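/- Fix $h>0$ and let the reduced phase space be $$M_h=\Big\{L=(\ell_{12},\ell_{13},\ell_{14},\ell_{23},\ell_{24},\ell_{34})\in\mathbb R^6:\ \textstyle\sum_{i<j}\ell_{ij}^2=2h,\ \ \ell_{12}\ell_{34}-\ell_{13}\ell_{24}+\ell_{14}\ell_{23}=0\Big\}\cong S^2\times S^2 .$$ For each of the systems below let $$J_i(L)=\frac2\pi\int_{\alpha_i}^{\beta_i}p_i(s)\,ds,\qquad i=1,2,3,$$ where $p_i=\sqrt{p_i^2}\ge 0$ and the functions $p_i^2$ and the intervals $[\alpha_i,\beta_i]$ (depending on $L$) are listed below. Wherever $r_1\le r_2$ appear together without a formula, they are the roots of the numerator of the $p^2$ indicated; these are quadratic polynomials in $s$ and have real roots for $L\in M_h$. 1. Ellipsoidal, $e_1<e_2<e_3<e_4$: with $\eta_1=\sum_{i<j}\ell_{ij}^2\sum_{k\ne i,j}e_k$ and $\eta_2=\sum_{i<j}\ell_{ij}^2\prod_{k\neq i,j}e_k$, $$p_1^2=p_2^2=p_3^2=-\frac{2hs^2-\eta_1s+\eta_2}{4\prod_{k=1}^4(s-e_k)},$$ intervals $[e_1,\min(r_1,e_2)]$,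 $[\max(r_1,e_2),\min(r_2,e_3)]$, $[\max(r_2,e_3),e_4]$. 2. Prolate, $b>1$: with $l=\ell_{23}$, $g=b\ell_{12}^2+b\ell_{13}^2+\ell_{14}^2$, $$p_1^2=p_3^2=\frac{-2hs^2+(g+2h+(b-1)l^2)s-g}{4s(s-b)(s-1)^2},\qquad p_2^2=\frac{l^2}{4s(1-s)},$$ intervals $[0,\min(r_1,1)]$, $[0,1]$, $[\max(1,r_2),b]$, with $r_1\le r_2$ from $p_1^2$. 3. Oblate, $a>1$: with $l=\ell_{34}$, $g=a\ell_{12}^2+\ell_{13}^2+\ell_{14}^2$, $$p_1^2=p_2^2=\frac{-2hs^2+(2ah+g-(a-1)l^2)s-ag}{4s(s-1)(s-a)^2},\qquad p_3^2=\frac{l^2}{4s(1-s)},$$ intervals $[0,\min(r_1,1)]$, $[\max(r_1,1),\min(r_2,a)]$, $[0,1]$, with $r_1\le r_2$ from $p_1^2$. 4. Lamé, $f_1<f_2<f_3$: with $f=\ell_{12}^2+\ell_{13}^2+\ell_{14}^2$, $g=f_1\ell_{34}^2+f_2\ell_{24}^2+f_3\ell_{23}^2$, $$p_1^2=\frac{f-2hs}{4(s-1)^2s},\qquad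 p_2^2=p_3^2=-\frac{(f-2h)s+g}{4(f_3-s)(s-f_1)(s-f_2)},$$ intervals $[0,\tfrac{f}{2h}]$, $[f_1,\min(r,f_2)]$, $[\max(f_2,r),f_3]$, with $r=\frac{g}{2h-f}$ (if $f=2h$ then $p_2=p_3=0$ identically, the value of $r$ is immaterial, and we take $r=f_2$). 5. Spherical: with $l=\ell_{34}$, $g=\ell_{12}^2+\ell_{13}^2+\ell_{14}^2$, $$p_1^2=\frac{g-2hs}{4s(s-1)^2},\qquad p_2^2=\frac{(g-2h)(s-1)-l^2}{4s(s-1)^2},\qquad p_3^2=\frac{l^2}{4s(1-s)},$$ intervals $[0,\tfrac{g}{2h}]$, $[0,1-\tfrac{l^2}{2h-g}]$, $[0,1]$ (if $g=2h$ then $l=0$, $p_2=0$ identically, and the second interval is taken to be $[0,1]$). 6. Cylindrical: $$p_1^2=\frac{\ell_{12}^2}{4s(1-s)},\qquad p_2^2=\frac{\ell_{12}^2(s-1)-s\,(2h(s-1)+\ell_{34}^2)}{4(s-1)^2s^2},\qquad p_3^2=\frac{\ell_{34}^2}{4s(1-s)},$$ intervals $[0,1]$, $[r_1,r_2]$, $[0,1]$,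 with $r_1\le r_2$ from $p_2^2$. Theorem. For each of these systems and all admissible parameter values, the following holds. For every $L\in M_h$ and every $i$ one has $\alpha_i\le\beta_i$, $p_i^2\ge0$ on $(\alpha_i,\beta_i)$, and the integral defining $J_i(L)$ converges; the action map $J=(J_1,J_2,J_3):M_h\to\mathbb R^3$ is continuous; and its image is exactly the triangle $$J(M_h)=\{(J_1,J_2,J_3)\in\mathbb R^3:\ J_1+J_2+J_3=\sqrt{2h},\ J_1,J_2,J_3\ge0\},$$ which is a (full, non-degenerate) equilateral triangle in Euclidean $\mathbb R^3$. -/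

import Mathlib

open Set

noncomputable section

namespace SphereActions

/-! ### The reduced phase space -/

/-- The dual of `so(4)`: a point `L` is the list of angular momenta
`(ℓ₁₂, ℓ₁₃, ℓ₁₄, ℓ₂₃, ℓ₂₄, ℓ₃₄)`. -/
abbrev AngMom : Type := Fin 6 → ℝ

def ell12 (L : AngMom) : ℝ := L 0
def ell13 (L : AngMom) : ℝ := L 1
def ell14 (L : AngMom) : ℝ := L 2
def ell23 (L : AngMom) : ℝ := L 3
def ell24 (L : AngMom) : ℝ := L 4
def ell34 (L : AngMom) : ℝ := L 5

/-- The first Casimir, equal to twice the energy of the geodesic flow. -/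
def casimir₁ (L : AngMom) : ℝ :=
  ell12 L ^ 2 + ell13 L ^ 2 + ell14 L ^ 2 + ell23 L ^ 2 + ell24 L ^ 2 + ell34 L ^ 2

/-- The second Casimir (the Pluecker relation). -/
def casimir₂ (L : AngMom) : ℝ :=
  ell12 L * ell34 L - ell13 L * ell24 L + ell14 L * ell23 L

/-- The reduced phase space at energy `h`: the symplectic leaf of `so(4)*`, diffeomorphic to the
product of two 2-spheres, on which the Casimirs take the values `2h` and `0`. -/
def reducedPhaseSpace (h : ℝ) : Set AngMom :=
  {L | casimir₁ L = 2 * h ∧ casimir₂ L = 0}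

/-! ### Actions of a separated system -/

/-- The data defining the symmetry reduced actions at one point of the phase space: for each degree
of freedom the squared separated momentum `p²` as a function of the separated coordinate, and the
end points of the interval over which `p` is integrated. -/
structure SeparatedData where
  sqMomentum : Fin 3 → ℝ → ℝ
  lo : Fin 3 → ℝ
  hi : Fin 3 → ℝ

/-- The interval of integration is a (possibly degenerate) interval of allowed motion, and the
improper integral of `p` over it converges. -/
def SeparatedData.Admissible (D : SeparatedData) (i : Fin 3) : Prop :=
  D.lo i ≤ D.hi i ∧
  (∀ s ∈ Ioo (D.lo i) (D.hi i), 0 ≤ D.sqMomentum i s) ∧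
  IntervalIntegrable (fun s => √(D.sqMomentum i s)) MeasureTheory.volume (D.lo i) (D.hi i)

/-- The symmetry reduced actions `Jᵢ = (2/π) ∫ p ds`. -/
def SeparatedData.actions (D : SeparatedData) : EuclideanSpace ℝ (Fin 3) :=
  WithLp.toLp 2 fun i => 2 / Real.pi * ∫ s in (D.lo i)..(D.hi i), √(D.sqMomentum i s)

/-- The triangle `J₁ + J₂ + J₃ = √(2h)`, `Jᵢ ≥ 0` in action space. -/
def actionTriangle (h : ℝ) : Set (EuclideanSpace ℝ (Fin 3)) :=
  {J | J 0 + J 1 + J 2 = √(2 * h) ∧ ∀ i, 0 ≤ J i}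

/-- The actions of the family `S` of separated data are well defined and continuous on the reduced
phase space of energy `h`, and the image of the reduced phase space under the action map is the
triangle. -/
def ActionImageIsTriangle (h : ℝ) (S : AngMom → SeparatedData) : Prop :=
  (∀ L ∈ reducedPhaseSpace h, ∀ i, (S L).Admissible i) ∧
  ContinuousOn (fun L => (S L).actions) (reducedPhaseSpace h) ∧
  (fun L => (S L).actions) '' reducedPhaseSpace h = actionTriangle h

/-- The smaller and the larger root of `a z² + b z + c`, for `a > 0`. -/
def smallRoot (a b c : ℝ) : ℝ := (-b - √(b ^ 2 - 4 * a * c)) / (2 * a)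
def largeRoot (a b c : ℝ) : ℝ := (-b + √(b ^ 2 - 4 * a * c)) / (2 * a)

/-! ### Ellipsoidal system, parameters `e₁ < e₂ < e₃ < e₄` -/

def eta₁ (e₁ e₂ e₃ e₄ : ℝ) (L : AngMom) : ℝ :=
  ell12 L ^ 2 * (e₃ + e₄) + ell13 L ^ 2 * (e₂ + e₄) + ell14 L ^ 2 * (e₂ + e₃)
    + ell23 L ^ 2 * (e₁ + e₄) + ell24 L ^ 2 * (e₁ + e₃) + ell34 L ^ 2 * (e₁ + e₂)

def eta₂ (e₁ e₂ e₃ e₄ : ℝ) (L : AngMom) : ℝ :=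
  ell12 L ^ 2 * (e₃ * e₄) + ell13 L ^ 2 * (e₂ * e₄) + ell14 L ^ 2 * (e₂ * e₃)
    + ell23 L ^ 2 * (e₁ * e₄) + ell24 L ^ 2 * (e₁ * e₃) + ell34 L ^ 2 * (e₁ * e₂)

/-- `p² = -R(s) / (4 A(s))` with `R(s) = 2h s² - η₁ s + η₂` and `A(s) = ∏ (s - eₖ)`; `r₁ ≤ r₂` are
the roots of `R`. -/
def ellipsoidal (h e₁ e₂ e₃ e₄ : ℝ) (L : AngMom) : SeparatedData :=
  let η₁ := eta₁ e₁ e₂ e₃ e₄ L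
  let η₂ := eta₂ e₁ e₂ e₃ e₄ L
  let r₁ := smallRoot (2 * h) (-η₁) η₂
  let r₂ := largeRoot (2 * h) (-η₁) η₂
  let psq : ℝ → ℝ := fun s =>
    -(2 * h * s ^ 2 - η₁ * s + η₂) / (4 * ((s - e₁) * (s - e₂) * (s - e₃) * (s - e₄)))
  { sqMomentum := ![psq, psq, psq]
    lo := ![e₁, max r₁ e₂, max r₂ e₃]
    hi := ![min r₁ e₂, min r₂ e₃, e₄] }

/-! ### Prolate system `(1 (2 3) 4)`, normalised to `(e₁, e₂ = e₃, e₄) = (0, 1, b)` -/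

def gPro (b : ℝ) (L : AngMom) : ℝ := b * ell12 L ^ 2 + b * ell13 L ^ 2 + ell14 L ^ 2

def prolate (h b : ℝ) (L : AngMom) : SeparatedData :=
  let g := gPro b L
  let l := ell23 L
  let r₁ := smallRoot (2 * h) (-(g + 2 * h + (b - 1) * l ^ 2)) g
  let r₂ := largeRoot (2 * h) (-(g + 2 * h + (b - 1) * l ^ 2)) g
  let psq : ℝ → ℝ := fun s =>
    (-(2 * h) * s ^ 2 + (g + 2 * h + (b - 1) * l ^ 2) * s - g) / (4 * s * (s - b) * (s - 1) ^ 2)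
  { sqMomentum := ![psq, fun s => l ^ 2 / (4 * s * (1 - s)), psq]
    lo := ![0, 0, max 1 r₂]
    hi := ![min r₁ 1, 1, b] }

/-! ### Oblate system `(1 2 (3 4))`, normalised to `(e₁, e₂, e₃ = e₄) = (0, 1, a)` -/

def gObl (a : ℝ) (L : AngMom) : ℝ := a * ell12 L ^ 2 + ell13 L ^ 2 + ell14 L ^ 2

def oblate (h a : ℝ) (L : AngMom) : SeparatedData :=
  let g := gObl a L
  let l := ell34 L
  let r₁ := smallRoot (2 * h) (-(2 * a * h + g - (a - 1) * l ^ 2)) (a * g)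
  let r₂ := largeRoot (2 * h) (-(2 * a * h + g - (a - 1) * l ^ 2)) (a * g)
  let psq : ℝ → ℝ := fun s =>
    (-(2 * h) * s ^ 2 + (2 * a * h + g - (a - 1) * l ^ 2) * s - a * g)
      / (4 * s * (s - 1) * (s - a) ^ 2)
  { sqMomentum := ![psq, psq, fun s => l ^ 2 / (4 * s * (1 - s))]
    lo := ![0, max r₁ 1, 0]
    hi := ![min r₁ 1, min r₂ a, 1] }

/-! ### Lame system `(1 (2 3 4))`, parameters `f₁ < f₂ < f₃` -/

def fLame (L : AngMom) : ℝ := ell12 L ^ 2 + ell13 L ^ 2 + ell14 L ^ 2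

def gLame (f₁ f₂ f₃ : ℝ) (L : AngMom) : ℝ :=
  f₁ * ell34 L ^ 2 + f₂ * ell24 L ^ 2 + f₃ * ell23 L ^ 2

open Classical in
/-- The root `r₂ = g / (2h - f)` of `p₂²` and `p₃²`. Where `f = 2h`, also `g = 0`, so that `p₂` and
`p₃` vanish identically; the value of `r₂` is then immaterial and is set to `f₂`. -/
def lameRoot (h f₁ f₂ f₃ : ℝ) (L : AngMom) : ℝ :=
  if fLame L = 2 * h then f₂ else gLame f₁ f₂ f₃ L / (2 * h - fLame L)

def lame (h f₁ f₂ f₃ : ℝ) (L : AngMom) : SeparatedData :=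
  let f := fLame L
  let g := gLame f₁ f₂ f₃ L
  let r₂ := lameRoot h f₁ f₂ f₃ L
  let psq : ℝ → ℝ := fun s =>
    -((f - 2 * h) * s + g) / (4 * (f₃ - s) * (s - f₁) * (s - f₂))
  { sqMomentum := ![fun s => (f - 2 * h * s) / (4 * (s - 1) ^ 2 * s), psq, psq]
    lo := ![0, f₁, max f₂ r₂]
    hi := ![f / (2 * h), min r₂ f₂, f₃] }

/-! ### Spherical system `(1 (2 (3 4)))` -/

/-- The integrals are `ℓ₃₄` and `g = ℓ₁₂² + ℓ₁₃² + ℓ₁₄²`. Where `g = 2h`, also `ℓ₃₄ = 0`, so that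
`p₂` vanishes identically and its integral is `0`. -/
def spherical (h : ℝ) (L : AngMom) : SeparatedData :=
  let g := fLame L
  let l := ell34 L
  { sqMomentum :=
      ![fun s => (g - 2 * h * s) / (4 * s * (s - 1) ^ 2),
        fun s => ((g - 2 * h) * (s - 1) - l ^ 2) / (4 * s * (s - 1) ^ 2),
        fun s => l ^ 2 / (4 * s * (1 - s))]
    lo := ![0, 0, 0]
    hi := ![g / (2 * h), 1 - l ^ 2 / (2 * h - g), 1] }

/-! ### Cylindrical system `((1 2) (3 4))` -/

/-- The integrals are `ℓ₁₂` and `ℓ₃₄`; `r₁ ≤ r₂` are the roots of the numerator of `p₂²`. -/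
def cylindrical (h : ℝ) (L : AngMom) : SeparatedData :=
  let k := ell12 L
  let l := ell34 L
  let r₁ := smallRoot (2 * h) (-(2 * h + k ^ 2 - l ^ 2)) (k ^ 2)
  let r₂ := largeRoot (2 * h) (-(2 * h + k ^ 2 - l ^ 2)) (k ^ 2)
  { sqMomentum :=
      ![fun s => k ^ 2 / (4 * s * (1 - s)),
        fun s => (k ^ 2 * (s - 1) - s * (2 * h * (s - 1) + l ^ 2)) / (4 * (s - 1) ^ 2 * s ^ 2),
        fun s => l ^ 2 / (4 * s * (1 - s))]
    lo := ![0, r₁, 0]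
    hi := ![1, r₂, 1] }

end SphereActions

end

/-! All systems are reduced to one density, `dens`, the square root of -(s - r₁)(s - r₂) / ∏ (s -
eₖ). As `Real.sqrt` vanishes on negative numbers, the integral of a momentum over an interval that
ends at a root equals, up to the factor √(2h)/2, the integral of `dens` over a fixed interval
between neighbouring parameters (`SeparatedData.hasAction_of_dens`). The actions thus become
functions of the pair (r₁, r₂), continuous by dominated convergence.

Which pairs occur: the Plücker relation and the inequality 2ab ≤ a² + b² make the roots real with e₁
≤ r₁ ≤ e₃ and e₂ ≤ r₂ ≤ e₄ (`exists_quadratic_nonpos`, `sepRoots_spec`), and every such ordered pair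
is attained (`exists_sepRoots_eq`).

Why the actions add up to √(2h): `cdens`, a quotient of holomorphic square roots, decays like 1/z in
the upper half plane, and by the interlacing of roots and poles its boundary values have imaginary
part -`dens`. Comparison with 1/(z + i), whose boundary imaginary part is -1/(1 + x²), gives total
integral π (`integral_dens`). If two parameters merge, as in the prolate and oblate systems, the
pair of poles leaves half a residue (`integral_dens_double_pole`), which is the action |ℓ| of the
rotational degree of freedom.

Why the whole triangle is attained: the first action increases with r₂, the third decreases with r₁,
and the middle one vanishes on the part of the boundary where r₁ = e₃, r₂ = e₂ or r₁ = r₂. An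
extremal argument then finds a pair with prescribed outer actions (`exists_mem_rootRegion_eq`).

The spherical and cylindrical actions are elementary functions of L. In the Lamé system the radial
action is elementary, and the remaining amount √(2h - f) is shared between the other two in a ratio
that depends on one root and sweeps out [0, 1] by the intermediate value theorem. -/

noncomputable section

open MeasureTheory Filter Topology

namespace SphereActions

/-! ### Integrability of inverse square roots -/

/-- The function `|x - a|^(-1/2)`. -/
def invSqrtDist (a x : ℝ) : ℝ := (√|x - a|)⁻¹

theorem invSqrtDist_nonneg (a x : ℝ) : 0 ≤ invSqrtDist a x := by
  unfold invSqrtDist; positivity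

theorem measurable_invSqrtDist (a : ℝ) : Measurable (invSqrtDist a) := by
  unfold invSqrtDist; fun_prop

theorem intervalIntegrable_invSqrtDist (c a b : ℝ) :
    IntervalIntegrable (invSqrtDist c) volume a b := by
  have key : ∀ a b : ℝ, IntervalIntegrable (fun x : ℝ => (√|x|)⁻¹) volume a b := by
    intro a b
    have h1 : IntervalIntegrable (fun x : ℝ => x ^ (-(1 / 2) : ℝ)) volume a b :=
      intervalIntegral.intervalIntegrable_rpow' (by norm_num)
    have h2 : IntervalIntegrable (fun x : ℝ => (-x) ^ (-(1 / 2) : ℝ)) volume a b := by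
      have h : IntervalIntegrable (fun x : ℝ => x ^ (-(1 / 2) : ℝ)) volume (-a) (-b) :=
        intervalIntegral.intervalIntegrable_rpow' (by norm_num)
      simpa using h.comp_sub_left 0
    have hpos : ∀ y : ℝ, 0 < y → y ^ (-(1 / 2) : ℝ) = (√|y|)⁻¹ := by
      intro y hy
      rw [Real.rpow_neg hy.le, ← Real.sqrt_eq_rpow, abs_of_pos hy]
    -- For a negative base `Real.rpow` carries the factor cos(π · exponent), here 0. Hence x^(-1/2)
    -- + (-x)^(-1/2) is |x|^(-1/2) off the origin.
    have hneg : ∀ y : ℝ, y < 0 → y ^ (-(1 / 2) : ℝ) = 0 := by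
      intro y hy
      rw [Real.rpow_def_of_neg hy, show (-(1 / 2) : ℝ) * Real.pi = -(Real.pi / 2) by ring,
        Real.cos_neg, Real.cos_pi_div_two, mul_zero]
    refine (h1.add h2).congr_ae ?_
    refine ae_restrict_of_ae ?_
    filter_upwards [Measure.ae_ne volume (0 : ℝ)] with x hx
    rcases lt_or_gt_of_ne hx with h | h
    · rw [hneg x h, hpos (-x) (by linarith), abs_neg, zero_add]
    · rw [hneg (-x) (by linarith), hpos x h, add_zero]
  have := (key (a - c) (b - c)).comp_sub_right c
  simp only [sub_add_cancel] at this
  exact this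

/-- One of the two points lies at distance at least |a - b| / 2 from x, so its factor is bounded.
Singularities at distinct points therefore never reinforce each other. -/
theorem invSqrtDist_mul_le {a b : ℝ} (hab : a ≠ b) (x : ℝ) :
    invSqrtDist a x * invSqrtDist b x ≤
      (√(|a - b| / 2))⁻¹ * (invSqrtDist a x + invSqrtDist b x) := by
  have hd : 0 < |a - b| := abs_pos.mpr (sub_ne_zero.mpr hab)
  have hs : 0 < √(|a - b| / 2) := Real.sqrt_pos.mpr (by linarith)
  have far : ∀ c, |a - b| / 2 ≤ |x - c| → invSqrtDist c x ≤ (√(|a - b| / 2))⁻¹ := by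
    intro c hc
    exact inv_anti₀ hs (Real.sqrt_le_sqrt hc)
  have ha := invSqrtDist_nonneg a x
  have hb := invSqrtDist_nonneg b x
  have hC : 0 ≤ (√(|a - b| / 2))⁻¹ := by positivity
  have tri : |a - b| ≤ |x - a| + |x - b| := by
    rw [abs_sub_comm x a]
    simpa using abs_sub_le a x b
  rcases le_total (|a - b| / 2) |x - a| with h | h
  · nlinarith [mul_le_mul_of_nonneg_right (far a h) hb, mul_nonneg hC ha]
  · nlinarith [mul_le_mul_of_nonneg_right (far b (by linarith)) ha, mul_nonneg hC hb]

theorem intervalIntegrable_of_nonneg_of_le {f g : ℝ → ℝ} {x y : ℝ}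
    (hg : IntervalIntegrable g volume x y) (hf : Measurable f) (h0 : ∀ s, 0 ≤ f s)
    (hfg : ∀ s, f s ≤ g s) : IntervalIntegrable f volume x y :=
  hg.mono_fun hf.aestronglyMeasurable (Eventually.of_forall fun s => by
    beta_reduce
    rw [Real.norm_of_nonneg (h0 s), Real.norm_of_nonneg ((h0 s).trans (hfg s))]
    exact hfg s)

theorem intervalIntegrable_invSqrtDist_mul {a b : ℝ} (hab : a ≠ b) {f : ℝ → ℝ} {x y : ℝ}
    (hf : Measurable f) (h0 : ∀ s, 0 ≤ f s)
    (ha : IntervalIntegrable (fun s => invSqrtDist a s * f s) volume x y)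
    (hb : IntervalIntegrable (fun s => invSqrtDist b s * f s) volume x y) :
    IntervalIntegrable (fun s => invSqrtDist a s * (invSqrtDist b s * f s)) volume x y := by
  refine intervalIntegrable_of_nonneg_of_le ((ha.add hb).const_mul (√(|a - b| / 2))⁻¹) ?_ ?_ ?_
  · exact (measurable_invSqrtDist a).mul ((measurable_invSqrtDist b).mul hf)
  · intro s
    exact mul_nonneg (invSqrtDist_nonneg a s) (mul_nonneg (invSqrtDist_nonneg b s) (h0 s))
  · intro s
    have := mul_le_mul_of_nonneg_right (invSqrtDist_mul_le hab s) (h0 s)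
    linarith

theorem intervalIntegrable_invSqrtDist_two {a b : ℝ} (hab : a ≠ b) (x y : ℝ) :
    IntervalIntegrable (fun s => invSqrtDist a s * invSqrtDist b s) volume x y := by
  have := intervalIntegrable_invSqrtDist_mul (f := fun _ => 1) (x := x) (y := y) hab
    measurable_const (fun _ => zero_le_one)
    (by simpa using intervalIntegrable_invSqrtDist a x y)
    (by simpa using intervalIntegrable_invSqrtDist b x y)
  simpa using this

theorem intervalIntegrable_invSqrtDist_three {a b c : ℝ} (hab : a ≠ b) (hac : a ≠ c)
    (hbc : b ≠ c) (x y : ℝ) :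
    IntervalIntegrable (fun s => invSqrtDist a s * (invSqrtDist b s * invSqrtDist c s))
      volume x y :=
  intervalIntegrable_invSqrtDist_mul hab (measurable_invSqrtDist c)
    (invSqrtDist_nonneg c) (intervalIntegrable_invSqrtDist_two hac x y)
    (intervalIntegrable_invSqrtDist_two hbc x y)

theorem intervalIntegrable_invSqrtDist_four {a b c d : ℝ} (hab : a ≠ b) (hac : a ≠ c)
    (had : a ≠ d) (hbc : b ≠ c) (hbd : b ≠ d) (hcd : c ≠ d) (x y : ℝ) :
    IntervalIntegrable
      (fun s => invSqrtDist a s * (invSqrtDist b s * (invSqrtDist c s * invSqrtDist d s)))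
      volume x y :=
  intervalIntegrable_invSqrtDist_mul hab
    ((measurable_invSqrtDist c).mul (measurable_invSqrtDist d))
    (fun s => mul_nonneg (invSqrtDist_nonneg c s) (invSqrtDist_nonneg d s))
    (intervalIntegrable_invSqrtDist_three hac had hcd x y)
    (intervalIntegrable_invSqrtDist_three hbc hbd hcd x y)

/-! ### The density of the actions -/

/-- The square root of the positive part of
`-(s - r₁)(s - r₂) / ((s - e₁)(s - e₂)(s - e₃)(s - e₄))`. -/
def dens (r₁ r₂ e₁ e₂ e₃ e₄ s : ℝ) : ℝ :=
  √(-((s - r₁) * (s - r₂)) / ((s - e₁) * (s - e₂) * (s - e₃) * (s - e₄)))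

theorem dens_nonneg (r₁ r₂ e₁ e₂ e₃ e₄ s : ℝ) : 0 ≤ dens r₁ r₂ e₁ e₂ e₃ e₄ s :=
  Real.sqrt_nonneg _

theorem measurable_dens (r₁ r₂ e₁ e₂ e₃ e₄ : ℝ) : Measurable (dens r₁ r₂ e₁ e₂ e₃ e₄) := by
  unfold dens; fun_prop

theorem dens_le (r₁ r₂ e₁ e₂ e₃ e₄ s : ℝ) :
    dens r₁ r₂ e₁ e₂ e₃ e₄ s ≤ √|s - r₁| * √|s - r₂| *
      (invSqrtDist e₁ s * (invSqrtDist e₂ s * (invSqrtDist e₃ s * invSqrtDist e₄ s))) := by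
  have h1 : dens r₁ r₂ e₁ e₂ e₃ e₄ s ≤ √(|s - r₁| * |s - r₂| /
      (|s - e₁| * |s - e₂| * |s - e₃| * |s - e₄|)) := by
    refine Real.sqrt_le_sqrt ((le_abs_self _).trans_eq ?_)
    simp only [abs_div, abs_neg, abs_mul]
  refine h1.trans_eq ?_
  rw [Real.sqrt_div (by positivity), Real.sqrt_mul (by positivity), Real.sqrt_mul (by positivity),
    Real.sqrt_mul (by positivity), Real.sqrt_mul (by positivity)]
  unfold invSqrtDist
  rw [div_eq_mul_inv, mul_inv, mul_inv, mul_inv]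
  ring

theorem continuous_dens_roots (e₁ e₂ e₃ e₄ s : ℝ) :
    Continuous fun p : ℝ × ℝ => dens p.1 p.2 e₁ e₂ e₃ e₄ s := by
  unfold dens; fun_prop

/-! ### Some elementary integrals -/

theorem hasDerivAt_arcsin_linear {a b s : ℝ} (h : s ∈ Ioo a b) :
    HasDerivAt (fun s => Real.arcsin ((2 * s - a - b) / (b - a))) (1 / √((s - a) * (b - s))) s := by
  obtain ⟨h1, h2⟩ := h
  have hba : 0 < b - a := by linarith
  have hx1 : (2 * s - a - b) / (b - a) ≠ -1 := by
    rw [Ne, div_eq_iff hba.ne']; intro h; linarith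
  have hx2 : (2 * s - a - b) / (b - a) ≠ 1 := by
    rw [Ne, div_eq_iff hba.ne']; intro h; linarith
  have hl : HasDerivAt (fun s : ℝ => (2 * s - a - b) / (b - a)) (2 / (b - a)) s := by
    have := ((((hasDerivAt_id s).const_mul 2).sub_const a).sub_const b).div_const (b - a)
    simpa using this
  have := (Real.hasDerivAt_arcsin hx1 hx2).comp s hl
  refine this.congr_deriv ?_
  have hp : 0 < (s - a) * (b - s) := mul_pos (by linarith) (by linarith)
  have e : 1 - ((2 * s - a - b) / (b - a)) ^ 2 = (2 / (b - a)) ^ 2 * ((s - a) * (b - s)) := by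
    field_simp; ring
  rw [e, Real.sqrt_mul (by positivity), Real.sqrt_sq (by positivity)]
  have := Real.sqrt_pos.mpr hp
  field_simp

theorem continuous_arcsin_linear (a b : ℝ) :
    Continuous (fun s => Real.arcsin ((2 * s - a - b) / (b - a))) := by
  fun_prop

/-- Convergence needs no estimate: a nonnegative derivative of a function continuous up to the end
points is integrable. -/
theorem intervalIntegrable_arcsine {a b : ℝ} (hab : a < b) :
    IntervalIntegrable (fun s => 1 / √((s - a) * (b - s))) volume a b := by
  refine intervalIntegral.intervalIntegrable_deriv_of_nonneg
    (continuous_arcsin_linear a b).continuousOn (fun s hs => ?_) (fun s _ => by positivity)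
  rw [min_eq_left hab.le, max_eq_right hab.le] at hs
  exact hasDerivAt_arcsin_linear hs

theorem integral_arcsine {a b : ℝ} (hab : a < b) :
    ∫ s in a..b, 1 / √((s - a) * (b - s)) = Real.pi := by
  rw [intervalIntegral.integral_eq_sub_of_hasDerivAt_of_le hab.le
    (continuous_arcsin_linear a b).continuousOn (fun s hs => hasDerivAt_arcsin_linear hs)
    (intervalIntegrable_arcsine hab)]
  have hba : b - a ≠ 0 := by linarith
  rw [show (2 * b - a - b) / (b - a) = 1 by field_simp; ring,
    show (2 * a - a - b) / (b - a) = -1 by field_simp; ring, Real.arcsin_one, Real.arcsin_neg_one]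
  ring

/-- The argument of the arcsine is, up to sign, the linear one for the variable 1/s on [1/b, 1/a].
It supplies the part of √((s - a)(b - s)) / s that is singular at s = 0. -/
theorem hasDerivAt_arcsin_inv {a b s : ℝ} (ha : 0 < a) (h : s ∈ Ioo a b) :
    HasDerivAt (fun s => Real.arcsin (((a + b) * s - 2 * a * b) / (s * (b - a))))
      (√(a * b) / (s * √((s - a) * (b - s)))) s := by
  obtain ⟨h1, h2⟩ := h
  have hba : 0 < b - a := by linarith
  have hs : 0 < s := ha.trans h1
  have hb : 0 < b := hs.trans h2
  have hx1 : ((a + b) * s - 2 * a * b) / (s * (b - a)) ≠ -1 := by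
    rw [Ne, div_eq_iff (by positivity)]; intro h
    have : b * (s - a) = 0 := by linarith
    rcases mul_eq_zero.mp this with h | h <;> linarith
  have hx2 : ((a + b) * s - 2 * a * b) / (s * (b - a)) ≠ 1 := by
    rw [Ne, div_eq_iff (by positivity)]; intro h
    have : a * (b - s) = 0 := by linarith
    rcases mul_eq_zero.mp this with h | h <;> linarith
  have hl : HasDerivAt (fun s : ℝ => ((a + b) * s - 2 * a * b) / (s * (b - a)))
      (2 * a * b / (s ^ 2 * (b - a))) s := by
    have n := ((hasDerivAt_id s).const_mul (a + b)).sub_const (2 * a * b)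
    have d := (hasDerivAt_id s).mul_const (b - a)
    refine (n.div d (by simp; constructor <;> positivity)).congr_deriv ?_
    simp only [id]
    field_simp
    ring
  have := (Real.hasDerivAt_arcsin hx1 hx2).comp s hl
  refine this.congr_deriv ?_
  have hp : 0 < (s - a) * (b - s) := mul_pos (by linarith) (by linarith)
  have e : 1 - (((a + b) * s - 2 * a * b) / (s * (b - a))) ^ 2
      = (2 / (s * (b - a))) ^ 2 * ((a * b) * ((s - a) * (b - s))) := by
    field_simp; ring
  rw [e, Real.sqrt_mul (by positivity), Real.sqrt_sq (by positivity),
    Real.sqrt_mul (by positivity)]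
  have h3 := Real.sqrt_pos.mpr hp
  have h4 := Real.sqrt_pos.mpr (mul_pos ha hb)
  have h5 := Real.mul_self_sqrt (mul_pos ha hb).le
  rw [show 2 * a * b = 2 * (√(a * b) * √(a * b)) by rw [h5]; ring]
  generalize √(a * b) = q at *
  field_simp

theorem hasDerivAt_sqrt_semicircle {a b s : ℝ} (h : s ∈ Ioo a b) :
    HasDerivAt (fun s => √((s - a) * (b - s)))
      ((a + b - 2 * s) / (2 * √((s - a) * (b - s)))) s := by
  have hp : 0 < (s - a) * (b - s) := mul_pos (by linarith [h.1]) (by linarith [h.2])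
  have := (((hasDerivAt_id s).sub_const a).mul ((hasDerivAt_id s).const_sub b)).sqrt hp.ne'
  refine this.congr_deriv ?_
  simp only [id, Pi.mul_apply]
  ring

/-- An antiderivative of `√((s - a)(b - s)) / s` and its increment over `[a, b]`. -/
theorem integral_sqrt_div {a b : ℝ} (ha : 0 ≤ a) (hab : a ≤ b) :
    IntervalIntegrable (fun s => √((s - a) * (b - s)) / s) volume a b ∧
    ∫ s in a..b, √((s - a) * (b - s)) / s = Real.pi * ((a + b) / 2 - √(a * b)) := by
  rcases hab.eq_or_lt with rfl | hab
  · refine ⟨by simp, ?_⟩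
    rw [intervalIntegral.integral_same, Real.sqrt_mul_self ha]
    ring
  have hba : b - a ≠ 0 := by linarith
  let A : ℝ → ℝ := fun s => √(a * b) *
    Real.arcsin (((a + b) * s - 2 * a * b) / (s * (b - a)))
  let F : ℝ → ℝ := fun s => √((s - a) * (b - s)) +
    (a + b) / 2 * Real.arcsin ((2 * s - a - b) / (b - a)) - A s
  have hA : ContinuousOn A (Icc a b) ∧ (∀ s ∈ Ioo a b, HasDerivAt A
      (√(a * b) * (√(a * b) / (s * √((s - a) * (b - s))))) s) ∧
      A b - A a = √(a * b) * Real.pi := by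
    -- For a = 0 the argument of the arcsine jumps at s = 0, but the prefactor √(ab) removes the
    -- whole term.
    rcases ha.eq_or_lt with rfl | ha
    · have hA0 : A = fun _ => 0 := by funext s; simp [A]
      rw [hA0]
      refine ⟨continuousOn_const, fun s hs => ?_, by simp⟩
      simpa using hasDerivAt_const s (0 : ℝ)
    · refine ⟨?_, fun s hs => (hasDerivAt_arcsin_inv ha hs).const_mul _, ?_⟩
      · refine continuousOn_const.mul (Real.continuous_arcsin.comp_continuousOn ?_)
        refine ContinuousOn.div (by fun_prop) (by fun_prop) fun s hs => ?_
        exact mul_ne_zero (ha.trans_le hs.1).ne' hba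
      · have hb : 0 < b := ha.trans hab
        simp only [A]
        rw [show ((a + b) * b - 2 * a * b) / (b * (b - a)) = 1 by field_simp; ring,
          show ((a + b) * a - 2 * a * b) / (a * (b - a)) = -1 by field_simp; ring,
          Real.arcsin_one, Real.arcsin_neg_one]
        ring
  obtain ⟨hAc, hAd, hAv⟩ := hA
  have hFc : ContinuousOn F (Icc a b) := by
    refine ContinuousOn.sub (Continuous.continuousOn ?_) hAc
    exact Continuous.add (by fun_prop) (continuous_const.mul (continuous_arcsin_linear a b))
  have hFd : ∀ s ∈ Ioo a b, HasDerivAt F (√((s - a) * (b - s)) / s) s := by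
    intro s hs
    have := ((hasDerivAt_sqrt_semicircle hs).add
      ((hasDerivAt_arcsin_linear hs).const_mul ((a + b) / 2))).sub (hAd s hs)
    refine this.congr_deriv ?_
    have hs0 : 0 < s := ha.trans_lt hs.1
    have hp : 0 < (s - a) * (b - s) := mul_pos (by linarith [hs.1]) (by linarith [hs.2])
    have h3 := Real.sqrt_pos.mpr hp
    have h4 := Real.sq_sqrt hp.le
    have h5 := Real.sq_sqrt (mul_nonneg ha (ha.trans hab.le))
    field_simp
    rw [h5, h4]
    ring
  have hint : IntervalIntegrable (fun s => √((s - a) * (b - s)) / s) volume a b := by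
    refine intervalIntegral.intervalIntegrable_deriv_of_nonneg (g := F)
      (by rwa [uIcc_of_le hab.le]) ?_ ?_ <;> rw [min_eq_left hab.le, max_eq_right hab.le]
    · exact hFd
    · intro s hs
      have hs0 : 0 < s := ha.trans_lt hs.1
      positivity
  refine ⟨hint, ?_⟩
  rw [intervalIntegral.integral_eq_sub_of_hasDerivAt_of_le hab.le hFc hFd hint]
  simp only [F]
  rw [show (2 * b - a - b) / (b - a) = 1 by field_simp; ring,
    show (2 * a - a - b) / (b - a) = -1 by field_simp; ring, Real.arcsin_one,
    Real.arcsin_neg_one]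
  simp only [sub_self, mul_zero, zero_mul, Real.sqrt_zero]
  linear_combination -hAv

/-- Partial fractions 1/(s(1 - s)) = 1/s + 1/(1 - s); the second summand is the first one after the
reflection s ↦ 1 - s. -/
theorem integral_sqrt_div_mul {a b : ℝ} (ha : 0 ≤ a) (hab : a ≤ b) (hb : b ≤ 1) :
    IntervalIntegrable (fun s => √((s - a) * (b - s)) / (s * (1 - s))) volume a b ∧
    ∫ s in a..b, √((s - a) * (b - s)) / (s * (1 - s))
      = Real.pi * (1 - √(a * b) - √((1 - a) * (1 - b))) := by
  obtain ⟨i1, v1⟩ := integral_sqrt_div ha hab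
  obtain ⟨i2, v2⟩ := integral_sqrt_div (a := 1 - b) (b := 1 - a) (by linarith) (by linarith)
  have i3 : IntervalIntegrable (fun s => √((s - a) * (b - s)) / (1 - s)) volume a b := by
    have := (i2.comp_sub_left 1).symm
    simp only [sub_sub_cancel] at this
    refine this.congr fun s _ => ?_
    ring_nf
  have v3 : ∫ s in a..b, √((s - a) * (b - s)) / (1 - s)
      = Real.pi * (((1 - b) + (1 - a)) / 2 - √((1 - b) * (1 - a))) := by
    rw [← v2, ← intervalIntegral.integral_comp_sub_left _ 1]
    refine intervalIntegral.integral_congr fun s _ => ?_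
    ring_nf
  have hE : ∀ s ∈ Ioo a b, √((s - a) * (b - s)) / s + √((s - a) * (b - s)) / (1 - s)
      = √((s - a) * (b - s)) / (s * (1 - s)) := by
    intro s hs
    have h1 : s ≠ 0 := by linarith [hs.1]
    have h2 : 1 - s ≠ 0 := by linarith [hs.2]
    field_simp
    ring
  have hE' : ∀ᵐ s, s ∈ uIoc a b → √((s - a) * (b - s)) / s + √((s - a) * (b - s)) / (1 - s)
      = √((s - a) * (b - s)) / (s * (1 - s)) := by
    filter_upwards [Measure.ae_ne volume b] with s hs hs'
    rw [uIoc_of_le hab] at hs'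
    exact hE s ⟨hs'.1, lt_of_le_of_ne hs'.2 hs⟩
  refine ⟨(i1.add i3).congr_ae ((ae_restrict_iff' measurableSet_uIoc).mpr hE'), ?_⟩
  rw [← intervalIntegral.integral_congr_ae hE', intervalIntegral.integral_add i1 i3, v1, v3,
    mul_comm (1 - b)]
  ring

/-! ### A square root on the closed upper half plane -/

/-- The branch of the square root that is holomorphic on `ℂ` minus the negative imaginary axis. -/
def csq (z : ℂ) : ℂ := Complex.exp (Real.pi / 4 * Complex.I) * (-Complex.I * z) ^ (1 / 2 : ℂ)

theorem csq_sq (z : ℂ) : csq z ^ 2 = z := by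
  unfold csq
  rw [mul_pow, ← Complex.exp_nat_mul, one_div,
    show (2⁻¹ : ℂ) = ((2 : ℕ) : ℂ)⁻¹ by norm_num, Complex.cpow_nat_inv_pow _ two_ne_zero,
    show ((2 : ℕ) : ℂ) * (Real.pi / 4 * Complex.I) = Real.pi / 2 * Complex.I by push_cast; ring,
    Complex.exp_pi_div_two_mul_I, ← mul_assoc]
  simp

theorem norm_csq (z : ℂ) : ‖csq z‖ = √‖z‖ := by
  have h : ‖csq z‖ ^ 2 = ‖z‖ := by rw [← norm_pow, csq_sq]
  rw [← h, Real.sqrt_sq (norm_nonneg _)]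

theorem csq_ne_zero {z : ℂ} (hz : z ≠ 0) : csq z ≠ 0 := by
  intro h
  have := csq_sq z
  rw [h] at this
  exact hz (by rw [← this]; norm_num)

theorem neg_I_mul_mem_slitPlane {z : ℂ} (hz : 0 ≤ z.im) (h0 : z ≠ 0) :
    -Complex.I * z ∈ Complex.slitPlane := by
  rw [Complex.mem_slitPlane_iff]
  simp only [Complex.mul_re, Complex.neg_re, Complex.I_re, Complex.neg_im, Complex.I_im,
    Complex.mul_im]
  rcases hz.eq_or_lt with h | h
  · right
    intro h'
    exact h0 (Complex.ext (by simp; linarith) (by simp [← h]))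
  · left; linarith

theorem differentiableAt_csq {z : ℂ} (hz : 0 ≤ z.im) (h0 : z ≠ 0) : DifferentiableAt ℂ csq z := by
  unfold csq
  refine DifferentiableAt.const_mul ?_ _
  exact DifferentiableAt.cpow (by fun_prop) (by fun_prop) (neg_I_mul_mem_slitPlane hz h0)

/-- For z in the closed upper half plane -iz has argument in [-π/2, π/2]; halving it and adding π/4
lands in [0, π/2]. -/
theorem csq_re_im_nonneg {z : ℂ} (hz : 0 ≤ z.im) : 0 ≤ (csq z).re ∧ 0 ≤ (csq z).im := by
  rcases eq_or_ne z 0 with rfl | h0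
  · simp [csq]
  have hw : -Complex.I * z ≠ 0 := mul_ne_zero (neg_ne_zero.mpr Complex.I_ne_zero) h0
  have harg : |(-Complex.I * z).arg| ≤ Real.pi / 2 :=
    Complex.abs_arg_le_pi_div_two_iff.mpr (by simpa using hz)
  obtain ⟨h1, h2⟩ := abs_le.mp harg
  have key : csq z = Complex.exp (Real.pi / 4 * Complex.I + Complex.log (-Complex.I * z) *
      (1 / 2)) := by
    rw [csq, Complex.cpow_def_of_ne_zero hw, Complex.exp_add]
  have him : (Real.pi / 4 * Complex.I + Complex.log (-Complex.I * z) * (1 / 2)).im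
      = Real.pi / 4 + (-Complex.I * z).arg / 2 := by
    rw [show (Real.pi / 4 * Complex.I + Complex.log (-Complex.I * z) * (1 / 2) : ℂ)
      = ((Real.pi / 4 : ℝ) : ℂ) * Complex.I + Complex.log (-Complex.I * z) * ((1 / 2 : ℝ) : ℂ) by
        push_cast; ring, Complex.add_im, Complex.im_mul_ofReal, Complex.im_ofReal_mul,
      Complex.I_im, Complex.log_im]
    ring
  rw [key, Complex.exp_re, Complex.exp_im, him]
  refine ⟨mul_nonneg (Real.exp_nonneg _) (Real.cos_nonneg_of_mem_Icc ⟨by linarith, by linarith⟩),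
    mul_nonneg (Real.exp_nonneg _) (Real.sin_nonneg_of_nonneg_of_le_pi (by linarith) ?_)⟩
  linarith [Real.pi_pos]

theorem csq_ofReal (y : ℝ) : (csq y).re * (csq y).im = 0 ∧ (csq y).re ^ 2 - (csq y).im ^ 2 = y := by
  have h := csq_sq y
  rw [sq] at h
  have h1 := congrArg Complex.re h
  have h2 := congrArg Complex.im h
  simp only [Complex.mul_re, Complex.mul_im, Complex.ofReal_re, Complex.ofReal_im] at h1 h2
  constructor <;> linarith

theorem csq_ofReal_of_pos {y : ℝ} (hy : 0 < y) : csq y = (√|y| : ℝ) := by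
  obtain ⟨h1, h2⟩ := csq_ofReal y
  obtain ⟨h3, -⟩ := csq_re_im_nonneg (z := y) (by simp)
  have hr : (csq y).re ≠ 0 := fun h => by rw [h] at h2; nlinarith [sq_nonneg (csq y).im]
  have hi : (csq y).im = 0 := (mul_eq_zero.mp h1).resolve_left hr
  refine Complex.ext ?_ (by rw [hi, Complex.ofReal_im])
  have h4 : (csq y).re ^ 2 = y := by rw [hi] at h2; linarith
  rw [Complex.ofReal_re, abs_of_pos hy, ← Real.sqrt_sq h3, h4]

theorem csq_ofReal_of_neg {y : ℝ} (hy : y < 0) : csq y = (√|y| : ℝ) * Complex.I := by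
  obtain ⟨h1, h2⟩ := csq_ofReal y
  obtain ⟨-, h3⟩ := csq_re_im_nonneg (z := y) (by simp)
  have hi : (csq y).im ≠ 0 := fun h => by rw [h] at h2; nlinarith [sq_nonneg (csq y).re]
  have hr : (csq y).re = 0 := (mul_eq_zero.mp h1).resolve_right hi
  refine Complex.ext (by simp [hr]) ?_
  have h4 : (csq y).im ^ 2 = -y := by rw [hr] at h2; linarith
  rw [Complex.im_ofReal_mul, Complex.I_im, mul_one, abs_of_neg hy, ← Real.sqrt_sq h3, h4]

/-- Difference of squares: (√(z - x) - √z)(√(z - x) + √z) = -x. Both roots lie in the first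
quadrant, so their sum has no cancellation and is at least |√z| in modulus. -/
theorem norm_csq_sub_div_sub_one_le (x : ℝ) {z : ℂ} (hz : 0 ≤ z.im) (h0 : z ≠ 0) :
    ‖csq (z - x) / csq z - 1‖ ≤ |x| / ‖z‖ := by
  obtain ⟨a1, a2⟩ := csq_re_im_nonneg hz
  obtain ⟨b1, b2⟩ := csq_re_im_nonneg (z := z - x) (by simpa using hz)
  have hq : csq z ≠ 0 := csq_ne_zero h0
  have hq' : 0 < ‖csq z‖ := norm_pos_iff.mpr hq
  have hsum : ‖csq z‖ ≤ ‖csq (z - x) + csq z‖ := by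
    rw [Complex.norm_eq_sqrt_sq_add_sq, Complex.norm_eq_sqrt_sq_add_sq]
    refine Real.sqrt_le_sqrt ?_
    simp only [Complex.add_re, Complex.add_im]
    gcongr <;> linarith
  have hdiff : (csq (z - x) - csq z) * (csq (z - x) + csq z) = -x := by
    linear_combination csq_sq (z - x) - csq_sq z
  have hnd : ‖csq (z - x) - csq z‖ * ‖csq (z - x) + csq z‖ = |x| := by
    rw [← norm_mul, hdiff, norm_neg, Complex.norm_real, Real.norm_eq_abs]
  have hz2 : ‖z‖ = ‖csq z‖ * ‖csq z‖ := by rw [← norm_mul, ← sq, csq_sq]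
  rw [div_sub_one hq, norm_div, hz2, div_le_div_iff₀ hq' (by positivity), ← hnd]
  have := mul_le_mul_of_nonneg_left hsum (norm_nonneg (csq (z - x) - csq z))
  nlinarith

theorem tendsto_csq_sub_div (x : ℝ) :
    Tendsto (fun z : ℂ => csq (z - x) / csq z) (Bornology.cobounded ℂ ⊓ 𝓟 {z | 0 ≤ z.im})
      (𝓝 1) := by
  rw [tendsto_iff_norm_sub_tendsto_zero]
  have h : Tendsto (fun z : ℂ => |x| / ‖z‖) (Bornology.cobounded ℂ ⊓ 𝓟 {z | 0 ≤ z.im}) (𝓝 0) :=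
    (tendsto_const_nhds.div_atTop tendsto_norm_cobounded_atTop).mono_left inf_le_left
  have hne : ∀ᶠ z : ℂ in Bornology.cobounded ℂ, z ≠ 0 := by
    filter_upwards [tendsto_norm_cobounded_atTop.eventually_gt_atTop 0] with z hz
    exact norm_pos_iff.mp hz
  refine squeeze_zero' (Eventually.of_forall fun _ => norm_nonneg _) ?_ h
  filter_upwards [mem_inf_of_left hne, mem_inf_of_right (mem_principal_self _)] with z h0 hz
  exact norm_csq_sub_div_sub_one_le x hz h0

/-! ### The contour integral -/

/-- The holomorphic function on the upper half plane whose boundary values give the density. -/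
def cdens (r₁ r₂ e₁ e₂ e₃ e₄ : ℝ) (z : ℂ) : ℂ :=
  csq (z - r₁) * csq (z - r₂) / (csq (z - e₁) * csq (z - e₂) * csq (z - e₃) * csq (z - e₄))

theorem differentiableAt_cdens {r₁ r₂ e₁ e₂ e₃ e₄ : ℝ} {z : ℂ} (hz : 0 ≤ z.im)
    (h : ∀ a ∈ ({r₁, r₂, e₁, e₂, e₃, e₄} : Set ℝ), z ≠ a) :
    DifferentiableAt ℂ (cdens r₁ r₂ e₁ e₂ e₃ e₄) z := by
  have hd : ∀ a ∈ ({r₁, r₂, e₁, e₂, e₃, e₄} : Set ℝ),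
      DifferentiableAt ℂ (fun z : ℂ => csq (z - a)) z ∧ csq (z - a) ≠ 0 := fun a ha =>
    have h0 := sub_ne_zero.mpr (h a ha)
    ⟨DifferentiableAt.comp (g := csq) (f := fun z : ℂ => z - a) z
      (differentiableAt_csq (by simpa using hz) h0) (by fun_prop), csq_ne_zero h0⟩
  simp only [mem_insert_iff, mem_singleton_iff, forall_eq_or_imp, forall_eq] at hd
  obtain ⟨⟨d1, -⟩, ⟨d2, -⟩, ⟨d3, n3⟩, ⟨d4, n4⟩, ⟨d5, n5⟩, ⟨d6, n6⟩⟩ := hd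
  unfold cdens
  exact (d1.mul d2).div (((d3.mul d4).mul d5).mul d6)
    (mul_ne_zero (mul_ne_zero (mul_ne_zero n3 n4) n5) n6)

/-- Two square roots above and four below leave `csq z ^ (-2)` = 1/z at infinity. The comparison
function has its pole at -i, outside the half plane, and the same leading term. -/
theorem tendsto_mul_cdens (r₁ r₂ e₁ e₂ e₃ e₄ : ℝ) :
    Tendsto (fun z : ℂ => z * (cdens r₁ r₂ e₁ e₂ e₃ e₄ z - 1 / (z + Complex.I)))
      (Bornology.cobounded ℂ ⊓ 𝓟 {z | 0 ≤ z.im}) (𝓝 0) := by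
  have hne : ∀ᶠ z : ℂ in Bornology.cobounded ℂ ⊓ 𝓟 {z | 0 ≤ z.im}, z ≠ 0 := by
    refine mem_inf_of_left ?_
    filter_upwards [tendsto_norm_cobounded_atTop.eventually_gt_atTop 0] with z hz
    exact norm_pos_iff.mp hz
  have h1 : Tendsto (fun z : ℂ => z * cdens r₁ r₂ e₁ e₂ e₃ e₄ z)
      (Bornology.cobounded ℂ ⊓ 𝓟 {z | 0 ≤ z.im}) (𝓝 1) := by
    have := ((tendsto_csq_sub_div r₁).mul (tendsto_csq_sub_div r₂)).div
      ((((tendsto_csq_sub_div e₁).mul (tendsto_csq_sub_div e₂)).mul (tendsto_csq_sub_div e₃)).mul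
        (tendsto_csq_sub_div e₄)) (by norm_num)
    simp only [mul_one, div_one] at this
    refine this.congr' ?_
    filter_upwards [hne] with z hz
    have hq := csq_ne_zero hz
    simp only [Pi.div_apply, cdens]
    calc _ = csq z ^ 2 * (csq (z - r₁) * csq (z - r₂) /
          (csq (z - e₁) * csq (z - e₂) * csq (z - e₃) * csq (z - e₄))) := by field_simp
      _ = _ := by rw [csq_sq]
  have h2 : Tendsto (fun z : ℂ => z * (1 / (z + Complex.I)))
      (Bornology.cobounded ℂ ⊓ 𝓟 {z | 0 ≤ z.im}) (𝓝 1) := by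
    have h3 : Tendsto (fun z : ℂ => Complex.I / z)
        (Bornology.cobounded ℂ ⊓ 𝓟 {z | 0 ≤ z.im}) (𝓝 0) := by
      have := (tendsto_inv₀_cobounded (α := ℂ)).const_mul Complex.I
      rw [mul_zero] at this
      exact this.mono_left inf_le_left
    have h4 : Tendsto (fun z : ℂ => 1 / (1 + Complex.I / z))
        (Bornology.cobounded ℂ ⊓ 𝓟 {z | 0 ≤ z.im}) (𝓝 (1 / (1 + 0))) :=
      tendsto_const_nhds.div (tendsto_const_nhds.add h3) (by norm_num)
    rw [add_zero, div_one] at h4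
    refine h4.congr' ?_
    filter_upwards [hne] with z hz
    rw [one_add_div hz, one_div_div, mul_one_div]
  have := h1.sub h2
  rw [sub_self] at this
  exact this.congr fun z => by ring

/-- Moving x leftwards past a point multiplies the square root attached to it by i. By interlacing,
the number of poles minus the number of roots to the right of x is 0, 1 or 2, so the phase is 1, -i
or -1 and never i; it is -i exactly where the radicand of `dens` is positive. -/
theorem cdens_ofReal_im {r₁ r₂ e₁ e₂ e₃ e₄ : ℝ} (h12 : e₁ < e₂) (h23 : e₂ < e₃) (h34 : e₃ < e₄)
    (hr1 : e₁ ≤ r₁) (hr1' : r₁ ≤ e₃) (hr2 : e₂ ≤ r₂) (hr2' : r₂ ≤ e₄) (hr : r₁ ≤ r₂) {x : ℝ}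
    (hx : ∀ a ∈ ({r₁, r₂, e₁, e₂, e₃, e₄} : Set ℝ), x ≠ a) :
    (cdens r₁ r₂ e₁ e₂ e₃ e₄ x).im = -dens r₁ r₂ e₁ e₂ e₃ e₄ x := by
  simp only [mem_insert_iff, mem_singleton_iff, forall_eq_or_imp, forall_eq] at hx
  obtain ⟨x1, x2, y1, y2, y3, y4⟩ := hx
  let u : ℝ → ℂ := fun a => if a < x then 1 else Complex.I
  let t : ℝ → ℝ := fun a => if a < x then 1 else -1
  have hu : ∀ a, x ≠ a → csq (x - a) = (√|x - a| : ℝ) * u a := by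
    intro a ha
    rw [← Complex.ofReal_sub]
    rcases lt_or_gt_of_ne ha with h | h
    · rw [csq_ofReal_of_neg (by linarith)]; simp [u, h.not_gt]
    · rw [csq_ofReal_of_pos (by linarith)]; simp [u, h]
  have ht : ∀ a, x ≠ a → x - a = |x - a| * t a := by
    intro a ha
    rcases lt_or_gt_of_ne ha with h | h
    · rw [abs_of_neg (by linarith)]; simp [t, h.not_gt]
    · rw [abs_of_pos (by linarith)]; simp [t, h]
  let P : ℝ := |x - r₁| * |x - r₂| / (|x - e₁| * |x - e₂| * |x - e₃| * |x - e₄|)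
  have hP : 0 ≤ P := by positivity
  have hd : dens r₁ r₂ e₁ e₂ e₃ e₄ x = √(-(t r₁ * t r₂ / (t e₁ * t e₂ * t e₃ * t e₄)) * P) := by
    unfold dens
    congr 1
    conv_lhs => rw [ht _ x1, ht _ x2, ht _ y1, ht _ y2, ht _ y3, ht _ y4]
    simp only [P]
    rw [neg_mul, div_mul_div_comm, neg_div]
    congr 2 <;> ring
  have hc : cdens r₁ r₂ e₁ e₂ e₃ e₄ x
      = (√P : ℝ) * (u r₁ * u r₂ / (u e₁ * u e₂ * u e₃ * u e₄)) := by
    unfold cdens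
    rw [hu _ x1, hu _ x2, hu _ y1, hu _ y2, hu _ y3, hu _ y4]
    simp only [P]
    rw [Real.sqrt_div (by positivity), Real.sqrt_mul (by positivity), Real.sqrt_mul (by positivity),
      Real.sqrt_mul (by positivity), Real.sqrt_mul (by positivity)]
    push_cast
    rw [div_mul_div_comm]
    congr 1 <;> ring
  have key : ∀ w : ℂ, ∀ σ : ℝ, (w.im = 0 ∧ σ = 1 ∨ w.im = -1 ∧ σ = -1) →
      ((√P : ℝ) * w).im = -√(-σ * P) := by
    rintro w σ (⟨h1, h2⟩ | ⟨h1, h2⟩)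
    · rw [Complex.im_ofReal_mul, h1, h2, Real.sqrt_eq_zero_of_nonpos (x := -1 * P) (by linarith)]; simp
    · rw [Complex.im_ofReal_mul, h1, h2]; simp
  rw [hc, hd]
  apply key
  have hlt : ∀ {a}, x < a → u a = Complex.I ∧ t a = -1 := fun h => by simp [u, t, h.not_gt]
  have hgt : ∀ {a}, a < x → u a = 1 ∧ t a = 1 := fun h => by simp [u, t, h]
  rcases lt_or_gt_of_ne x1 with c1 | c1 <;> rcases lt_or_gt_of_ne x2 with c2 | c2 <;>
  rcases lt_or_gt_of_ne y1 with d1 | d1 <;> rcases lt_or_gt_of_ne y2 with d2 | d2 <;>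
  rcases lt_or_gt_of_ne y3 with d3 | d3 <;> rcases lt_or_gt_of_ne y4 with d4 | d4 <;>
  first
  | (exfalso; linarith)
  | (simp only [hlt, hgt, c1, c2, d1, d2, d3, d4]; norm_num [mul_assoc, div_neg])

theorem add_I_ne_zero {z : ℂ} (hz : 0 ≤ z.im) : z + Complex.I ≠ 0 := by
  intro h
  have := congrArg Complex.im h
  simp only [Complex.add_im, Complex.I_im, Complex.zero_im] at this
  linarith

/-- Cauchy's theorem on the rectangle [-T, T] × [ε, T]: the other three sides stay at modulus at
least T, where the integrand is at most η/T. The top contributes 2η and each vertical side at most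
η. -/
theorem norm_integral_cdens_le {r₁ r₂ e₁ e₂ e₃ e₄ η T ε : ℝ} (hη : 0 ≤ η) (hT : 0 < T)
    (hε : 0 < ε) (hεT : ε ≤ T)
    (hbound : ∀ z : ℂ, T ≤ ‖z‖ → 0 ≤ z.im →
      ‖z * (cdens r₁ r₂ e₁ e₂ e₃ e₄ z - 1 / (z + Complex.I))‖ ≤ η) :
    ‖∫ x in (-T)..T, (cdens r₁ r₂ e₁ e₂ e₃ e₄ (x + ε * Complex.I)
      - 1 / (x + ε * Complex.I + Complex.I))‖ ≤ 4 * η := by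
  set g : ℂ → ℂ := fun z => cdens r₁ r₂ e₁ e₂ e₃ e₄ z - 1 / (z + Complex.I) with hg
  have hg' : ∀ z : ℂ, T ≤ ‖z‖ → 0 ≤ z.im → ‖g z‖ ≤ η / T := by
    intro z hz him
    have h := hbound z hz him
    rw [norm_mul] at h
    rw [le_div_iff₀ hT, mul_comm]
    exact (mul_le_mul_of_nonneg_right hz (norm_nonneg _)).trans h
  have hdiff : ∀ z : ℂ, 0 < z.im → DifferentiableAt ℂ g z := by
    intro z hz
    refine (differentiableAt_cdens hz.le ?_).sub ?_
    · rintro a - rfl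
      simp at hz
    · exact (differentiableAt_const _).div (by fun_prop) (add_I_ne_zero hz.le)
  have hrect := Complex.integral_boundary_rect_eq_zero_of_differentiableOn g
    (⟨-T, ε⟩ : ℂ) (⟨T, T⟩ : ℂ) (by
      intro z hz
      refine (hdiff z ?_).differentiableWithinAt
      have h2 := hz.2
      simp only [mem_preimage, uIcc_of_le hεT, mem_Icc] at h2
      linarith [h2.1])
  simp only at hrect
  have htop : ‖∫ x in (-T)..T, g (x + T * Complex.I)‖ ≤ η / T * |T - -T| := by
    refine intervalIntegral.norm_integral_le_of_norm_le_const fun x _ => hg' _ ?_ (by simp [hT.le])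
    refine le_trans ?_ (Complex.abs_im_le_norm _)
    simp [le_abs_self]
  have hside : ∀ c : ℝ, |c| = T → ‖∫ y in ε..T, g (c + y * Complex.I)‖ ≤ η / T * |T - ε| := by
    intro c hc
    refine intervalIntegral.norm_integral_le_of_norm_le_const fun y hy => hg' _ ?_ ?_
    · refine le_trans ?_ (Complex.abs_re_le_norm _)
      simp [hc]
    · rw [uIoc_of_le hεT] at hy
      simpa using (hε.trans hy.1).le
  have h1 := hside T (abs_of_pos hT)
  have h2 := hside (-T) (by rw [abs_neg, abs_of_pos hT])
  have e1 : η / T * |T - -T| = 2 * η := by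
    rw [sub_neg_eq_add, abs_of_pos (by linarith)]; field_simp; ring
  have e2 : η / T * |T - ε| ≤ η := by
    rw [abs_of_nonneg (by linarith), div_mul_eq_mul_div, div_le_iff₀ hT]
    nlinarith
  have hmain : ∫ x in (-T)..T, g (x + ε * Complex.I) =
      (∫ x in (-T)..T, g (x + T * Complex.I)) - Complex.I • (∫ y in ε..T, g (T + y * Complex.I))
      + Complex.I • ∫ y in ε..T, g ((-T : ℝ) + y * Complex.I) := by
    linear_combination hrect
  rw [hmain]
  refine (norm_add_le _ _).trans ?_
  refine (add_le_add_left (norm_sub_le _ _) _).trans ?_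
  rw [norm_smul, norm_smul, Complex.norm_I, one_mul, one_mul]
  linarith

theorem im_one_div_ofReal_add_I (x : ℝ) : (1 / ((x : ℂ) + Complex.I)).im = -(1 / (1 + x ^ 2)) := by
  rw [one_div, Complex.inv_im]
  simp [Complex.normSq_apply]
  ring

/-- Since |x + iε - e| ≥ |x - e|, the boundary singularities dominate the values above them
uniformly in ε. -/
theorem norm_cdens_le {r₁ r₂ e₁ e₂ e₃ e₄ T ε x : ℝ} (hx : |x| ≤ T) (hε : 0 ≤ ε) (hε1 : ε ≤ 1)
    (hne : ∀ a ∈ ({e₁, e₂, e₃, e₄} : Set ℝ), x ≠ a) :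
    ‖cdens r₁ r₂ e₁ e₂ e₃ e₄ (x + ε * Complex.I)‖ ≤ √(T + 1 + |r₁|) * √(T + 1 + |r₂|) *
      (invSqrtDist e₁ x * (invSqrtDist e₂ x * (invSqrtDist e₃ x * invSqrtDist e₄ x))) := by
  have him : 0 ≤ ((x : ℂ) + ε * Complex.I).im := by simpa using hε
  have hnum : ∀ r : ℝ, ‖csq (x + ε * Complex.I - r)‖ ≤ √(T + 1 + |r|) := by
    intro r
    rw [norm_csq]
    refine Real.sqrt_le_sqrt ?_
    calc ‖(x : ℂ) + ε * Complex.I - r‖ ≤ ‖(x : ℂ)‖ + ‖(ε : ℂ) * Complex.I‖ + ‖(r : ℂ)‖ :=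
          (norm_sub_le _ _).trans (by gcongr; exact norm_add_le _ _)
      _ ≤ T + 1 + |r| := by
          rw [norm_mul, Complex.norm_I, mul_one, Complex.norm_real, Complex.norm_real,
            Complex.norm_real, Real.norm_eq_abs, Real.norm_eq_abs, Real.norm_eq_abs,
            abs_of_nonneg hε]
          linarith
  have hden : ∀ e : ℝ, x ≠ e → ‖csq (x + ε * Complex.I - e)‖⁻¹ ≤ invSqrtDist e x := by
    intro e he
    rw [norm_csq]
    refine inv_anti₀ (Real.sqrt_pos.mpr (abs_pos.mpr (sub_ne_zero.mpr he)))
      (Real.sqrt_le_sqrt ?_)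
    refine le_trans (le_of_eq ?_) (Complex.abs_re_le_norm _)
    simp
  simp only [mem_insert_iff, mem_singleton_iff, forall_eq_or_imp, forall_eq] at hne
  obtain ⟨y1, y2, y3, y4⟩ := hne
  unfold cdens
  rw [norm_div, norm_mul, norm_mul, norm_mul, norm_mul, div_eq_mul_inv, mul_inv, mul_inv, mul_inv]
  have i1 := invSqrtDist_nonneg e₁ x
  have i2 := invSqrtDist_nonneg e₂ x
  have i3 := invSqrtDist_nonneg e₃ x
  rw [mul_assoc (_ * _), mul_assoc ‖csq (x + ε * Complex.I - e₁)‖⁻¹]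
  exact mul_le_mul (mul_le_mul (hnum r₁) (hnum r₂) (norm_nonneg _) (Real.sqrt_nonneg _))
    (mul_le_mul (hden e₁ y1) (mul_le_mul (hden e₂ y2) (mul_le_mul (hden e₃ y3) (hden e₄ y4)
      (by positivity) i3) (by positivity) i2) (by positivity) i1) (by positivity) (by positivity)

theorem abs_integral_dens_sub_le {r₁ r₂ e₁ e₂ e₃ e₄ η T : ℝ} (h12 : e₁ < e₂) (h23 : e₂ < e₃)
    (h34 : e₃ < e₄) (hr1 : e₁ ≤ r₁) (hr1' : r₁ ≤ e₃) (hr2 : e₂ ≤ r₂) (hr2' : r₂ ≤ e₄)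
    (hr : r₁ ≤ r₂) (hη : 0 ≤ η) (hT : 0 < T)
    (hbound : ∀ z : ℂ, T ≤ ‖z‖ → 0 ≤ z.im →
      ‖z * (cdens r₁ r₂ e₁ e₂ e₃ e₄ z - 1 / (z + Complex.I))‖ ≤ η) :
    |∫ x in (-T)..T, (1 / (1 + x ^ 2) - dens r₁ r₂ e₁ e₂ e₃ e₄ x)| ≤ 4 * η := by
  set g : ℂ → ℂ := fun z => cdens r₁ r₂ e₁ e₂ e₃ e₄ z - 1 / (z + Complex.I) with hg
  have hcont : ∀ ε : ℝ, 0 < ε → Continuous fun x : ℝ => g (x + ε * Complex.I) := by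
    intro ε hε
    refine continuous_iff_continuousAt.mpr fun x => ?_
    have hz : 0 < ((x : ℂ) + ε * Complex.I).im := by simpa using hε
    refine ContinuousAt.comp (g := g) (f := fun x : ℝ => (x : ℂ) + ε * Complex.I) ?_
      (by fun_prop)
    refine ((differentiableAt_cdens hz.le ?_).continuousAt).sub ?_
    · intro a _ h
      rw [h, Complex.ofReal_im] at hz
      exact lt_irrefl _ hz
    · exact continuousAt_const.div (by fun_prop) (add_I_ne_zero hz.le)
  have hle : ∀ ε : ℝ, 0 < ε → ε ≤ T → |∫ x in (-T)..T, (g (x + ε * Complex.I)).im| ≤ 4 * η := by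
    intro ε hε hεT
    have h := norm_integral_cdens_le hη hT hε hεT hbound
    have e : ∫ x in (-T)..T, (g (x + ε * Complex.I)).im
        = (∫ x in (-T)..T, g (x + ε * Complex.I)).im :=
      Complex.imCLM.intervalIntegral_comp_comm ((hcont ε hε).intervalIntegrable _ _)
    rw [e]
    exact (Complex.abs_im_le_norm _).trans h
  have hlim : Tendsto (fun ε : ℝ => ∫ x in (-T)..T, (g (x + ε * Complex.I)).im) (𝓝[>] 0)
      (𝓝 (∫ x in (-T)..T, (1 / (1 + x ^ 2) - dens r₁ r₂ e₁ e₂ e₃ e₄ x))) := by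
    -- The contour is lowered to the real axis. The summand 1 in the dominating function accounts
    -- for 1/(z + i), as |z + i| ≥ 1 when Im z ≥ 0.
    refine intervalIntegral.tendsto_integral_filter_of_dominated_convergence
      (fun x => √(T + 1 + |r₁|) * √(T + 1 + |r₂|) *
        (invSqrtDist e₁ x * (invSqrtDist e₂ x * (invSqrtDist e₃ x * invSqrtDist e₄ x))) + 1)
      ?_ ?_ ?_ ?_
    · filter_upwards [self_mem_nhdsWithin] with ε hε
      exact (Complex.continuous_im.comp (hcont ε hε)).aestronglyMeasurable
    · filter_upwards [Ioc_mem_nhdsGT (zero_lt_one (α := ℝ))] with ε hε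
      filter_upwards [(Set.toFinite ({e₁, e₂, e₃, e₄} : Set ℝ)).countable.ae_notMem volume]
        with x hx hxT
      have hxT' : |x| ≤ T := by
        rw [uIoc_of_le (by linarith)] at hxT
        exact abs_le.mpr ⟨hxT.1.le, hxT.2⟩
      rw [Real.norm_eq_abs]
      refine (Complex.abs_im_le_norm _).trans ((norm_sub_le _ _).trans (add_le_add
        (norm_cdens_le hxT' hε.1.le hε.2 fun a ha h => hx (h ▸ ha)) ?_))
      rw [norm_div, norm_one]
      refine div_le_one_of_le₀ ?_ (norm_nonneg _)
      refine le_trans ?_ (Complex.abs_im_le_norm _)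
      rw [le_abs]
      left
      simpa using hε.1.le
    · exact ((intervalIntegrable_invSqrtDist_four h12.ne (h12.trans h23).ne
        (h12.trans (h23.trans h34)).ne h23.ne (h23.trans h34).ne h34.ne _ _).const_mul _).add
        intervalIntegrable_const
    · filter_upwards [(Set.toFinite ({r₁, r₂, e₁, e₂, e₃, e₄} : Set ℝ)).countable.ae_notMem volume]
        with x hx hxT
      have hx' : ∀ a ∈ ({r₁, r₂, e₁, e₂, e₃, e₄} : Set ℝ), x ≠ a := fun a ha h => hx (h ▸ ha)
      have hval : (g (x + (0 : ℝ) * Complex.I)).im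
          = 1 / (1 + x ^ 2) - dens r₁ r₂ e₁ e₂ e₃ e₄ x := by
        simp only [Complex.ofReal_zero, zero_mul, add_zero, hg, Complex.sub_im,
          im_one_div_ofReal_add_I, cdens_ofReal_im h12 h23 h34 hr1 hr1' hr2 hr2' hr hx']
        ring
      rw [← hval]
      have him : ((x : ℂ) + (0 : ℝ) * Complex.I).im = 0 := by simp
      have hgc : ContinuousAt g (x + (0 : ℝ) * Complex.I) := by
        refine ((differentiableAt_cdens him.ge ?_).continuousAt).sub
          (continuousAt_const.div (by fun_prop) (add_I_ne_zero him.ge))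
        intro a ha h
        simp only [Complex.ofReal_zero, zero_mul, add_zero] at h
        exact hx' a ha (by exact_mod_cast h)
      have hc : ContinuousAt (fun ε : ℝ => (g (x + ε * Complex.I)).im) 0 :=
        Complex.continuous_im.continuousAt.comp (ContinuousAt.comp (g := g)
          (f := fun ε : ℝ => (x : ℂ) + ε * Complex.I) hgc (by fun_prop))
      exact hc.tendsto.mono_left nhdsWithin_le_nhds
  refine le_of_tendsto (hlim.abs) ?_
  filter_upwards [Ioc_mem_nhdsGT hT] with ε hε
  exact hle ε hε.1 hε.2

theorem intervalIntegrable_dens {e₁ e₂ e₃ e₄ : ℝ} (h12 : e₁ < e₂) (h23 : e₂ < e₃)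
    (h34 : e₃ < e₄) (r₁ r₂ a b : ℝ) :
    IntervalIntegrable (dens r₁ r₂ e₁ e₂ e₃ e₄) volume a b := by
  have h := (intervalIntegrable_invSqrtDist_four h12.ne (h12.trans h23).ne
    (h12.trans (h23.trans h34)).ne h23.ne (h23.trans h34).ne h34.ne a b).continuousOn_mul
    (Continuous.continuousOn (s := uIcc a b) (f := fun s => √|s - r₁| * √|s - r₂|)
      (by fun_prop))
  exact intervalIntegrable_of_nonneg_of_le h (measurable_dens _ _ _ _ _ _)
    (dens_nonneg _ _ _ _ _ _) (dens_le _ _ _ _ _ _)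

theorem dens_eq_zero {r₁ r₂ e₁ e₂ e₃ e₄ s : ℝ}
    (h : 0 ≤ (s - r₁) * (s - r₂) / ((s - e₁) * (s - e₂) * (s - e₃) * (s - e₄))) :
    dens r₁ r₂ e₁ e₂ e₃ e₄ s = 0 := by
  unfold dens
  rw [neg_div]
  exact Real.sqrt_eq_zero_of_nonpos (neg_nonpos.mpr h)

theorem dens_eq_zero_of_gt {r₁ r₂ e₁ e₂ e₃ e₄ s : ℝ} (h12 : e₁ ≤ e₂) (h23 : e₂ ≤ e₃)
    (h34 : e₃ ≤ e₄) (hr2 : r₂ ≤ e₄) (hr : r₁ ≤ r₂) (hs : e₄ ≤ s) :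
    dens r₁ r₂ e₁ e₂ e₃ e₄ s = 0 := by
  apply dens_eq_zero
  have a1 : 0 ≤ s - r₁ := by linarith
  have a2 : 0 ≤ s - r₂ := by linarith
  have a3 : 0 ≤ s - e₁ := by linarith
  have a4 : 0 ≤ s - e₂ := by linarith
  have a5 : 0 ≤ s - e₃ := by linarith
  have a6 : 0 ≤ s - e₄ := by linarith
  positivity

theorem dens_eq_zero_of_lt {r₁ r₂ e₁ e₂ e₃ e₄ s : ℝ} (h12 : e₁ ≤ e₂) (h23 : e₂ ≤ e₃)
    (h34 : e₃ ≤ e₄) (hr1 : e₁ ≤ r₁) (hr : r₁ ≤ r₂) (hs : s ≤ e₁) :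
    dens r₁ r₂ e₁ e₂ e₃ e₄ s = 0 := by
  apply dens_eq_zero
  rw [show (s - r₁) * (s - r₂) / ((s - e₁) * (s - e₂) * (s - e₃) * (s - e₄))
    = (r₁ - s) * (r₂ - s) / ((e₁ - s) * (e₂ - s) * (e₃ - s) * (e₄ - s)) by congr 1 <;> ring]
  have a1 : 0 ≤ r₁ - s := by linarith
  have a2 : 0 ≤ r₂ - s := by linarith
  have a3 : 0 ≤ e₁ - s := by linarith
  have a4 : 0 ≤ e₂ - s := by linarith
  have a5 : 0 ≤ e₃ - s := by linarith
  have a6 : 0 ≤ e₄ - s := by linarith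
  positivity

theorem integral_eq_zero_of_forall_Ioo {f : ℝ → ℝ} {a b : ℝ} (hab : a ≤ b)
    (h : ∀ s ∈ Ioo a b, f s = 0) : ∫ s in a..b, f s = 0 := by
  refine intervalIntegral.integral_zero_ae ?_
  filter_upwards [Measure.ae_ne volume b] with s hs hs'
  rw [uIoc_of_le hab] at hs'
  exact h s ⟨hs'.1, lt_of_le_of_ne hs'.2 hs⟩

/-- The sum of the real half-periods of `√(-R / A) ds`. -/
theorem integral_dens {r₁ r₂ e₁ e₂ e₃ e₄ : ℝ} (h12 : e₁ < e₂) (h23 : e₂ < e₃)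
    (h34 : e₃ < e₄) (hr1 : e₁ ≤ r₁) (hr1' : r₁ ≤ e₃) (hr2 : e₂ ≤ r₂) (hr2' : r₂ ≤ e₄)
    (hr : r₁ ≤ r₂) : ∫ x in e₁..e₄, dens r₁ r₂ e₁ e₂ e₃ e₄ x = Real.pi := by
  have hii := intervalIntegrable_dens h12 h23 h34 r₁ r₂
  have hatan : Tendsto (fun T : ℝ => |Real.arctan T - Real.arctan (-T)
      - ∫ x in e₁..e₄, dens r₁ r₂ e₁ e₂ e₃ e₄ x|) atTop
      (𝓝 |Real.pi - ∫ x in e₁..e₄, dens r₁ r₂ e₁ e₂ e₃ e₄ x|) := by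
    have h1 : Tendsto Real.arctan atTop (𝓝 (Real.pi / 2)) :=
      Real.tendsto_arctan_atTop.mono_right nhdsWithin_le_nhds
    have h2 := (h1.add h1).sub_const (∫ x in e₁..e₄, dens r₁ r₂ e₁ e₂ e₃ e₄ x)
    rw [add_halves] at h2
    simpa only [Real.arctan_neg, sub_neg_eq_add] using h2.abs
  -- The density vanishes outside [e₁, e₄], so enlarging T only moves the arctangent term, which
  -- tends to π.
  have hsmall : ∀ η > 0, |Real.pi - ∫ x in e₁..e₄, dens r₁ r₂ e₁ e₂ e₃ e₄ x| ≤ 4 * η := by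
    intro η hη
    have hev : ∀ᶠ z in Bornology.cobounded ℂ ⊓ 𝓟 {z : ℂ | 0 ≤ z.im},
        ‖z * (cdens r₁ r₂ e₁ e₂ e₃ e₄ z - 1 / (z + Complex.I))‖ ≤ η := by
      have := (tendsto_mul_cdens r₁ r₂ e₁ e₂ e₃ e₄).norm
      rw [norm_zero] at this
      exact this.eventually_le_const hη
    rw [eventually_inf_principal, ← comap_norm_atTop, eventually_comap] at hev
    obtain ⟨T₀, hT₀⟩ := eventually_atTop.mp hev
    refine le_of_tendsto hatan ?_
    filter_upwards [eventually_ge_atTop T₀, eventually_gt_atTop 0, eventually_ge_atTop (-e₁),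
      eventually_ge_atTop e₄] with T hT hT0 hT1 hT4
    have h := abs_integral_dens_sub_le h12 h23 h34 hr1 hr1' hr2 hr2' hr hη.le hT0
      (fun z hz him => hT₀ ‖z‖ (hT.trans hz) z rfl him)
    rw [intervalIntegral.integral_sub ?_ (hii _ _), integral_one_div_one_add_sq,
      ← intervalIntegral.integral_add_adjacent_intervals (hii (-T) e₁) (hii e₁ T),
      ← intervalIntegral.integral_add_adjacent_intervals (hii e₁ e₄) (hii e₄ T),
      integral_eq_zero_of_forall_Ioo (by linarith) fun s hs =>
        dens_eq_zero_of_lt h12.le h23.le h34.le hr1 hr hs.2.le,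
      integral_eq_zero_of_forall_Ioo hT4 fun s hs =>
        dens_eq_zero_of_gt h12.le h23.le h34.le hr2' hr hs.1.le, zero_add, add_zero] at h
    · exact h
    · exact (Continuous.div continuous_const (by fun_prop)
        fun x => by positivity).intervalIntegrable _ _
  have h0 : |Real.pi - ∫ x in e₁..e₄, dens r₁ r₂ e₁ e₂ e₃ e₄ x| ≤ 0 := by
    refine le_of_forall_pos_le_add fun η hη => ?_
    have := hsmall (η / 4) (by linarith)
    linarith
  have := abs_nonpos_iff.mp h0
  linarith

/-! ### Confluence of two poles -/

theorem intervalIntegrable_dens_of_ne {e₁ e₂ e₃ e₄ : ℝ} (h12 : e₁ ≠ e₂) (h13 : e₁ ≠ e₃)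
    (h14 : e₁ ≠ e₄) (h23 : e₂ ≠ e₃) (h24 : e₂ ≠ e₄) (h34 : e₃ ≠ e₄) (r₁ r₂ a b : ℝ) :
    IntervalIntegrable (dens r₁ r₂ e₁ e₂ e₃ e₄) volume a b := by
  have h := (intervalIntegrable_invSqrtDist_four h12 h13 h14 h23 h24 h34 a b).continuousOn_mul
    (Continuous.continuousOn (s := uIcc a b) (f := fun s => √|s - r₁| * √|s - r₂|)
      (by fun_prop))
  exact intervalIntegrable_of_nonneg_of_le h (measurable_dens _ _ _ _ _ _)
    (dens_nonneg _ _ _ _ _ _) (dens_le _ _ _ _ _ _)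

/-- The arcsine densities on [p - δ, p + δ] all have mass π and concentrate at p. -/
theorem tendsto_integral_arcsine {φ : ℝ → ℝ} {p κ : ℝ} (hκ : 0 < κ)
    (hφ : ContinuousOn φ (Icc (p - κ) (p + κ))) :
    Tendsto (fun δ => ∫ s in (p - δ)..(p + δ), φ s * (1 / √((s - (p - δ)) * (p + δ - s))))
      (𝓝[>] 0) (𝓝 (φ p * Real.pi)) := by
  rw [Metric.tendsto_nhds]
  intro η hη
  have hpc : ContinuousAt φ p :=
    hφ.continuousAt (Icc_mem_nhds (by linarith) (by linarith))
  obtain ⟨δ₀, hδ₀, hclose⟩ := Metric.continuousAt_iff.mp hpc (η / (2 * Real.pi))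
    (div_pos hη (by linarith [Real.pi_pos]))
  filter_upwards [Ioo_mem_nhdsGT (lt_min hδ₀ hκ)] with δ hδ
  obtain ⟨h0, h1⟩ := hδ
  have hlt : p - δ < p + δ := by linarith
  have h1a := h1.trans_le (min_le_left _ _)
  have h1b := h1.trans_le (min_le_right _ _)
  have hw := intervalIntegrable_arcsine hlt
  have hφw : IntervalIntegrable (fun s => φ s * (1 / √((s - (p - δ)) * (p + δ - s)))) volume
      (p - δ) (p + δ) := by
    refine hw.continuousOn_mul (hφ.mono ?_)
    rw [uIcc_of_le hlt.le]
    exact Icc_subset_Icc (by linarith) (by linarith)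
  have e : (∫ s in (p - δ)..(p + δ), φ s * (1 / √((s - (p - δ)) * (p + δ - s))))
      - φ p * Real.pi
      = ∫ s in (p - δ)..(p + δ), (φ s - φ p) * (1 / √((s - (p - δ)) * (p + δ - s))) := by
    rw [← integral_arcsine hlt, ← intervalIntegral.integral_const_mul,
      ← intervalIntegral.integral_sub hφw (hw.const_mul _)]
    exact intervalIntegral.integral_congr fun s _ => by ring
  rw [Real.dist_eq, e]
  have hb : ‖∫ s in (p - δ)..(p + δ), (φ s - φ p) * (1 / √((s - (p - δ)) * (p + δ - s)))‖
      ≤ ∫ s in (p - δ)..(p + δ), η / (2 * Real.pi) * (1 / √((s - (p - δ)) * (p + δ - s))) := by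
    refine intervalIntegral.norm_integral_le_of_norm_le hlt.le ?_ (hw.const_mul _)
    refine Eventually.of_forall fun s hs => ?_
    rw [norm_mul, Real.norm_of_nonneg (by positivity : 0 ≤ 1 / √((s - (p - δ)) * (p + δ - s)))]
    refine mul_le_mul_of_nonneg_right ?_ (by positivity)
    refine (hclose (x := s) ?_).le
    rw [Real.dist_eq, abs_lt]
    constructor <;> linarith [hs.1, hs.2]
  rw [intervalIntegral.integral_const_mul, integral_arcsine hlt] at hb
  have : η / (2 * Real.pi) * Real.pi = η / 2 := by
    have := Real.pi_pos
    field_simp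
  rw [this, Real.norm_eq_abs] at hb
  linarith

/-- If two simple poles merge at a point `p` where the remaining factor is positive, they
contribute half a residue in the limit. -/
theorem integral_dens_double_pole {r₁ r₂ u v p a b : ℝ} (huv : u ≠ v) (hap : a < p) (hpb : p < b)
    (hψ : 0 < (p - r₁) * (p - r₂) / ((p - u) * (p - v)))
    (hπ : ∀ᶠ δ in 𝓝[>] (0 : ℝ), ∫ s in a..b, dens r₁ r₂ u v (p - δ) (p + δ) s = Real.pi) :
    (∫ s in a..b, dens r₁ r₂ u v p p s)
      + √((p - r₁) * (p - r₂) / ((p - u) * (p - v))) * Real.pi = Real.pi := by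
  set ψ : ℝ → ℝ := fun s => (s - r₁) * (s - r₂) / ((s - u) * (s - v)) with hψdef
  have hpuv : (p - u) * (p - v) ≠ 0 := fun h => by
    rw [h, div_zero] at hψ; exact lt_irrefl _ hψ
  have hψc : ContinuousAt ψ p := ContinuousAt.div (by fun_prop) (by fun_prop) hpuv
  have hev : ∀ᶠ s in 𝓝 p, 0 < ψ s ∧ a < s ∧ s < b :=
    (hψc.eventually_const_lt hψ).and ((eventually_gt_nhds hap).and (eventually_lt_nhds hpb))
  obtain ⟨κ₀, hκ₀, hball⟩ := Metric.eventually_nhds_iff.mp hev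
  obtain ⟨κ, hκ, hκκ⟩ := exists_between hκ₀
  have hin : ∀ s, |s - p| ≤ κ → 0 < ψ s ∧ a < s ∧ s < b := fun s hs =>
    hball (by rw [Real.dist_eq]; exact hs.trans_lt hκκ)
  have hne : ∀ s, |s - p| ≤ κ → s - u ≠ 0 ∧ s - v ≠ 0 := by
    intro s hs
    refine mul_ne_zero_iff.mp fun h => ?_
    have := (hin s hs).1
    simp only [hψdef, h, div_zero, lt_irrefl] at this
  have hψon : ContinuousOn ψ (Icc (p - κ) (p + κ)) := by
    refine ContinuousOn.div (by fun_prop) (by fun_prop) fun s hs => ?_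
    have := hne s (abs_le.mpr ⟨by linarith [hs.1], by linarith [hs.2]⟩)
    exact mul_ne_zero this.1 this.2
  -- Near p but not between the two poles the radicand is nonpositive; between them, the density is
  -- √ψ times an arcsine density.
  have hnear : ∀ {δ s : ℝ}, δ ^ 2 ≤ (s - p) ^ 2 → |s - p| ≤ κ →
      dens r₁ r₂ u v (p - δ) (p + δ) s = 0 := by
    intro δ s h1 h2
    apply dens_eq_zero
    rw [show (s - u) * (s - v) * (s - (p - δ)) * (s - (p + δ))
      = ((s - u) * (s - v)) * ((s - p) ^ 2 - δ ^ 2) by ring, ← div_div]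
    exact div_nonneg (hin s h2).1.le (sub_nonneg.mpr h1)
  have hmid : ∀ {δ s : ℝ}, |s - p| ≤ κ → dens r₁ r₂ u v (p - δ) (p + δ) s
      = √(ψ s) * (1 / √((s - (p - δ)) * (p + δ - s))) := by
    intro δ s hs
    rw [mul_one_div, ← Real.sqrt_div (hin s hs).1.le]
    unfold dens
    congr 1
    simp only [hψdef]
    rw [div_div, ← neg_div_neg_eq]
    congr 1 <;> ring
  -- If δ ≤ κ/2 and |s - p| ≥ κ, both merging poles are at distance at least κ/2 from s; their two
  -- factors give at most (√(κ/2))⁻² = 2/κ.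
  let w : ℝ → ℝ := fun s => 2 / κ * (√|s - r₁| * √|s - r₂| * (invSqrtDist u s * invSqrtDist v s))
  have hw : ∀ x y, IntervalIntegrable w volume x y := fun x y =>
    ((intervalIntegrable_invSqrtDist_two huv x y).continuousOn_mul (Continuous.continuousOn
      (s := uIcc x y) (f := fun s => √|s - r₁| * √|s - r₂|) (by fun_prop))).const_mul _
  have hwle : ∀ {δ s : ℝ}, 0 ≤ δ → δ ≤ κ / 2 → κ ≤ |s - p| →
      dens r₁ r₂ u v (p - δ) (p + δ) s ≤ w s := by
    intro δ s h0 hδ hs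
    have hfar : ∀ q, |q - p| ≤ κ / 2 → invSqrtDist q s ≤ (√(κ / 2))⁻¹ := by
      intro q hq
      refine inv_anti₀ (Real.sqrt_pos.mpr (by linarith)) (Real.sqrt_le_sqrt ?_)
      have := abs_sub_le s q p
      linarith
    have hf := mul_le_mul (hfar (p - δ) (by rw [sub_sub_cancel_left, abs_neg, abs_of_nonneg h0]; exact hδ))
      (hfar (p + δ) (by rw [add_sub_cancel_left, abs_of_nonneg h0]; exact hδ))
      (invSqrtDist_nonneg _ _) (by positivity)
    rw [← mul_inv, Real.mul_self_sqrt (by linarith), inv_div] at hf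
    refine (dens_le _ _ _ _ _ _ _).trans ?_
    have h3 : 0 ≤ √|s - r₁| * √|s - r₂| * (invSqrtDist u s * invSqrtDist v s) :=
      mul_nonneg (by positivity) (mul_nonneg (invSqrtDist_nonneg _ _) (invSqrtDist_nonneg _ _))
    have := mul_le_mul_of_nonneg_left hf h3
    simp only [w]
    linarith
  have h0eq : dens r₁ r₂ u v (p - 0) (p + 0) = dens r₁ r₂ u v p p := by rw [sub_zero, add_zero]
  have hfarlim : ∀ x y : ℝ, x ≤ y → (∀ s ∈ Ioc x y, κ ≤ |s - p|) →
      Tendsto (fun δ => ∫ s in x..y, dens r₁ r₂ u v (p - δ) (p + δ) s) (𝓝[>] 0)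
        (𝓝 (∫ s in x..y, dens r₁ r₂ u v p p s)) := by
    intro x y hxy hfar
    refine intervalIntegral.tendsto_integral_filter_of_dominated_convergence w
      (Eventually.of_forall fun δ => (measurable_dens _ _ _ _ _ _).aestronglyMeasurable) ?_
      (hw x y) ?_
    · filter_upwards [Ioc_mem_nhdsGT (half_pos hκ)] with δ hδ
      refine Eventually.of_forall fun s hs => ?_
      rw [uIoc_of_le hxy] at hs
      rw [Real.norm_of_nonneg (dens_nonneg _ _ _ _ _ _ _)]
      exact hwle hδ.1.le hδ.2 (hfar s hs)
    · filter_upwards [Measure.ae_ne volume u, Measure.ae_ne volume v] with s hsu hsv hs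
      rw [uIoc_of_le hxy] at hs
      have hsp : s - p ≠ 0 := fun h => by
        have := hfar s hs
        rw [h, abs_zero] at this
        linarith
      have hc : ContinuousAt (fun δ => dens r₁ r₂ u v (p - δ) (p + δ) s) 0 := by
        unfold dens
        refine ContinuousAt.sqrt (ContinuousAt.div (by fun_prop) (by fun_prop) ?_)
        rw [sub_zero, add_zero]
        exact mul_ne_zero (mul_ne_zero (mul_ne_zero (sub_ne_zero.mpr hsu) (sub_ne_zero.mpr hsv))
          hsp) hsp
      have := hc.tendsto.mono_left (nhdsWithin_le_nhds (s := Ioi 0))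
      rwa [h0eq] at this
  have hpk := hin (p - κ) (by rw [sub_sub_cancel_left, abs_neg, abs_of_pos hκ])
  have hpk' := hin (p + κ) (by rw [add_sub_cancel_left, abs_of_pos hκ])
  have l1 := hfarlim a (p - κ) hpk.2.1.le fun s hs => by
    rw [abs_of_nonpos (by linarith [hs.2])]; linarith [hs.2]
  have l2 := hfarlim (p + κ) b hpk'.2.2.le fun s hs => by
    rw [abs_of_nonneg (by linarith [hs.1])]; linarith [hs.1]
  have l3 := tendsto_integral_arcsine hκ hψon.sqrt
  have hsum : ∀ᶠ δ in 𝓝[>] (0 : ℝ), (∫ s in a..(p - κ), dens r₁ r₂ u v (p - δ) (p + δ) s)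
      + (∫ s in (p - δ)..(p + δ), √(ψ s) * (1 / √((s - (p - δ)) * (p + δ - s))))
      + (∫ s in (p + κ)..b, dens r₁ r₂ u v (p - δ) (p + δ) s) = Real.pi := by
    filter_upwards [hπ, Ioc_mem_nhdsGT hκ] with δ hδπ hδ
    have hin' : ∀ {q}, |q - p| ≤ κ → u ≠ q ∧ v ≠ q := fun h =>
      ⟨fun e => (hne _ h).1 (by rw [e, sub_self]), fun e => (hne _ h).2 (by rw [e, sub_self])⟩
    have n1 := hin' (q := p - δ) (by rw [sub_sub_cancel_left, abs_neg, abs_of_pos hδ.1]; exact hδ.2)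
    have n2 := hin' (q := p + δ) (by rw [add_sub_cancel_left, abs_of_pos hδ.1]; exact hδ.2)
    have hii := intervalIntegrable_dens_of_ne huv n1.1 n2.1 n1.2 n2.2
      (by linarith [hδ.1] : p - δ < p + δ).ne r₁ r₂
    rw [← hδπ, ← intervalIntegral.integral_add_adjacent_intervals (hii a (p - κ)) (hii (p - κ) b),
      ← intervalIntegral.integral_add_adjacent_intervals (hii (p - κ) (p - δ)) (hii (p - δ) b),
      ← intervalIntegral.integral_add_adjacent_intervals (hii (p - δ) (p + δ)) (hii (p + δ) b),
      ← intervalIntegral.integral_add_adjacent_intervals (hii (p + δ) (p + κ)) (hii (p + κ) b),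
      integral_eq_zero_of_forall_Ioo (by linarith [hδ.2] : p - κ ≤ p - δ) fun s hs => hnear
        (by nlinarith [hs.2, hδ.1]) (abs_le.mpr ⟨by linarith [hs.1], by linarith [hs.2, hδ.1]⟩),
      integral_eq_zero_of_forall_Ioo (by linarith [hδ.2] : p + δ ≤ p + κ) fun s hs => hnear
        (by nlinarith [hs.1, hδ.1]) (abs_le.mpr ⟨by linarith [hs.1, hδ.1], by linarith [hs.2]⟩),
      zero_add, zero_add, add_assoc]
    congr 2
    refine intervalIntegral.integral_congr fun s hs => ?_
    rw [uIcc_of_le (by linarith [hδ.1])] at hs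
    exact (hmid (abs_le.mpr ⟨by linarith [hs.1, hδ.2], by linarith [hs.2, hδ.2]⟩)).symm
  have hlim := (l1.add l3).add l2
  have huniq := tendsto_nhds_unique (hlim.congr' hsum) tendsto_const_nhds
  have hnear0 : ∀ {s}, |s - p| ≤ κ → dens r₁ r₂ u v p p s = 0 := by
    intro s hs
    have := hnear (δ := 0) (s := s) (by rw [zero_pow two_ne_zero]; positivity) hs
    rwa [h0eq] at this
  have hii0 : ∀ x y, IntervalIntegrable (dens r₁ r₂ u v p p) volume x y := by
    intro x y
    refine intervalIntegrable_of_nonneg_of_le (hw x y) (measurable_dens _ _ _ _ _ _)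
      (dens_nonneg _ _ _ _ _ _) fun s => ?_
    rcases le_total |s - p| κ with h | h
    · rw [hnear0 h]
      exact mul_nonneg (by positivity) (mul_nonneg (by positivity)
        (mul_nonneg (invSqrtDist_nonneg _ _) (invSqrtDist_nonneg _ _)))
    · have := hwle le_rfl (half_pos hκ).le h
      rwa [h0eq] at this
  rw [← intervalIntegral.integral_add_adjacent_intervals (hii0 a (p - κ)) (hii0 (p - κ) b),
    ← intervalIntegral.integral_add_adjacent_intervals (hii0 (p - κ) (p + κ)) (hii0 (p + κ) b),
    integral_eq_zero_of_forall_Ioo (by linarith : p - κ ≤ p + κ) fun s hs =>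
      hnear0 (abs_le.mpr ⟨by linarith [hs.1], by linarith [hs.2]⟩)]
  linarith

/-! ### Roots of real quadratics -/

theorem quadratic_roots {E b c s₀ : ℝ} (hE : 0 < E) (h : E * s₀ ^ 2 + b * s₀ + c ≤ 0) :
    (∀ s, E * s ^ 2 + b * s + c = E * ((s - smallRoot E b c) * (s - largeRoot E b c))) ∧
    smallRoot E b c ≤ s₀ ∧ s₀ ≤ largeRoot E b c := by
  have hd : (2 * E * s₀ + b) ^ 2 ≤ b ^ 2 - 4 * E * c := by nlinarith
  have hd0 : 0 ≤ b ^ 2 - 4 * E * c := (sq_nonneg _).trans hd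
  have hq := Real.sq_sqrt hd0
  have habs := Real.abs_le_sqrt hd
  obtain ⟨h1, h2⟩ := abs_le.mp habs
  refine ⟨fun s => ?_, ?_, ?_⟩
  · unfold smallRoot largeRoot
    generalize √(b ^ 2 - 4 * E * c) = q at *
    field_simp
    linear_combination hq
  · unfold smallRoot
    rw [div_le_iff₀ (by linarith)]
    linarith
  · unfold largeRoot
    rw [le_div_iff₀ (by linarith)]
    linarith

theorem roots_of_factored {E x y : ℝ} (hE : 0 < E) (hxy : x ≤ y) :
    smallRoot E (-(E * (x + y))) (E * (x * y)) = x ∧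
    largeRoot E (-(E * (x + y))) (E * (x * y)) = y := by
  have hd : (-(E * (x + y))) ^ 2 - 4 * E * (E * (x * y)) = (E * (y - x)) ^ 2 := by ring
  have hn : 0 ≤ E * (y - x) := mul_nonneg hE.le (by linarith)
  unfold smallRoot largeRoot
  rw [hd, Real.sqrt_sq hn]
  constructor <;> field_simp <;> ring

/-! ### The separation roots on the reduced phase space -/

/-- The possible values of the pair of separation roots. -/
def rootRegion (e₁ e₂ e₃ e₄ : ℝ) : Set (ℝ × ℝ) :=
  {p | e₁ ≤ p.1 ∧ p.1 ≤ e₃ ∧ e₂ ≤ p.2 ∧ p.2 ≤ e₄ ∧ p.1 ≤ p.2}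

/-- The pair of roots of `2h s² - η₁ s + η₂`. -/
def sepRoots (h e₁ e₂ e₃ e₄ : ℝ) (L : AngMom) : ℝ × ℝ :=
  (smallRoot (2 * h) (-(eta₁ e₁ e₂ e₃ e₄ L)) (eta₂ e₁ e₂ e₃ e₄ L),
    largeRoot (2 * h) (-(eta₁ e₁ e₂ e₃ e₄ L)) (eta₂ e₁ e₂ e₃ e₄ L))

theorem continuous_ell :
    Continuous ell12 ∧ Continuous ell13 ∧ Continuous ell14 ∧ Continuous ell23 ∧
      Continuous ell24 ∧ Continuous ell34 := by
  refine ⟨?_, ?_, ?_, ?_, ?_, ?_⟩ <;> exact continuous_apply _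

theorem continuous_sepRoots (h e₁ e₂ e₃ e₄ : ℝ) : Continuous (sepRoots h e₁ e₂ e₃ e₄) := by
  obtain ⟨c1, c2, c3, c4, c5, c6⟩ := continuous_ell
  have h1 : Continuous (eta₁ e₁ e₂ e₃ e₄) := by unfold eta₁; fun_prop
  have h2 : Continuous (eta₂ e₁ e₂ e₃ e₄) := by unfold eta₂; fun_prop
  unfold sepRoots smallRoot largeRoot
  fun_prop

theorem quadratic_eq_sum {h : ℝ} {L : AngMom} (hL : L ∈ reducedPhaseSpace h)
    (e₁ e₂ e₃ e₄ s : ℝ) :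
    2 * h * s ^ 2 + -(eta₁ e₁ e₂ e₃ e₄ L) * s + eta₂ e₁ e₂ e₃ e₄ L =
      ell12 L ^ 2 * ((s - e₃) * (s - e₄)) + ell13 L ^ 2 * ((s - e₂) * (s - e₄))
      + ell14 L ^ 2 * ((s - e₂) * (s - e₃)) + ell23 L ^ 2 * ((s - e₁) * (s - e₄))
      + ell24 L ^ 2 * ((s - e₁) * (s - e₃)) + ell34 L ^ 2 * ((s - e₁) * (s - e₂)) := by
  rw [← hL.1]
  unfold casimir₁ eta₁ eta₂
  ring

theorem two_mul_abs_mul_le {c d C D t : ℝ} (hC : 0 ≤ C) (hD : 0 ≤ D)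
    (h : C * D = t ^ 2) : 2 * (|c * d| * t) ≤ c ^ 2 * C + d ^ 2 * D := by
  refine abs_le_of_sq_le_sq' ?_ (by positivity) |>.2
  rw [mul_pow, mul_pow, sq_abs, ← h]
  nlinarith [sq_nonneg (c ^ 2 * C - d ^ 2 * D)]

/-- By the intermediate value theorem some s in [e₂, e₃] makes the two nonnegative terms, those of
ℓ₁₂ and ℓ₃₄, equal; each is then |ℓ₁₂ ℓ₃₄| t with t the root of |∏ (s - eₖ)|. The four nonpositive
terms pair up to at most -2(|ℓ₁₃ ℓ₂₄| + |ℓ₁₄ ℓ₂₃|) t, and the Plücker relation compares the two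
amounts. -/
theorem exists_quadratic_nonpos {h e₁ e₂ e₃ e₄ : ℝ} (h12 : e₁ ≤ e₂) (h23 : e₂ ≤ e₃)
    (h34 : e₃ ≤ e₄) {L : AngMom} (hL : L ∈ reducedPhaseSpace h) :
    ∃ s ∈ Icc e₂ e₃,
      2 * h * s ^ 2 + -(eta₁ e₁ e₂ e₃ e₄ L) * s + eta₂ e₁ e₂ e₃ e₄ L ≤ 0 := by
  have hq : ContinuousOn (fun s => ell12 L ^ 2 * ((e₃ - s) * (e₄ - s))
      - ell34 L ^ 2 * ((s - e₁) * (s - e₂))) (Icc e₂ e₃) := by fun_prop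
  obtain ⟨s, hs, hs0⟩ := intermediate_value_Icc' h23 hq (show (0 : ℝ) ∈ Icc _ _ by
    constructor
    · have : 0 ≤ ell34 L ^ 2 * ((e₃ - e₁) * (e₃ - e₂)) :=
        mul_nonneg (sq_nonneg _) (mul_nonneg (by linarith) (by linarith))
      simp only [sub_self, zero_mul, mul_zero]
      linarith
    · have : 0 ≤ ell12 L ^ 2 * ((e₃ - e₂) * (e₄ - e₂)) :=
        mul_nonneg (sq_nonneg _) (mul_nonneg (by linarith) (by linarith))
      simp only [sub_self, mul_zero]
      linarith)
  refine ⟨s, hs, ?_⟩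
  rw [quadratic_eq_sum hL]
  obtain ⟨hs2, hs3⟩ := hs
  have a1 : 0 ≤ s - e₁ := by linarith
  have a2 : 0 ≤ s - e₂ := by linarith
  have a3 : 0 ≤ e₃ - s := by linarith
  have a4 : 0 ≤ e₄ - s := by linarith
  have ht : ((s - e₁) * (s - e₂) * ((e₃ - s) * (e₄ - s)))
      = √((s - e₁) * (s - e₂) * ((e₃ - s) * (e₄ - s))) ^ 2 :=
    (Real.sq_sqrt (by positivity)).symm
  have ht0 := Real.sqrt_nonneg ((s - e₁) * (s - e₂) * ((e₃ - s) * (e₄ - s)))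
  set t := √((s - e₁) * (s - e₂) * ((e₃ - s) * (e₄ - s)))
  have k1 := two_mul_abs_mul_le (c := ell13 L) (d := ell24 L) (t := t) (mul_nonneg a2 a4)
    (mul_nonneg a1 a3) (by rw [← ht]; ring)
  have k2 := two_mul_abs_mul_le (c := ell14 L) (d := ell23 L) (t := t) (mul_nonneg a2 a3)
    (mul_nonneg a1 a4) (by rw [← ht]; ring)
  have k3 : ell12 L ^ 2 * ((e₃ - s) * (e₄ - s)) = |ell12 L * ell34 L| * t := by
    have h0 : 0 ≤ |ell12 L * ell34 L| * t := by positivity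
    have h1 : 0 ≤ ell12 L ^ 2 * ((e₃ - s) * (e₄ - s)) := by positivity
    rw [← Real.sqrt_sq h0, ← Real.sqrt_sq h1]
    congr 1
    rw [mul_pow _ t, sq_abs, ← ht]
    linear_combination (ell12 L ^ 2 * ((e₃ - s) * (e₄ - s))) * hs0
  have hp : |ell12 L * ell34 L| ≤ |ell13 L * ell24 L| + |ell14 L * ell23 L| := by
    have : ell12 L * ell34 L = ell13 L * ell24 L - ell14 L * ell23 L := by
      have := hL.2
      unfold casimir₂ at this
      linarith
    rw [this]
    exact abs_sub _ _
  have := mul_le_mul_of_nonneg_right hp ht0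
  simp only at hs0
  nlinarith

/-- The hypotheses hold to the left of e₁ and to the right of e₄, so the roots lie in [e₁, e₄]. All
six weights being positive, the value could fail to be positive only at L = 0, which 2h > 0
excludes. -/
theorem quadratic_pos {h : ℝ} (hh : 0 < h) {L : AngMom} (hL : L ∈ reducedPhaseSpace h)
    {e₁ e₂ e₃ e₄ s : ℝ} (c₁₂ : 0 < (s - e₁) * (s - e₂)) (c₁₃ : 0 < (s - e₁) * (s - e₃))
    (c₁₄ : 0 < (s - e₁) * (s - e₄)) (c₂₃ : 0 < (s - e₂) * (s - e₃))
    (c₂₄ : 0 < (s - e₂) * (s - e₄)) (c₃₄ : 0 < (s - e₃) * (s - e₄)) :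
    0 < 2 * h * s ^ 2 + -(eta₁ e₁ e₂ e₃ e₄ L) * s + eta₂ e₁ e₂ e₃ e₄ L := by
  rw [quadratic_eq_sum hL]
  by_contra hcon
  have n1 := mul_nonneg (sq_nonneg (ell12 L)) c₃₄.le
  have n2 := mul_nonneg (sq_nonneg (ell13 L)) c₂₄.le
  have n3 := mul_nonneg (sq_nonneg (ell14 L)) c₂₃.le
  have n4 := mul_nonneg (sq_nonneg (ell23 L)) c₁₄.le
  have n5 := mul_nonneg (sq_nonneg (ell24 L)) c₁₃.le
  have n6 := mul_nonneg (sq_nonneg (ell34 L)) c₁₂.le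
  have z : ∀ {x c : ℝ}, 0 < c → x ^ 2 * c ≤ 0 → x ^ 2 = 0 := fun hc h =>
    le_antisymm (nonpos_of_mul_nonpos_left h hc) (sq_nonneg _)
  have z1 := z c₃₄ (x := ell12 L) (by linarith)
  have z2 := z c₂₄ (x := ell13 L) (by linarith)
  have z3 := z c₂₃ (x := ell14 L) (by linarith)
  have z4 := z c₁₄ (x := ell23 L) (by linarith)
  have z5 := z c₁₃ (x := ell24 L) (by linarith)
  have z6 := z c₁₂ (x := ell34 L) (by linarith)
  have := hL.1
  unfold casimir₁ at this
  linarith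

/-- The separation roots are real and interlace with the parameters. -/
theorem sepRoots_spec {h e₁ e₂ e₃ e₄ : ℝ} (hh : 0 < h) (h12 : e₁ ≤ e₂) (h23 : e₂ ≤ e₃)
    (h34 : e₃ ≤ e₄) {L : AngMom} (hL : L ∈ reducedPhaseSpace h) :
    (∀ s, 2 * h * s ^ 2 - eta₁ e₁ e₂ e₃ e₄ L * s + eta₂ e₁ e₂ e₃ e₄ L =
      2 * h * ((s - (sepRoots h e₁ e₂ e₃ e₄ L).1) * (s - (sepRoots h e₁ e₂ e₃ e₄ L).2))) ∧
    sepRoots h e₁ e₂ e₃ e₄ L ∈ rootRegion e₁ e₂ e₃ e₄ := by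
  obtain ⟨s₀, hs₀, hneg⟩ := exists_quadratic_nonpos h12 h23 h34 hL
  obtain ⟨hf, hl, hr⟩ := quadratic_roots (by linarith) hneg
  change ∀ s, _ = 2 * h * ((s - (sepRoots h e₁ e₂ e₃ e₄ L).1) * (s - (sepRoots h e₁ e₂ e₃ e₄ L).2)) at hf
  change (sepRoots h e₁ e₂ e₃ e₄ L).1 ≤ s₀ at hl
  change s₀ ≤ (sepRoots h e₁ e₂ e₃ e₄ L).2 at hr
  refine ⟨fun s => by rw [← hf]; ring, ?_, hl.trans hs₀.2, hs₀.1.trans hr, ?_, hl.trans hr⟩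
  · by_contra hlt
    rw [not_le] at hlt
    set s := (sepRoots h e₁ e₂ e₃ e₄ L).1
    have := quadratic_pos hh hL (s := s) (e₁ := e₁) (e₂ := e₂) (e₃ := e₃) (e₄ := e₄)
      (mul_pos_of_neg_of_neg (by linarith) (by linarith))
      (mul_pos_of_neg_of_neg (by linarith) (by linarith))
      (mul_pos_of_neg_of_neg (by linarith) (by linarith))
      (mul_pos_of_neg_of_neg (by linarith) (by linarith))
      (mul_pos_of_neg_of_neg (by linarith) (by linarith))
      (mul_pos_of_neg_of_neg (by linarith) (by linarith))
    rw [hf, sub_self, zero_mul, mul_zero] at this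
    exact lt_irrefl _ this
  · by_contra hlt
    rw [not_le] at hlt
    set s := (sepRoots h e₁ e₂ e₃ e₄ L).2
    have := quadratic_pos hh hL (s := s) (e₁ := e₁) (e₂ := e₂) (e₃ := e₃) (e₄ := e₄)
      (mul_pos (by linarith) (by linarith)) (mul_pos (by linarith) (by linarith))
      (mul_pos (by linarith) (by linarith)) (mul_pos (by linarith) (by linarith))
      (mul_pos (by linarith) (by linarith)) (mul_pos (by linarith) (by linarith))
    rw [hf, sub_self, mul_zero, mul_zero] at this
    exact lt_irrefl _ this

/-- The witness is the decomposable bivector E u ∧ v with unit vectors u = (s, 0, c, 0) and v = (0,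
s', 0, c'). Its quadratic splits into the factors z - (c² e₁ + s² e₃) and z - (c'² e₂ + s'² e₄), so
each root is placed independently as a convex combination. -/
theorem exists_sepRoots_eq {h e₁ e₂ e₃ e₄ : ℝ} (hh : 0 < h) (h13 : e₁ < e₃) (h24 : e₂ < e₄)
    {p : ℝ × ℝ} (hp : p ∈ rootRegion e₁ e₂ e₃ e₄) :
    ∃ L ∈ reducedPhaseSpace h, sepRoots h e₁ e₂ e₃ e₄ L = p := by
  obtain ⟨x, y⟩ := p
  obtain ⟨p1, p2, p3, p4, p5⟩ := hp
  simp only at p1 p2 p3 p4 p5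
  have d1 : 0 < e₃ - e₁ := by linarith
  have d2 : 0 < e₄ - e₂ := by linarith
  obtain ⟨E, hE⟩ : ∃ E, E = √(2 * h) := ⟨_, rfl⟩
  obtain ⟨c, hc⟩ : ∃ c, c = √((e₃ - x) / (e₃ - e₁)) := ⟨_, rfl⟩
  obtain ⟨s, hs⟩ : ∃ s, s = √((x - e₁) / (e₃ - e₁)) := ⟨_, rfl⟩
  obtain ⟨c', hc'⟩ : ∃ c, c = √((e₄ - y) / (e₄ - e₂)) := ⟨_, rfl⟩
  obtain ⟨s', hs'⟩ : ∃ s, s = √((y - e₂) / (e₄ - e₂)) := ⟨_, rfl⟩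
  have E2 : E ^ 2 = 2 * h := by rw [hE, Real.sq_sqrt (by linarith)]
  have c2 : c ^ 2 * (e₃ - e₁) = e₃ - x := by
    rw [hc, Real.sq_sqrt (div_nonneg (by linarith) d1.le), div_mul_cancel₀ _ d1.ne']
  have s2 : s ^ 2 * (e₃ - e₁) = x - e₁ := by
    rw [hs, Real.sq_sqrt (div_nonneg (by linarith) d1.le), div_mul_cancel₀ _ d1.ne']
  have c2' : c' ^ 2 * (e₄ - e₂) = e₄ - y := by
    rw [hc', Real.sq_sqrt (div_nonneg (by linarith) d2.le), div_mul_cancel₀ _ d2.ne']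
  have s2' : s' ^ 2 * (e₄ - e₂) = y - e₂ := by
    rw [hs', Real.sq_sqrt (div_nonneg (by linarith) d2.le), div_mul_cancel₀ _ d2.ne']
  have u : c ^ 2 + s ^ 2 = 1 := mul_right_cancel₀ d1.ne' (by linear_combination c2 + s2)
  have u' : c' ^ 2 + s' ^ 2 = 1 := mul_right_cancel₀ d2.ne' (by linear_combination c2' + s2')
  have hx : x = c ^ 2 * e₁ + s ^ 2 * e₃ := by linear_combination -s2 - e₁ * u
  have hy : y = c' ^ 2 * e₂ + s' ^ 2 * e₄ := by linear_combination -s2' - e₂ * u'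
  let L : AngMom := ![E * (s * s'), 0, E * (s * c'), -(E * (c * s')), 0, E * (c * c')]
  have l1 : ell12 L = E * (s * s') := rfl
  have l2 : ell13 L = 0 := rfl
  have l3 : ell14 L = E * (s * c') := rfl
  have l4 : ell23 L = -(E * (c * s')) := rfl
  have l5 : ell24 L = 0 := rfl
  have l6 : ell34 L = E * (c * c') := rfl
  have hη₁ : eta₁ e₁ e₂ e₃ e₄ L = 2 * h * (x + y) := by
    unfold eta₁
    rw [l1, l2, l3, l4, l5, l6, hx, hy, ← E2]
    linear_combination E ^ 2 * (c ^ 2 * e₁ + s ^ 2 * e₃) * u' + E ^ 2 * (c' ^ 2 * e₂ + s' ^ 2 * e₄) * u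
  have hη₂ : eta₂ e₁ e₂ e₃ e₄ L = 2 * h * (x * y) := by
    unfold eta₂
    rw [l1, l2, l3, l4, l5, l6, hx, hy, ← E2]
    ring
  refine ⟨L, ⟨?_, ?_⟩, ?_⟩
  · unfold casimir₁
    rw [l1, l2, l3, l4, l5, l6, ← E2]
    linear_combination E ^ 2 * (c' ^ 2 + s' ^ 2) * u + E ^ 2 * u'
  · unfold casimir₂
    rw [l1, l2, l3, l4, l5, l6]
    ring
  · obtain ⟨r1, r2⟩ := roots_of_factored (E := 2 * h) (by linarith) p5
    unfold sepRoots
    rw [hη₁, hη₂, r1, r2]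

/-! ### The action triangle -/

theorem exists_equilateral_triangle {h : ℝ} (hh : 0 < h) :
    ∃ T : Affine.Triangle ℝ (EuclideanSpace ℝ (Fin 3)),
      T.Equilateral ∧ T.closedInterior = actionTriangle h := by
  have hT : 0 < √(2 * h) := Real.sqrt_pos.mpr (by linarith)
  set t := √(2 * h) with ht
  let P : Fin 3 → EuclideanSpace ℝ (Fin 3) := fun i => EuclideanSpace.single i t
  have hcomb : ∀ (w : Fin 3 → ℝ) (j : Fin 3), (∑ i, w i • P i) j = w j * t := by
    intro w j
    simp only [P, Fin.sum_univ_three, PiLp.add_apply, PiLp.smul_apply, smul_eq_mul]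
    fin_cases j <;> simp
  have hind : AffineIndependent ℝ P := by
    rw [affineIndependent_iff]
    intro s w _ hw i hi
    have := congrArg (fun v : EuclideanSpace ℝ (Fin 3) => v i) hw
    simp only [P, PiLp.zero_apply, WithLp.ofLp_sum, Finset.sum_apply, PiLp.smul_apply,
      PiLp.single_apply, smul_eq_mul] at this
    rw [Finset.sum_eq_single_of_mem i hi fun j _ hj => by rw [if_neg hj.symm, mul_zero],
      if_pos rfl] at this
    exact (mul_eq_zero.mp this).resolve_right hT.ne'
  refine ⟨⟨P, hind⟩, ⟨√(t ^ 2 + t ^ 2), fun i j hij => ?_⟩, ?_⟩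
  · simp only [P]
    rw [EuclideanSpace.dist_eq]
    congr 1
    rw [Fin.sum_univ_three]
    clear hcomb hind P ht
    fin_cases i <;> fin_cases j <;> simp at hij ⊢
  · ext x
    constructor
    · rintro ⟨w, hw, hI, rfl⟩
      rw [Finset.affineCombination_eq_linear_combination _ _ _ hw]
      rw [Fin.sum_univ_three] at hw
      refine ⟨?_, fun i => ?_⟩
      · rw [hcomb, hcomb, hcomb, ← add_mul, ← add_mul, hw, one_mul]
      · rw [hcomb]
        exact mul_nonneg (hI i).1 hT.le
    · rintro ⟨hs, hn⟩
      have hw : ∑ i, x i / t = 1 := by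
        rw [Fin.sum_univ_three, ← add_div, ← add_div, hs, div_self hT.ne']
      refine ⟨fun i => x i / t, hw, fun i => ⟨div_nonneg (hn i) hT.le, ?_⟩, ?_⟩
      · rw [div_le_one hT, ht, ← hs]
        have h0 := hn 0
        have h1 := hn 1
        have h2 := hn 2
        fin_cases i <;> simp <;> linarith
      · rw [Finset.affineCombination_eq_linear_combination _ _ _ hw]
        ext j
        rw [hcomb, div_mul_cancel₀ _ hT.ne']

/-! ### A planar surjectivity argument -/

theorem isCompact_rootRegion (e₁ e₂ e₃ e₄ : ℝ) : IsCompact (rootRegion e₁ e₂ e₃ e₄) := by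
  have : rootRegion e₁ e₂ e₃ e₄ = (Icc e₁ e₃ ×ˢ Icc e₂ e₄) ∩ {p | p.1 ≤ p.2} := by
    ext p
    simp only [rootRegion, mem_ofPred_eq, mem_inter_iff, mem_prod, mem_Icc]
    tauto
  rw [this]
  exact (isCompact_Icc.prod isCompact_Icc).inter_right
    (isClosed_le continuous_fst continuous_snd)

/-- Among the pairs with F ≤ j and G ≤ k, take one that minimises r₂ - r₁. Off the boundary part in
`hbd`, if F < j then r₁ can be raised a little, which keeps F < j by continuity and does not raise
G; if G < k then r₂ can be lowered likewise. Either move contradicts minimality. On that boundary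
part, F + G ≥ j + k forces both equalities. -/
theorem exists_mem_rootRegion_eq {e₁ e₂ e₃ e₄ : ℝ} (h12 : e₁ ≤ e₂) (h23 : e₂ ≤ e₃)
    (h34 : e₃ ≤ e₄) {F G : ℝ × ℝ → ℝ} (hF : ContinuousOn F (rootRegion e₁ e₂ e₃ e₄))
    (hG : ContinuousOn G (rootRegion e₁ e₂ e₃ e₄))
    (hFmono : ∀ x y y', (x, y) ∈ rootRegion e₁ e₂ e₃ e₄ → (x, y') ∈ rootRegion e₁ e₂ e₃ e₄ →
      y ≤ y' → F (x, y) ≤ F (x, y'))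
    (hGanti : ∀ x x' y, (x, y) ∈ rootRegion e₁ e₂ e₃ e₄ → (x', y) ∈ rootRegion e₁ e₂ e₃ e₄ →
      x ≤ x' → G (x', y) ≤ G (x, y))
    {j k : ℝ} (hF0 : F (e₁, e₄) ≤ j) (hG0 : G (e₁, e₄) ≤ k)
    (hbd : ∀ p ∈ rootRegion e₁ e₂ e₃ e₄, p.1 = e₃ ∨ p.2 = e₂ ∨ p.1 = p.2 → j + k ≤ F p + G p) :
    ∃ p ∈ rootRegion e₁ e₂ e₃ e₄, F p = j ∧ G p = k := by
  set D := rootRegion e₁ e₂ e₃ e₄ with hD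
  let K : Set (ℝ × ℝ) := (D ∩ F ⁻¹' Iic j) ∩ (D ∩ G ⁻¹' Iic k)
  have hDc : IsCompact D := isCompact_rootRegion _ _ _ _
  have hK : IsCompact K :=
    (hDc.of_isClosed_subset (hF.preimage_isClosed_of_isClosed hDc.isClosed isClosed_Iic)
      inter_subset_left).inter_right
      (hG.preimage_isClosed_of_isClosed hDc.isClosed isClosed_Iic)
  have hcorner : (e₁, e₄) ∈ D :=
    ⟨le_rfl, h12.trans h23, h23.trans h34, le_rfl, (h12.trans h23).trans h34⟩
  obtain ⟨⟨x, y⟩, ⟨⟨hpD, hFj⟩, -, hGk⟩, hmin⟩ := hK.exists_isMinOn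
    ⟨(e₁, e₄), ⟨hcorner, hF0⟩, hcorner, hG0⟩
    (f := fun p : ℝ × ℝ => p.2 - p.1) (by fun_prop)
  simp only [mem_preimage, mem_Iic] at hFj hGk
  refine ⟨(x, y), hpD, ?_⟩
  by_cases hb : x = e₃ ∨ y = e₂ ∨ x = y
  · have := hbd _ hpD hb
    constructor <;> linarith
  · push Not at hb
    obtain ⟨b1, b2, b3⟩ := hb
    have hpD' := hpD
    obtain ⟨p1, p2, p3, p4, p5⟩ := hpD'
    simp only at p1 p2 p3 p4 p5
    have hxe : x < e₃ := lt_of_le_of_ne p2 b1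
    have hye : e₂ < y := lt_of_le_of_ne p3 (Ne.symm b2)
    have hxy : x < y := lt_of_le_of_ne p5 b3
    constructor
    · by_contra hne
      have hlt : F (x, y) < j := lt_of_le_of_ne hFj hne
      have hev : ∀ᶠ x' in 𝓝[>] x, (x', y) ∈ D := by
        filter_upwards [Ioo_mem_nhdsGT (lt_min hxe hxy)] with x' hx'
        exact ⟨p1.trans hx'.1.le, (hx'.2.trans_le (min_le_left _ _)).le, p3, p4,
          (hx'.2.trans_le (min_le_right _ _)).le⟩
      have hcont : Tendsto (fun x' => (x', y)) (𝓝[>] x) (𝓝[D] (x, y)) :=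
        tendsto_nhdsWithin_iff.mpr ⟨(Continuous.tendsto (by fun_prop) x).mono_left
          nhdsWithin_le_nhds, hev⟩
      have hF' := ((hF (x, y) hpD).tendsto.comp hcont).eventually_lt_const hlt
      obtain ⟨x', ⟨hx'D, hFx'⟩, hx'⟩ := ((hev.and hF').and self_mem_nhdsWithin).exists
      have hx'' : x < x' := hx'
      have := hmin (show (x', y) ∈ K from ⟨⟨hx'D, le_of_lt hFx'⟩, hx'D,
        (hGanti x x' y hpD hx'D hx''.le).trans hGk⟩)
      simp only [mem_ofPred_eq] at this
      linarith
    · by_contra hne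
      have hlt : G (x, y) < k := lt_of_le_of_ne hGk hne
      have hev : ∀ᶠ y' in 𝓝[<] y, (x, y') ∈ D := by
        filter_upwards [Ioo_mem_nhdsLT (max_lt hye hxy)] with y' hy'
        exact ⟨p1, p2, ((le_max_left _ _).trans_lt hy'.1).le, hy'.2.le.trans p4,
          ((le_max_right _ _).trans_lt hy'.1).le⟩
      have hcont : Tendsto (fun y' => (x, y')) (𝓝[<] y) (𝓝[D] (x, y)) :=
        tendsto_nhdsWithin_iff.mpr ⟨(Continuous.tendsto (by fun_prop) y).mono_left
          nhdsWithin_le_nhds, hev⟩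
      have hG' := ((hG (x, y) hpD).tendsto.comp hcont).eventually_lt_const hlt
      obtain ⟨y', ⟨hy'D, hGy'⟩, hy'⟩ := ((hev.and hG').and self_mem_nhdsWithin).exists
      have hy'' : y' < y := hy'
      have := hmin (show (x, y') ∈ K from ⟨⟨hy'D, (hFmono x y' y hy'D hpD hy''.le).trans hFj⟩,
        hy'D, le_of_lt hGy'⟩)
      simp only [mem_ofPred_eq] at this
      linarith

/-- The actions are continuous with image the triangle if they factor through the separation
roots in a suitable way. -/
theorem actionImageIsTriangle_of_sepRoots {h e₁ e₂ e₃ e₄ : ℝ} (hh : 0 < h) (h12 : e₁ ≤ e₂)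
    (h23 : e₂ ≤ e₃) (h34 : e₃ ≤ e₄) (h13 : e₁ < e₃) (h24 : e₂ < e₄) {S : AngMom → SeparatedData}
    {F H G : ℝ × ℝ → ℝ} (hadm : ∀ L ∈ reducedPhaseSpace h, ∀ i, (S L).Admissible i)
    (hact : ∀ L ∈ reducedPhaseSpace h, (S L).actions = WithLp.toLp 2
      ![F (sepRoots h e₁ e₂ e₃ e₄ L), H (sepRoots h e₁ e₂ e₃ e₄ L), G (sepRoots h e₁ e₂ e₃ e₄ L)])
    (hF : ContinuousOn F (rootRegion e₁ e₂ e₃ e₄)) (hH : ContinuousOn H (rootRegion e₁ e₂ e₃ e₄))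
    (hG : ContinuousOn G (rootRegion e₁ e₂ e₃ e₄))
    (hnonneg : ∀ p ∈ rootRegion e₁ e₂ e₃ e₄, 0 ≤ F p ∧ 0 ≤ H p ∧ 0 ≤ G p)
    (hsum : ∀ p ∈ rootRegion e₁ e₂ e₃ e₄, F p + H p + G p = √(2 * h))
    (hFmono : ∀ x y y', (x, y) ∈ rootRegion e₁ e₂ e₃ e₄ → (x, y') ∈ rootRegion e₁ e₂ e₃ e₄ →
      y ≤ y' → F (x, y) ≤ F (x, y'))
    (hGanti : ∀ x x' y, (x, y) ∈ rootRegion e₁ e₂ e₃ e₄ → (x', y) ∈ rootRegion e₁ e₂ e₃ e₄ →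
      x ≤ x' → G (x', y) ≤ G (x, y))
    (hF0 : F (e₁, e₄) = 0) (hG0 : G (e₁, e₄) = 0)
    (hH0 : ∀ p ∈ rootRegion e₁ e₂ e₃ e₄, p.1 = e₃ ∨ p.2 = e₂ ∨ p.1 = p.2 → H p = 0) :
    ActionImageIsTriangle h S := by
  have hmem : ∀ L ∈ reducedPhaseSpace h, sepRoots h e₁ e₂ e₃ e₄ L ∈ rootRegion e₁ e₂ e₃ e₄ :=
    fun L hL => (sepRoots_spec hh h12 h23 h34 hL).2
  refine ⟨hadm, ?_, ?_⟩
  · refine ContinuousOn.congr ?_ hact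
    refine (PiLp.continuous_toLp 2 _).comp_continuousOn (continuousOn_pi.mpr fun i => ?_)
    have hc := (continuous_sepRoots h e₁ e₂ e₃ e₄).continuousOn (s := reducedPhaseSpace h)
    fin_cases i
    · exact hF.comp hc hmem
    · exact hH.comp hc hmem
    · exact hG.comp hc hmem
  · ext J
    constructor
    · rintro ⟨L, hL, rfl⟩
      simp only
      rw [hact L hL]
      have hn := hnonneg _ (hmem L hL)
      refine ⟨by simpa using hsum _ (hmem L hL), fun i => ?_⟩
      fin_cases i
      · exact hn.1
      · exact hn.2.1
      · exact hn.2.2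
    · rintro ⟨hJ, hJ0⟩
      -- Where the middle action vanishes, the outer two add up to √(2h) ≥ J 0 + J 2. The middle
      -- coordinate comes for free from the sum.
      obtain ⟨p, hp, hFp, hGp⟩ := exists_mem_rootRegion_eq h12 h23 h34 hF hG hFmono hGanti
        (j := J 0) (k := J 2) (hF0.le.trans (hJ0 0)) (hG0.le.trans (hJ0 2)) (by
          intro p hp hb
          have h1 := hsum p hp
          rw [hH0 p hp hb] at h1
          linarith [hJ0 1])
      obtain ⟨L, hL, hLp⟩ := exists_sepRoots_eq hh h13 h24 hp
      refine ⟨L, hL, ?_⟩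
      simp only
      rw [hact L hL, hLp]
      have h1 := hsum p hp
      ext i
      fin_cases i
      · exact hFp
      · change H p = J 1
        linarith
      · exact hGp

/-! ### Continuity of the partial integrals of the density -/

/-- The roots stay in a bounded set, so their factors are at most 1 + |s| + C each and one
integrable function dominates all densities. -/
theorem continuousOn_integral_dens {e₁ e₂ e₃ e₄ f₁ f₂ f₃ f₄ x y : ℝ} {w : ℝ → ℝ}
    (hw : IntervalIntegrable w volume x y) (hw0 : ∀ s, 0 ≤ w s)
    (hle : ∀ p ∈ rootRegion f₁ f₂ f₃ f₄, ∀ s,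
      dens p.1 p.2 e₁ e₂ e₃ e₄ s ≤ (1 + |s - p.1|) * (1 + |s - p.2|) * w s) :
    (∀ p ∈ rootRegion f₁ f₂ f₃ f₄, IntervalIntegrable (dens p.1 p.2 e₁ e₂ e₃ e₄) volume x y) ∧
    ContinuousOn (fun p : ℝ × ℝ => ∫ s in x..y, dens p.1 p.2 e₁ e₂ e₃ e₄ s)
      (rootRegion f₁ f₂ f₃ f₄) := by
  let C := |f₁| + |f₂| + |f₃| + |f₄|
  have hb : ∀ p ∈ rootRegion f₁ f₂ f₃ f₄, ∀ s,
      dens p.1 p.2 e₁ e₂ e₃ e₄ s ≤ (1 + |s| + C) ^ 2 * w s := by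
    intro p hp s
    refine (hle p hp s).trans (mul_le_mul_of_nonneg_right ?_ (hw0 s))
    have h1 : |s - p.1| ≤ |s| + C := by
      have := abs_sub s p.1
      have h3 : |p.1| ≤ C := by
        refine abs_le.mpr ⟨?_, ?_⟩ <;> simp only [C]
        · linarith [hp.1, neg_abs_le f₁, abs_nonneg f₂, abs_nonneg f₃, abs_nonneg f₄]
        · linarith [hp.2.1, le_abs_self f₃, abs_nonneg f₂, abs_nonneg f₁, abs_nonneg f₄]
      linarith
    have h2 : |s - p.2| ≤ |s| + C := by
      have := abs_sub s p.2
      have h3 : |p.2| ≤ C := by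
        refine abs_le.mpr ⟨?_, ?_⟩ <;> simp only [C]
        · linarith [hp.2.2.1, neg_abs_le f₂, abs_nonneg f₁, abs_nonneg f₃, abs_nonneg f₄]
        · linarith [hp.2.2.2.1, le_abs_self f₄, abs_nonneg f₂, abs_nonneg f₁, abs_nonneg f₃]
      linarith
    have h3 := abs_nonneg (s - p.1)
    have h4 := abs_nonneg (s - p.2)
    rw [sq]
    gcongr ?_ * ?_ <;> linarith
  have hbint : IntervalIntegrable (fun s => (1 + |s| + C) ^ 2 * w s) volume x y :=
    hw.continuousOn_mul (Continuous.continuousOn (f := fun s => (1 + |s| + C) ^ 2) (by fun_prop))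
  refine ⟨fun p hp => intervalIntegrable_of_nonneg_of_le hbint (measurable_dens _ _ _ _ _ _)
    (dens_nonneg _ _ _ _ _ _) (hb p hp), fun p hp => ?_⟩
  refine intervalIntegral.continuousWithinAt_of_dominated_interval
    (Eventually.of_forall fun q => (measurable_dens _ _ _ _ _ _).aestronglyMeasurable) ?_ hbint
    (Eventually.of_forall fun s _ => (continuous_dens_roots _ _ _ _ s).continuousWithinAt)
  filter_upwards [self_mem_nhdsWithin] with q hq
  refine Eventually.of_forall fun s _ => ?_
  rw [Real.norm_of_nonneg (dens_nonneg _ _ _ _ _ _ _)]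
  exact hb q hq s

theorem sqrt_le_one_add {t : ℝ} (ht : 0 ≤ t) : √t ≤ 1 + t := by
  rw [Real.sqrt_le_left (by linarith)]
  nlinarith

theorem dens_le_of_simple (r₁ r₂ e₁ e₂ e₃ e₄ s : ℝ) :
    dens r₁ r₂ e₁ e₂ e₃ e₄ s ≤ (1 + |s - r₁|) * (1 + |s - r₂|) *
      (invSqrtDist e₁ s * (invSqrtDist e₂ s * (invSqrtDist e₃ s * invSqrtDist e₄ s))) := by
  refine (dens_le _ _ _ _ _ _ _).trans (mul_le_mul_of_nonneg_right ?_ ?_)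
  · exact mul_le_mul (sqrt_le_one_add (abs_nonneg _)) (sqrt_le_one_add (abs_nonneg _))
      (Real.sqrt_nonneg _) (by positivity)
  · unfold invSqrtDist
    positivity

/-- A double pole gives 1/|s - p|, which is not integrable. A root nearer to s than p cancels one of
the two inverse square roots; in the third alternative the density is zero. -/
theorem dens_le_of_double {r₁ r₂ u v p s : ℝ}
    (h : |s - r₁| ≤ |s - p| ∨ |s - r₂| ≤ |s - p| ∨
      0 ≤ (s - r₁) * (s - r₂) / ((s - u) * (s - v) * (s - p) * (s - p))) :
    dens r₁ r₂ u v p p s ≤ (1 + |s - r₁|) * (1 + |s - r₂|) *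
      (invSqrtDist u s * (invSqrtDist v s * invSqrtDist p s)) := by
  have hw : 0 ≤ invSqrtDist u s * (invSqrtDist v s * invSqrtDist p s) := by
    unfold invSqrtDist; positivity
  have hc : ∀ r, |s - r| ≤ |s - p| → √|s - r| * invSqrtDist p s ≤ 1 := by
    intro r hr
    unfold invSqrtDist
    rw [← div_eq_mul_inv]
    exact div_le_one_of_le₀ (Real.sqrt_le_sqrt hr) (Real.sqrt_nonneg _)
  have h1 := abs_nonneg (s - r₁)
  have h2 := abs_nonneg (s - r₂)
  have q1 := Real.sqrt_nonneg |s - r₁|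
  have q2 := Real.sqrt_nonneg |s - r₂|
  rcases h with h | h | h
  · refine (dens_le _ _ _ _ _ _ _).trans ?_
    calc _ = (√|s - r₁| * invSqrtDist p s) * √|s - r₂| *
          (invSqrtDist u s * (invSqrtDist v s * invSqrtDist p s)) := by ring
      _ ≤ _ := by
        refine mul_le_mul_of_nonneg_right (mul_le_mul ((hc _ h).trans (by linarith))
          (sqrt_le_one_add h2) q2 (by linarith)) hw
  · refine (dens_le _ _ _ _ _ _ _).trans ?_
    calc _ = √|s - r₁| * (√|s - r₂| * invSqrtDist p s) *
          (invSqrtDist u s * (invSqrtDist v s * invSqrtDist p s)) := by ring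
      _ ≤ _ := by
        refine mul_le_mul_of_nonneg_right (mul_le_mul (sqrt_le_one_add h1)
          ((hc _ h).trans (by linarith)) (mul_nonneg q2 (invSqrtDist_nonneg _ _))
          (by linarith)) hw
  · rw [dens_eq_zero h]
    exact mul_nonneg (by positivity) hw

/-! ### Sign of the density between the poles -/

theorem dens_left {r₁ r₂ e₁ e₂ e₃ e₄ s : ℝ} (h23 : e₂ ≤ e₃) (h34 : e₃ ≤ e₄) (hr2 : e₂ ≤ r₂)
    (hs : s ∈ Ioo e₁ e₂) :
    (s ≤ r₁ → 0 ≤ -((s - r₁) * (s - r₂)) / ((s - e₁) * (s - e₂) * (s - e₃) * (s - e₄))) ∧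
    (r₁ ≤ s → dens r₁ r₂ e₁ e₂ e₃ e₄ s = 0) := by
  obtain ⟨h1, h2⟩ := hs
  have b1 : 0 ≤ s - e₁ := by linarith
  have b2 : 0 ≤ e₂ - s := by linarith
  have b3 : 0 ≤ e₃ - s := by linarith
  have b4 : 0 ≤ e₄ - s := by linarith
  have c2 : 0 ≤ r₂ - s := by linarith
  constructor <;> intro h
  · have c1 : 0 ≤ r₁ - s := by linarith
    rw [show -((s - r₁) * (s - r₂)) / ((s - e₁) * (s - e₂) * (s - e₃) * (s - e₄))
      = ((r₁ - s) * (r₂ - s)) / ((s - e₁) * (e₂ - s) * (e₃ - s) * (e₄ - s)) by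
        rw [← neg_div_neg_eq]; congr 1 <;> ring]
    positivity
  · have c1 : 0 ≤ s - r₁ := by linarith
    apply dens_eq_zero
    rw [show ((s - r₁) * (s - r₂)) / ((s - e₁) * (s - e₂) * (s - e₃) * (s - e₄))
      = ((s - r₁) * (r₂ - s)) / ((s - e₁) * (e₂ - s) * (e₃ - s) * (e₄ - s)) by
        rw [← neg_div_neg_eq]; congr 1 <;> ring]
    positivity

theorem dens_mid {r₁ r₂ e₁ e₂ e₃ e₄ s : ℝ} (h12 : e₁ ≤ e₂) (h34 : e₃ ≤ e₄) (hr : r₁ ≤ r₂)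
    (hs : s ∈ Ioo e₂ e₃) :
    (r₁ ≤ s → s ≤ r₂ →
      0 ≤ -((s - r₁) * (s - r₂)) / ((s - e₁) * (s - e₂) * (s - e₃) * (s - e₄))) ∧
    (s ≤ r₁ ∨ r₂ ≤ s → dens r₁ r₂ e₁ e₂ e₃ e₄ s = 0) := by
  obtain ⟨h1, h2⟩ := hs
  have b1 : 0 ≤ s - e₁ := by linarith
  have b2 : 0 ≤ s - e₂ := by linarith
  have b3 : 0 ≤ e₃ - s := by linarith
  have b4 : 0 ≤ e₄ - s := by linarith
  constructor
  · intro h3 h4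
    have c1 : 0 ≤ s - r₁ := by linarith
    have c2 : 0 ≤ r₂ - s := by linarith
    rw [show -((s - r₁) * (s - r₂)) / ((s - e₁) * (s - e₂) * (s - e₃) * (s - e₄))
      = ((s - r₁) * (r₂ - s)) / ((s - e₁) * (s - e₂) * (e₃ - s) * (e₄ - s)) by
        congr 1 <;> ring]
    positivity
  · intro h
    apply dens_eq_zero
    have hn : 0 ≤ (s - r₁) * (s - r₂) := by
      rcases h with h | h
      · exact mul_nonneg_of_nonpos_of_nonpos (by linarith) (by linarith)
      · exact mul_nonneg (by linarith) (by linarith)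
    rw [show ((s - r₁) * (s - r₂)) / ((s - e₁) * (s - e₂) * (s - e₃) * (s - e₄))
      = ((s - r₁) * (s - r₂)) / ((s - e₁) * (s - e₂) * (e₃ - s) * (e₄ - s)) by
        congr 1; ring]
    positivity

theorem dens_right {r₁ r₂ e₁ e₂ e₃ e₄ s : ℝ} (h12 : e₁ ≤ e₂) (h23 : e₂ ≤ e₃) (hr1 : r₁ ≤ e₃)
    (hs : s ∈ Ioo e₃ e₄) :
    (r₂ ≤ s → 0 ≤ -((s - r₁) * (s - r₂)) / ((s - e₁) * (s - e₂) * (s - e₃) * (s - e₄))) ∧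
    (s ≤ r₂ → dens r₁ r₂ e₁ e₂ e₃ e₄ s = 0) := by
  obtain ⟨h1, h2⟩ := hs
  have b1 : 0 ≤ s - e₁ := by linarith
  have b2 : 0 ≤ s - e₂ := by linarith
  have b3 : 0 ≤ s - e₃ := by linarith
  have b4 : 0 ≤ e₄ - s := by linarith
  have c1 : 0 ≤ s - r₁ := by linarith
  constructor <;> intro h
  · have c2 : 0 ≤ s - r₂ := by linarith
    rw [show -((s - r₁) * (s - r₂)) / ((s - e₁) * (s - e₂) * (s - e₃) * (s - e₄))
      = ((s - r₁) * (s - r₂)) / ((s - e₁) * (s - e₂) * (s - e₃) * (e₄ - s)) by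
        rw [← neg_div_neg_eq]; congr 1 <;> ring]
    positivity
  · have c2 : 0 ≤ r₂ - s := by linarith
    apply dens_eq_zero
    rw [show ((s - r₁) * (s - r₂)) / ((s - e₁) * (s - e₂) * (s - e₃) * (s - e₄))
      = ((s - r₁) * (r₂ - s)) / ((s - e₁) * (s - e₂) * (s - e₃) * (e₄ - s)) by
        rw [← neg_div_neg_eq]; congr 1 <;> ring]
    positivity

/-- Where the density does not vanish, s is below both roots, and raising the upper one only
enlarges its factor y - s. -/
theorem dens_left_mono {x y y' e₁ e₂ e₃ e₄ s : ℝ} (h23 : e₂ ≤ e₃) (h34 : e₃ ≤ e₄) (hy : e₂ ≤ y)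
    (hyy : y ≤ y') (hs : s ∈ Ioo e₁ e₂) :
    dens x y e₁ e₂ e₃ e₄ s ≤ dens x y' e₁ e₂ e₃ e₄ s := by
  rcases le_total x s with h | h
  · rw [(dens_left h23 h34 hy hs).2 h]
    exact dens_nonneg _ _ _ _ _ _ _
  · obtain ⟨h1, h2⟩ := hs
    have b1 : 0 ≤ s - e₁ := by linarith
    have b2 : 0 ≤ e₂ - s := by linarith
    have b3 : 0 ≤ e₃ - s := by linarith
    have b4 : 0 ≤ e₄ - s := by linarith
    refine Real.sqrt_le_sqrt ?_
    rw [show (s - e₁) * (s - e₂) * (s - e₃) * (s - e₄)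
      = -((s - e₁) * (e₂ - s) * (e₃ - s) * (e₄ - s)) by ring, neg_div_neg_eq, neg_div_neg_eq]
    refine div_le_div_of_nonneg_right ?_ (by positivity)
    nlinarith

theorem dens_right_anti {x x' y e₁ e₂ e₃ e₄ s : ℝ} (h12 : e₁ ≤ e₂) (h23 : e₂ ≤ e₃) (hx' : x' ≤ e₃)
    (hxx : x ≤ x') (hs : s ∈ Ioo e₃ e₄) :
    dens x' y e₁ e₂ e₃ e₄ s ≤ dens x y e₁ e₂ e₃ e₄ s := by
  rcases le_total s y with h | h
  · rw [(dens_right h12 h23 hx' hs).2 h]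
    exact dens_nonneg _ _ _ _ _ _ _
  · obtain ⟨h1, h2⟩ := hs
    have b1 : 0 ≤ s - e₁ := by linarith
    have b2 : 0 ≤ s - e₂ := by linarith
    have b3 : 0 ≤ s - e₃ := by linarith
    have b4 : 0 ≤ e₄ - s := by linarith
    refine Real.sqrt_le_sqrt ?_
    rw [show (s - e₁) * (s - e₂) * (s - e₃) * (s - e₄)
      = -((s - e₁) * (s - e₂) * (s - e₃) * (e₄ - s)) by ring, neg_div_neg_eq, neg_div_neg_eq]
    refine div_le_div_of_nonneg_right ?_ (by positivity)
    nlinarith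

/-! ### Partial integrals of the density as functions of the roots -/

/-- The integral of the density over `[x, y]`, in units of the actions at energy `h`. -/
def partialAction (h e₁ e₂ e₃ e₄ x y : ℝ) (p : ℝ × ℝ) : ℝ :=
  √(2 * h) / Real.pi * ∫ s in x..y, dens p.1 p.2 e₁ e₂ e₃ e₄ s

theorem partialAction_nonneg {h e₁ e₂ e₃ e₄ x y : ℝ} (hxy : x ≤ y) (p : ℝ × ℝ) :
    0 ≤ partialAction h e₁ e₂ e₃ e₄ x y p :=
  mul_nonneg (div_nonneg (Real.sqrt_nonneg _) Real.pi_pos.le)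
    (intervalIntegral.integral_nonneg hxy fun _ _ => dens_nonneg _ _ _ _ _ _ _)

theorem partialAction_eq_zero {h e₁ e₂ e₃ e₄ x y : ℝ} (hxy : x ≤ y) {p : ℝ × ℝ}
    (hz : ∀ s ∈ Ioo x y, dens p.1 p.2 e₁ e₂ e₃ e₄ s = 0) :
    partialAction h e₁ e₂ e₃ e₄ x y p = 0 := by
  unfold partialAction
  rw [integral_eq_zero_of_forall_Ioo hxy hz, mul_zero]

theorem partialAction_le {h e₁ e₂ e₃ e₄ x y : ℝ} (hxy : x ≤ y) {p q : ℝ × ℝ}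
    (hp : IntervalIntegrable (dens p.1 p.2 e₁ e₂ e₃ e₄) volume x y)
    (hq : IntervalIntegrable (dens q.1 q.2 e₁ e₂ e₃ e₄) volume x y)
    (hle : ∀ s ∈ Ioo x y, dens p.1 p.2 e₁ e₂ e₃ e₄ s ≤ dens q.1 q.2 e₁ e₂ e₃ e₄ s) :
    partialAction h e₁ e₂ e₃ e₄ x y p ≤ partialAction h e₁ e₂ e₃ e₄ x y q :=
  mul_le_mul_of_nonneg_left (intervalIntegral.integral_mono_on_of_le_Ioo hxy hp hq hle)
    (div_nonneg (Real.sqrt_nonneg _) Real.pi_pos.le)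

theorem partialAction_left_mono {h e₁ e₂ e₃ e₄ : ℝ} (h12 : e₁ ≤ e₂) (h23 : e₂ ≤ e₃) (h34 : e₃ ≤ e₄)
    (hint : ∀ p ∈ rootRegion e₁ e₂ e₃ e₄, ∀ x y,
      IntervalIntegrable (dens p.1 p.2 e₁ e₂ e₃ e₄) volume x y) (x y y' : ℝ)
    (hp : (x, y) ∈ rootRegion e₁ e₂ e₃ e₄) (hq : (x, y') ∈ rootRegion e₁ e₂ e₃ e₄) (hy : y ≤ y') :
    partialAction h e₁ e₂ e₃ e₄ e₁ e₂ (x, y) ≤ partialAction h e₁ e₂ e₃ e₄ e₁ e₂ (x, y') :=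
  partialAction_le h12 (hint _ hp _ _) (hint _ hq _ _) fun _ hs =>
    dens_left_mono h23 h34 hp.2.2.1 hy hs

theorem partialAction_right_anti {h e₁ e₂ e₃ e₄ : ℝ} (h12 : e₁ ≤ e₂) (h23 : e₂ ≤ e₃)
    (h34 : e₃ ≤ e₄) (hint : ∀ p ∈ rootRegion e₁ e₂ e₃ e₄, ∀ x y,
      IntervalIntegrable (dens p.1 p.2 e₁ e₂ e₃ e₄) volume x y) (x x' y : ℝ)
    (hp : (x, y) ∈ rootRegion e₁ e₂ e₃ e₄) (hq : (x', y) ∈ rootRegion e₁ e₂ e₃ e₄) (hx : x ≤ x') :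
    partialAction h e₁ e₂ e₃ e₄ e₃ e₄ (x', y) ≤ partialAction h e₁ e₂ e₃ e₄ e₃ e₄ (x, y) :=
  partialAction_le h34 (hint _ hq _ _) (hint _ hp _ _) fun _ hs =>
    dens_right_anti h12 h23 hq.2.1 hx hs

theorem partialAction_mid_eq_zero {h e₁ e₂ e₃ e₄ : ℝ} (h12 : e₁ ≤ e₂) (h23 : e₂ ≤ e₃)
    (h34 : e₃ ≤ e₄) {p : ℝ × ℝ} (hp : p ∈ rootRegion e₁ e₂ e₃ e₄)
    (hb : p.1 = e₃ ∨ p.2 = e₂ ∨ p.1 = p.2) : partialAction h e₁ e₂ e₃ e₄ e₂ e₃ p = 0 := by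
  refine partialAction_eq_zero h23 fun s hs => (dens_mid h12 h34 hp.2.2.2.2 hs).2 ?_
  rcases hb with h | h | h
  · left; rw [h]; exact hs.2.le
  · right; rw [h]; exact hs.1.le
  · rw [h]; exact le_total _ _

/-! ### Actions computed from the density -/

/-- The `i`-th action is well defined and equal to `c`. -/
abbrev SeparatedData.HasAction (D : SeparatedData) (i : Fin 3) (c : ℝ) : Prop :=
  D.Admissible i ∧ 2 / Real.pi * (∫ s in (D.lo i)..(D.hi i), √(D.sqMomentum i s)) = c

/-- The density vanishes on [x, y] outside the interval of motion, so the moving end points can be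
replaced by fixed ones. -/
theorem SeparatedData.hasAction_of_dens {D : SeparatedData} {i : Fin 3} {h r₁ r₂ e₁ e₂ e₃ e₄ x y : ℝ}
    (hh : 0 ≤ h) (hx : x ≤ D.lo i) (hlh : D.lo i ≤ D.hi i) (hy : D.hi i ≤ y)
    (hpsq : ∀ s ∈ Ioo x y, D.sqMomentum i s = 2 * h / 4 *
      (-((s - r₁) * (s - r₂)) / ((s - e₁) * (s - e₂) * (s - e₃) * (s - e₄))))
    (hpos : ∀ s ∈ Ioo x y, D.lo i ≤ s → s ≤ D.hi i →
      0 ≤ -((s - r₁) * (s - r₂)) / ((s - e₁) * (s - e₂) * (s - e₃) * (s - e₄)))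
    (hzero : ∀ s ∈ Ioo x y, s ≤ D.lo i ∨ D.hi i ≤ s → dens r₁ r₂ e₁ e₂ e₃ e₄ s = 0)
    (hint : ∀ x y, IntervalIntegrable (dens r₁ r₂ e₁ e₂ e₃ e₄) volume x y) :
    D.HasAction i (partialAction h e₁ e₂ e₃ e₄ x y (r₁, r₂)) := by
  have hsub : ∀ s ∈ Ioo (D.lo i) (D.hi i), s ∈ Ioo x y := fun s hs =>
    ⟨hx.trans_lt hs.1, hs.2.trans_le hy⟩
  have hsqrt : ∀ s ∈ Ioo (D.lo i) (D.hi i),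
      √(2 * h) / 2 * dens r₁ r₂ e₁ e₂ e₃ e₄ s = √(D.sqMomentum i s) := by
    intro s hs
    rw [hpsq s (hsub s hs), Real.sqrt_mul (x := 2 * h / 4) (by linarith),
      Real.sqrt_div (x := 2 * h) (by linarith),
      show (4 : ℝ) = 2 ^ 2 by norm_num, Real.sqrt_sq (by norm_num), dens]
  have hae : ∀ᵐ s, s ∈ uIoc (D.lo i) (D.hi i) →
      √(2 * h) / 2 * dens r₁ r₂ e₁ e₂ e₃ e₄ s = √(D.sqMomentum i s) := by
    filter_upwards [Measure.ae_ne volume (D.hi i)] with s hs hs'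
    rw [uIoc_of_le hlh] at hs'
    exact hsqrt s ⟨hs'.1, lt_of_le_of_ne hs'.2 hs⟩
  refine ⟨⟨hlh, fun s hs => ?_, ?_⟩, ?_⟩
  · rw [hpsq s (hsub s hs)]
    exact mul_nonneg (by linarith) (hpos s (hsub s hs) hs.1.le hs.2.le)
  · exact ((hint _ _).const_mul _).congr_ae ((ae_restrict_iff' measurableSet_uIoc).mpr hae)
  · rw [← intervalIntegral.integral_congr_ae hae, intervalIntegral.integral_const_mul]
    unfold partialAction
    rw [← intervalIntegral.integral_add_adjacent_intervals (hint x (D.lo i)) (hint (D.lo i) y),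
      ← intervalIntegral.integral_add_adjacent_intervals (hint (D.lo i) (D.hi i)) (hint (D.hi i) y),
      integral_eq_zero_of_forall_Ioo hx fun s hs =>
        hzero s ⟨hs.1, hs.2.trans_le (hlh.trans hy)⟩ (Or.inl hs.2.le),
      integral_eq_zero_of_forall_Ioo hy fun s hs =>
        hzero s ⟨(hx.trans hlh).trans_lt hs.1, hs.2⟩ (Or.inr hs.1.le)]
    have := Real.pi_pos
    field_simp
    ring

theorem hasAction_left {D : SeparatedData} {i : Fin 3} {h e₁ e₂ e₃ e₄ : ℝ} {p : ℝ × ℝ}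
    (hh : 0 ≤ h) (h12 : e₁ ≤ e₂) (h23 : e₂ ≤ e₃) (h34 : e₃ ≤ e₄)
    (hp : p ∈ rootRegion e₁ e₂ e₃ e₄) (hlo : D.lo i = e₁) (hhi : D.hi i = min p.1 e₂)
    (hpsq : ∀ s ∈ Ioo e₁ e₂, D.sqMomentum i s = 2 * h / 4 *
      (-((s - p.1) * (s - p.2)) / ((s - e₁) * (s - e₂) * (s - e₃) * (s - e₄))))
    (hint : ∀ x y, IntervalIntegrable (dens p.1 p.2 e₁ e₂ e₃ e₄) volume x y) :
    D.HasAction i (partialAction h e₁ e₂ e₃ e₄ e₁ e₂ p) := by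
  refine SeparatedData.hasAction_of_dens hh hlo.ge ?_ ?_ hpsq ?_ ?_ hint
  · rw [hlo, hhi]; exact le_min hp.1 h12
  · rw [hhi]; exact min_le_right _ _
  · intro s hs _ h2
    rw [hhi] at h2
    exact (dens_left h23 h34 hp.2.2.1 hs).1 (h2.trans (min_le_left _ _))
  · rintro s hs (h1 | h1)
    · rw [hlo] at h1; exact absurd hs.1 h1.not_gt
    · rw [hhi] at h1
      rcases min_le_iff.mp h1 with h2 | h2
      · exact (dens_left h23 h34 hp.2.2.1 hs).2 h2
      · exact absurd hs.2 h2.not_gt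

theorem hasAction_mid {D : SeparatedData} {i : Fin 3} {h e₁ e₂ e₃ e₄ : ℝ} {p : ℝ × ℝ}
    (hh : 0 ≤ h) (h12 : e₁ ≤ e₂) (h23 : e₂ ≤ e₃) (h34 : e₃ ≤ e₄)
    (hp : p ∈ rootRegion e₁ e₂ e₃ e₄) (hlo : D.lo i = max p.1 e₂) (hhi : D.hi i = min p.2 e₃)
    (hpsq : ∀ s ∈ Ioo e₂ e₃, D.sqMomentum i s = 2 * h / 4 *
      (-((s - p.1) * (s - p.2)) / ((s - e₁) * (s - e₂) * (s - e₃) * (s - e₄))))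
    (hint : ∀ x y, IntervalIntegrable (dens p.1 p.2 e₁ e₂ e₃ e₄) volume x y) :
    D.HasAction i (partialAction h e₁ e₂ e₃ e₄ e₂ e₃ p) := by
  obtain ⟨p1, p2, p3, p4, p5⟩ := hp
  refine SeparatedData.hasAction_of_dens hh ?_ ?_ ?_ hpsq ?_ ?_ hint
  · rw [hlo]; exact le_max_right _ _
  · rw [hlo, hhi]; exact max_le (le_min p5 p2) (le_min p3 h23)
  · rw [hhi]; exact min_le_right _ _
  · intro s hs h1 h2
    rw [hlo] at h1
    rw [hhi] at h2
    exact (dens_mid h12 h34 p5 hs).1 ((le_max_left _ _).trans h1) (h2.trans (min_le_left _ _))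
  · rintro s hs (h1 | h1)
    · rw [hlo] at h1
      rcases le_max_iff.mp h1 with h2 | h2
      · exact (dens_mid h12 h34 p5 hs).2 (Or.inl h2)
      · exact absurd hs.1 h2.not_gt
    · rw [hhi] at h1
      rcases min_le_iff.mp h1 with h2 | h2
      · exact (dens_mid h12 h34 p5 hs).2 (Or.inr h2)
      · exact absurd hs.2 h2.not_gt

theorem hasAction_right {D : SeparatedData} {i : Fin 3} {h e₁ e₂ e₃ e₄ : ℝ} {p : ℝ × ℝ}
    (hh : 0 ≤ h) (h12 : e₁ ≤ e₂) (h23 : e₂ ≤ e₃) (h34 : e₃ ≤ e₄)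
    (hp : p ∈ rootRegion e₁ e₂ e₃ e₄) (hlo : D.lo i = max p.2 e₃) (hhi : D.hi i = e₄)
    (hpsq : ∀ s ∈ Ioo e₃ e₄, D.sqMomentum i s = 2 * h / 4 *
      (-((s - p.1) * (s - p.2)) / ((s - e₁) * (s - e₂) * (s - e₃) * (s - e₄))))
    (hint : ∀ x y, IntervalIntegrable (dens p.1 p.2 e₁ e₂ e₃ e₄) volume x y) :
    D.HasAction i (partialAction h e₁ e₂ e₃ e₄ e₃ e₄ p) := by
  refine SeparatedData.hasAction_of_dens hh ?_ ?_ hhi.le hpsq ?_ ?_ hint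
  · rw [hlo]; exact le_max_right _ _
  · rw [hlo, hhi]; exact max_le hp.2.2.2.1 h34
  · intro s hs h1 _
    rw [hlo] at h1
    exact (dens_right h12 h23 hp.2.1 hs).1 ((le_max_left _ _).trans h1)
  · rintro s hs (h1 | h1)
    · rw [hlo] at h1
      rcases le_max_iff.mp h1 with h2 | h2
      · exact (dens_right h12 h23 hp.2.1 hs).2 h2
      · exact absurd hs.1 h2.not_gt
    · rw [hhi] at h1; exact absurd hs.2 h1.not_gt

/-- The action of a degree of freedom with rotational symmetry. -/
theorem hasAction_angular {D : SeparatedData} {i : Fin 3} {l : ℝ} (hlo : D.lo i = 0)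
    (hhi : D.hi i = 1) (hpsq : ∀ s, D.sqMomentum i s = l ^ 2 / (4 * s * (1 - s))) :
    D.HasAction i |l| := by
  have hs : ∀ s : ℝ, |l| / 2 * (1 / √((s - 0) * (1 - s))) = √(D.sqMomentum i s) := by
    intro s
    rw [hpsq, Real.sqrt_div (sq_nonneg _), Real.sqrt_sq_eq_abs, mul_assoc,
      Real.sqrt_mul (x := 4) (by norm_num), show (4 : ℝ) = 2 ^ 2 by norm_num,
      Real.sqrt_sq (by norm_num), sub_zero]
    ring
  have hi := (intervalIntegrable_arcsine (zero_lt_one (α := ℝ))).const_mul (|l| / 2)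
  unfold SeparatedData.HasAction SeparatedData.Admissible
  simp only [← hs, hlo, hhi]
  refine ⟨⟨zero_le_one, fun s hs => ?_, hi⟩, ?_⟩
  · rw [hpsq]
    have h1 := hs.1
    have h2 : 0 < 1 - s := by linarith [hs.2]
    positivity
  · rw [intervalIntegral.integral_const_mul, integral_arcsine zero_lt_one]
    have := Real.pi_pos
    field_simp

theorem actions_eq {D : SeparatedData} {a b c : ℝ} (h0 : D.HasAction 0 a) (h1 : D.HasAction 1 b)
    (h2 : D.HasAction 2 c) : D.actions = WithLp.toLp 2 ![a, b, c] := by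
  unfold SeparatedData.actions
  congr 1
  funext i
  fin_cases i
  · exact h0.2
  · exact h1.2
  · exact h2.2

/-! ### The ellipsoidal system -/

theorem ellipsoidal_actionImageIsTriangle {h e₁ e₂ e₃ e₄ : ℝ} (hh : 0 < h) (h12 : e₁ < e₂)
    (h23 : e₂ < e₃) (h34 : e₃ < e₄) : ActionImageIsTriangle h (ellipsoidal h e₁ e₂ e₃ e₄) := by
  have hw := intervalIntegrable_invSqrtDist_four h12.ne (h12.trans h23).ne
    (h12.trans (h23.trans h34)).ne h23.ne (h23.trans h34).ne h34.ne
  have hcont : ∀ x y, ContinuousOn (partialAction h e₁ e₂ e₃ e₄ x y) (rootRegion e₁ e₂ e₃ e₄) :=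
    fun x y => (continuousOn_integral_dens (hw x y) (fun s => by unfold invSqrtDist; positivity)
      fun p _ s => dens_le_of_simple _ _ _ _ _ _ s).2.const_mul _
  have hint : ∀ p : ℝ × ℝ, ∀ x y, IntervalIntegrable (dens p.1 p.2 e₁ e₂ e₃ e₄) volume x y :=
    fun p x y => intervalIntegrable_dens h12 h23 h34 _ _ x y
  have hA : ∀ L ∈ reducedPhaseSpace h, _ ∧ _ ∧ _ := fun L hL =>
    have hpsq : ∀ s, -(2 * h * s ^ 2 - eta₁ e₁ e₂ e₃ e₄ L * s + eta₂ e₁ e₂ e₃ e₄ L) /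
        (4 * ((s - e₁) * (s - e₂) * (s - e₃) * (s - e₄))) = 2 * h / 4 *
        (-((s - (sepRoots h e₁ e₂ e₃ e₄ L).1) * (s - (sepRoots h e₁ e₂ e₃ e₄ L).2)) /
          ((s - e₁) * (s - e₂) * (s - e₃) * (s - e₄))) := fun s => by
      rw [(sepRoots_spec hh h12.le h23.le h34.le hL).1, div_mul_div_comm]
      ring
    have hp := (sepRoots_spec hh h12.le h23.le h34.le hL).2
    ⟨hasAction_left (D := ellipsoidal h e₁ e₂ e₃ e₄ L) (i := 0) hh.le h12.le h23.le h34.le hp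
      rfl rfl (fun s _ => hpsq s) (hint _),
    hasAction_mid (D := ellipsoidal h e₁ e₂ e₃ e₄ L) (i := 1) hh.le h12.le h23.le h34.le hp
      rfl rfl (fun s _ => hpsq s) (hint _),
    hasAction_right (D := ellipsoidal h e₁ e₂ e₃ e₄ L) (i := 2) hh.le h12.le h23.le h34.le hp
      rfl rfl (fun s _ => hpsq s) (hint _)⟩
  refine actionImageIsTriangle_of_sepRoots hh h12.le h23.le h34.le (h12.trans h23) (h23.trans h34)
    (F := partialAction h e₁ e₂ e₃ e₄ e₁ e₂) (H := partialAction h e₁ e₂ e₃ e₄ e₂ e₃)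
    (G := partialAction h e₁ e₂ e₃ e₄ e₃ e₄) ?_ ?_ (hcont _ _) (hcont _ _) (hcont _ _) ?_ ?_ ?_ ?_
    ?_ ?_ ?_
  · intro L hL i
    obtain ⟨a0, a1, a2⟩ := hA L hL
    fin_cases i
    exacts [a0.1, a1.1, a2.1]
  · intro L hL
    obtain ⟨a0, a1, a2⟩ := hA L hL
    exact actions_eq a0 a1 a2
  · exact fun p _ => ⟨partialAction_nonneg h12.le p, partialAction_nonneg h23.le p,
      partialAction_nonneg h34.le p⟩
  · intro p hp
    obtain ⟨p1, p2, p3, p4, p5⟩ := hp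
    unfold partialAction
    rw [← mul_add, ← mul_add, intervalIntegral.integral_add_adjacent_intervals (hint p _ _)
      (hint p _ _), intervalIntegral.integral_add_adjacent_intervals (hint p _ _) (hint p _ _),
      integral_dens h12 h23 h34 p1 p2 p3 p4 p5, div_mul_cancel₀ _ Real.pi_ne_zero]
  · exact partialAction_left_mono h12.le h23.le h34.le fun p _ => hint p
  · exact partialAction_right_anti h12.le h23.le h34.le fun p _ => hint p
  · exact partialAction_eq_zero h12.le fun s hs =>
      (dens_left h23.le h34.le (h23.le.trans h34.le) hs).2 hs.1.le
  · exact partialAction_eq_zero h34.le fun s hs =>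
      (dens_right h12.le h23.le (h12.le.trans h23.le) hs).2 hs.2.le
  · exact fun p hp hb => partialAction_mid_eq_zero h12.le h23.le h34.le hp hb

/-! ### The prolate system -/

theorem dens_inner_pair (r₁ r₂ a b c : ℝ) : dens r₁ r₂ a c c b = dens r₁ r₂ a b c c := by
  funext s
  unfold dens
  congr 2
  ring

/-- The double pole 1 lies between the roots: outside [r₁, r₂] the nearer root is closer to s than 1
is, and inside the density vanishes. -/
theorem dens_prolate_le {b : ℝ} {p : ℝ × ℝ} (hp : p ∈ rootRegion 0 1 1 b) (s : ℝ) :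
    dens p.1 p.2 0 1 1 b s ≤ (1 + |s - p.1|) * (1 + |s - p.2|) *
      (invSqrtDist 0 s * (invSqrtDist b s * invSqrtDist 1 s)) := by
  obtain ⟨p1, p2, p3, p4, p5⟩ := hp
  rw [dens_inner_pair]
  apply dens_le_of_double
  rcases le_total s p.1 with h1 | h1
  · left
    rw [abs_of_nonpos (by linarith), abs_of_nonpos (by linarith)]
    linarith
  · rcases le_total p.2 s with h2 | h2
    · right; left
      rw [abs_of_nonneg (by linarith), abs_of_nonneg (by linarith)]
      linarith
    · right; right
      rw [show (s - p.1) * (s - p.2) / ((s - 0) * (s - b) * (s - 1) * (s - 1))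
        = (s - p.1) * (p.2 - s) / (s * (b - s) * (s - 1) ^ 2) by
          rw [← neg_div_neg_eq]; congr 1 <;> ring]
      have a1 : 0 ≤ s - p.1 := by linarith
      have a2 : 0 ≤ p.2 - s := by linarith
      have a3 : 0 ≤ s := by linarith
      have a4 : 0 ≤ b - s := by linarith
      positivity

theorem continuousOn_integral_dens_prolate {b : ℝ} (hb : 1 < b) (x y : ℝ) :
    (∀ p ∈ rootRegion 0 1 1 b, IntervalIntegrable (dens p.1 p.2 0 1 1 b) volume x y) ∧
    ContinuousOn (fun p : ℝ × ℝ => ∫ s in x..y, dens p.1 p.2 0 1 1 b s) (rootRegion 0 1 1 b) :=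
  continuousOn_integral_dens
    (intervalIntegrable_invSqrtDist_three (by linarith) zero_ne_one hb.ne' x y)
    (fun s => by unfold invSqrtDist; positivity) fun _ hp s => dens_prolate_le hp s

/-- For r₁ < 1 < r₂ split the double pole into 1 ± δ, where the total is π, and let δ tend to 0.
Such pairs are dense in the region and both sides are continuous. -/
theorem integral_dens_prolate {b : ℝ} (hb : 1 < b) {p : ℝ × ℝ} (hp : p ∈ rootRegion 0 1 1 b) :
    (∫ s in (0 : ℝ)..b, dens p.1 p.2 0 1 1 b s)
      + √((1 - p.1) * (p.2 - 1) / (b - 1)) * Real.pi = Real.pi := by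
  have hgen : EqOn (fun p : ℝ × ℝ => (∫ s in (0 : ℝ)..b, dens p.1 p.2 0 1 1 b s)
      + √((1 - p.1) * (p.2 - 1) / (b - 1)) * Real.pi) (fun _ => Real.pi)
      (rootRegion 0 1 1 b ∩ {p | p.1 < 1 ∧ 1 < p.2}) := by
    rintro ⟨x, y⟩ ⟨⟨p1, p2, p3, p4, p5⟩, h1, h2⟩
    simp only at p1 p2 p3 p4 p5 h1 h2 ⊢
    have hψ : (1 - x) * (1 - y) / ((1 - 0) * (1 - b)) = (1 - x) * (y - 1) / (b - 1) := by
      rw [← neg_div_neg_eq]; congr 1 <;> ring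
    have := integral_dens_double_pole (r₁ := x) (r₂ := y) (u := 0) (v := b) (p := 1) (a := 0)
      (b := b) (by linarith) zero_lt_one hb (by
        rw [hψ]
        exact div_pos (mul_pos (by linarith) (by linarith)) (by linarith)) (by
        filter_upwards [Ioo_mem_nhdsGT (lt_min (zero_lt_one (α := ℝ)) (sub_pos.mpr hb))] with δ hδ
        have d1 := hδ.2.trans_le (min_le_left _ _)
        have d2 := hδ.2.trans_le (min_le_right _ _)
        have d0 := hδ.1
        rw [← integral_dens (r₁ := x) (r₂ := y) (e₁ := 0) (e₂ := 1 - δ) (e₃ := 1 + δ) (e₄ := b)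
          (by linarith) (by linarith) (by linarith) p1 (by linarith) (by linarith) p4 p5]
        refine intervalIntegral.integral_congr fun s _ => ?_
        unfold dens
        congr 2
        ring)
    rwa [hψ, ← dens_inner_pair] at this
  have hcl : rootRegion 0 1 1 b ⊆ closure (rootRegion 0 1 1 b ∩ {p | p.1 < 1 ∧ 1 < p.2}) := by
    rintro ⟨x, y⟩ ⟨p1, p2, p3, p4, p5⟩
    simp only at p1 p2 p3 p4 p5
    -- Approach along the segment to the corner (0, b), where both inequalities are strict.
    have ht : Tendsto (fun t : ℝ => ((1 - t) * x, (1 - t) * y + t * b)) (𝓝[>] 0) (𝓝 (x, y)) := by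
      have : Continuous (fun t : ℝ => ((1 - t) * x, (1 - t) * y + t * b)) := by fun_prop
      have := (this.tendsto 0).mono_left (nhdsWithin_le_nhds (s := Ioi 0))
      simpa using this
    refine mem_closure_of_tendsto ht ?_
    filter_upwards [Ioo_mem_nhdsGT (zero_lt_one (α := ℝ))] with t ht
    obtain ⟨t0, t1⟩ := ht
    have k1 : (1 - t) * x < 1 := by nlinarith
    have k2 : 1 < (1 - t) * y + t * b := by nlinarith
    exact ⟨⟨by simp only; nlinarith, k1.le, k2.le, by simp only; nlinarith, (k1.trans k2).le⟩, k1, k2⟩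
  refine Set.EqOn.of_subset_closure hgen ?_ continuousOn_const inter_subset_left hcl hp
  exact (continuousOn_integral_dens_prolate hb 0 b).2.add
    (Continuous.continuousOn (by fun_prop))

theorem eta_prolate {h : ℝ} {L : AngMom} (hL : L ∈ reducedPhaseSpace h) (b : ℝ) :
    gPro b L + 2 * h + (b - 1) * ell23 L ^ 2 = eta₁ 0 1 1 b L ∧ gPro b L = eta₂ 0 1 1 b L := by
  rw [← hL.1]
  unfold gPro eta₁ eta₂ casimir₁
  constructor <;> ring

theorem prolate_actionImageIsTriangle {h b : ℝ} (hh : 0 < h) (hb : 1 < b) :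
    ActionImageIsTriangle h (prolate h b) := by
  have hint : ∀ p ∈ rootRegion 0 1 1 b, ∀ x y,
      IntervalIntegrable (dens p.1 p.2 0 1 1 b) volume x y :=
    fun p hp x y => (continuousOn_integral_dens_prolate hb x y).1 p hp
  have hcont : ∀ x y, ContinuousOn (partialAction h 0 1 1 b x y) (rootRegion 0 1 1 b) :=
    fun x y => (continuousOn_integral_dens_prolate hb x y).2.const_mul _
  let H : ℝ × ℝ → ℝ := fun p => √(2 * h) * √((1 - p.1) * (p.2 - 1) / (b - 1))
  have hA : ∀ L ∈ reducedPhaseSpace h,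
      (prolate h b L).HasAction 0 (partialAction h 0 1 1 b 0 1 (sepRoots h 0 1 1 b L)) ∧
      (prolate h b L).HasAction 1 (H (sepRoots h 0 1 1 b L)) ∧
      (prolate h b L).HasAction 2 (partialAction h 0 1 1 b 1 b (sepRoots h 0 1 1 b L)) := by
    intro L hL
    obtain ⟨hη₁, hη₂⟩ := eta_prolate hL b
    obtain ⟨hf, hp⟩ := sepRoots_spec hh zero_le_one le_rfl hb.le hL
    have hpsq : ∀ s, (-(2 * h) * s ^ 2 + (gPro b L + 2 * h + (b - 1) * ell23 L ^ 2) * s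
        - gPro b L) / (4 * s * (s - b) * (s - 1) ^ 2) = 2 * h / 4 *
        (-((s - (sepRoots h 0 1 1 b L).1) * (s - (sepRoots h 0 1 1 b L).2)) /
          ((s - 0) * (s - 1) * (s - 1) * (s - b))) := fun s => by
      rw [hη₁, hη₂, show -(2 * h) * s ^ 2 + eta₁ 0 1 1 b L * s - eta₂ 0 1 1 b L
        = -(2 * h * s ^ 2 - eta₁ 0 1 1 b L * s + eta₂ 0 1 1 b L) by ring, hf, div_mul_div_comm]
      congr 1 <;> ring
    have hlo : (prolate h b L).lo 2 = max (sepRoots h 0 1 1 b L).2 1 := by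
      unfold sepRoots
      rw [← hη₁, ← hη₂, max_comm]
      rfl
    have hhi : (prolate h b L).hi 0 = min (sepRoots h 0 1 1 b L).1 1 := by
      unfold sepRoots
      rw [← hη₁, ← hη₂]
      rfl
    refine ⟨hasAction_left hh.le zero_le_one le_rfl hb.le hp rfl hhi (fun s _ => hpsq s) (hint _ hp), ?_,
      hasAction_right hh.le zero_le_one le_rfl hb.le hp hlo rfl (fun s _ => hpsq s) (hint _ hp)⟩
    convert hasAction_angular (D := prolate h b L) (i := 1) (l := ell23 L) rfl rfl fun s => rfl
      using 1
    -- At s = 1 only the term of ℓ₂₃ survives: 2h(1 - r₁)(r₂ - 1) = (b - 1) ℓ₂₃². So the half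
    -- residue is the angular action.
    have h1 := hf 1
    rw [← hη₁, ← hη₂] at h1
    simp only [H]
    rw [← Real.sqrt_sq_eq_abs, ← Real.sqrt_mul (by linarith)]
    congr 1
    have hb' : b - 1 ≠ 0 := by linarith
    field_simp
    linear_combination h1
  refine actionImageIsTriangle_of_sepRoots hh zero_le_one le_rfl hb.le zero_lt_one hb
    (F := partialAction h 0 1 1 b 0 1) (H := H) (G := partialAction h 0 1 1 b 1 b)
    ?_ ?_ (hcont _ _) (Continuous.continuousOn (by fun_prop)) (hcont _ _) ?_ ?_ ?_ ?_ ?_ ?_ ?_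
  · intro L hL i
    obtain ⟨a0, a1, a2⟩ := hA L hL
    fin_cases i
    exacts [a0.1, a1.1, a2.1]
  · intro L hL
    obtain ⟨a0, a1, a2⟩ := hA L hL
    exact actions_eq a0 a1 a2
  · exact fun p _ => ⟨partialAction_nonneg zero_le_one p, by positivity,
      partialAction_nonneg hb.le p⟩
  · intro p hp
    have h1 := integral_dens_prolate hb hp
    rw [← intervalIntegral.integral_add_adjacent_intervals (hint p hp 0 1) (hint p hp 1 b)] at h1
    simp only [partialAction, H]
    have := Real.pi_pos
    field_simp
    linear_combination h1
  · exact partialAction_left_mono zero_le_one le_rfl hb.le hint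
  · exact partialAction_right_anti zero_le_one le_rfl hb.le hint
  · exact partialAction_eq_zero zero_le_one fun s hs =>
      (dens_left le_rfl hb.le hb.le hs).2 hs.1.le
  · exact partialAction_eq_zero hb.le fun s hs =>
      (dens_right zero_le_one le_rfl zero_le_one hs).2 hs.2.le
  · rintro p ⟨p1, p2, p3, p4, p5⟩ hbd
    have : (1 - p.1) * (p.2 - 1) = 0 := by
      rcases hbd with e | e | e
      · rw [e]; ring
      · rw [e]; ring
      · have : p.1 = 1 := by linarith
        rw [this]; ring
    simp only [H]
    rw [this, zero_div, Real.sqrt_zero, mul_zero]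

/-! ### The oblate system -/

/-- The double pole a lies to the right of both roots: for s ≤ r₂ the root r₂ is closer to s than a
is, and for s ≥ r₂ the density vanishes. -/
theorem dens_oblate_le {a : ℝ} {p : ℝ × ℝ} (hp : p ∈ rootRegion 0 1 a a) (s : ℝ) :
    dens p.1 p.2 0 1 a a s ≤ (1 + |s - p.1|) * (1 + |s - p.2|) *
      (invSqrtDist 0 s * (invSqrtDist 1 s * invSqrtDist a s)) := by
  obtain ⟨p1, p2, p3, p4, p5⟩ := hp
  apply dens_le_of_double
  rcases le_total s p.2 with h1 | h1
  · right; left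
    rw [abs_of_nonpos (by linarith), abs_of_nonpos (by linarith)]
    linarith
  · right; right
    rw [mul_assoc _ (s - a) (s - a), ← sq]
    have a1 : 0 ≤ s - p.1 := by linarith
    have a2 : 0 ≤ s - p.2 := by linarith
    have a3 : 0 ≤ s - 0 := by linarith
    have a4 : 0 ≤ s - 1 := by linarith
    positivity

theorem continuousOn_integral_dens_oblate {a : ℝ} (ha : 1 < a) (x y : ℝ) :
    (∀ p ∈ rootRegion 0 1 a a, IntervalIntegrable (dens p.1 p.2 0 1 a a) volume x y) ∧
    ContinuousOn (fun p : ℝ × ℝ => ∫ s in x..y, dens p.1 p.2 0 1 a a s) (rootRegion 0 1 a a) :=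
  continuousOn_integral_dens
    (intervalIntegrable_invSqrtDist_three zero_ne_one (by linarith) ha.ne x y)
    (fun s => by unfold invSqrtDist; positivity) fun _ hp s => dens_oblate_le hp s

theorem integral_dens_oblate {a : ℝ} (ha : 1 < a) {p : ℝ × ℝ} (hp : p ∈ rootRegion 0 1 a a) :
    (∫ s in (0 : ℝ)..a, dens p.1 p.2 0 1 a a s)
      + √((a - p.1) * (a - p.2) / (a * (a - 1))) * Real.pi = Real.pi := by
  have hgen : EqOn (fun p : ℝ × ℝ => (∫ s in (0 : ℝ)..a, dens p.1 p.2 0 1 a a s)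
      + √((a - p.1) * (a - p.2) / (a * (a - 1))) * Real.pi) (fun _ => Real.pi)
      (rootRegion 0 1 a a ∩ {p | p.2 < a}) := by
    rintro ⟨x, y⟩ ⟨hpD, h2⟩
    have hii := fun u v => (continuousOn_integral_dens_oblate ha u v).1 _ hpD
    obtain ⟨p1, p2, p3, p4, p5⟩ := hpD
    simp only at p1 p2 p3 p4 p5 hii ⊢
    change y < a at h2
    -- The double pole is the right end of the support, so the interval is prolonged to a + 1 to
    -- have it inside; the density vanishes on the added piece.
    have := integral_dens_double_pole (r₁ := x) (r₂ := y) (u := 0) (v := 1) (p := a) (a := 0)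
      (b := a + 1) zero_ne_one (by linarith) (by linarith)
      (div_pos (mul_pos (by linarith) (by linarith)) (mul_pos (by linarith) (by linarith))) (by
        filter_upwards [Ioo_mem_nhdsGT (lt_min (lt_min (zero_lt_one (α := ℝ)) (sub_pos.mpr ha))
          (sub_pos.mpr h2))] with δ hδ
        have d0 := hδ.1
        have d1 := (hδ.2.trans_le (min_le_left _ _)).trans_le (min_le_left _ _)
        have d2 := (hδ.2.trans_le (min_le_left _ _)).trans_le (min_le_right _ _)
        have d3 := hδ.2.trans_le (min_le_right _ _)
        have o1 : (0 : ℝ) < 1 := zero_lt_one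
        have o2 : 1 < a - δ := by linarith
        have o3 : a - δ < a + δ := by linarith
        have hi := intervalIntegrable_dens o1 o2 o3 x y
        rw [← intervalIntegral.integral_add_adjacent_intervals (hi 0 (a + δ)) (hi (a + δ) (a + 1)),
          integral_dens o1 o2 o3 p1 (by linarith) p3 (by linarith) p5,
          integral_eq_zero_of_forall_Ioo (by linarith) fun s hs =>
            dens_eq_zero_of_gt o1.le o2.le o3.le (by linarith) p5 hs.1.le, add_zero])
    rwa [sub_zero, ← intervalIntegral.integral_add_adjacent_intervals (hii 0 a) (hii a (a + 1)),
      integral_eq_zero_of_forall_Ioo (by linarith : a ≤ a + 1) fun s hs =>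
        dens_eq_zero_of_gt zero_le_one ha.le le_rfl p4 p5 hs.1.le, add_zero] at this
  have hcl : rootRegion 0 1 a a ⊆ closure (rootRegion 0 1 a a ∩ {p | p.2 < a}) := by
    rintro ⟨x, y⟩ ⟨p1, p2, p3, p4, p5⟩
    simp only at p1 p2 p3 p4 p5
    have ht : Tendsto (fun t : ℝ => ((1 - t) * x, (1 - t) * y + t)) (𝓝[>] 0) (𝓝 (x, y)) := by
      have : Continuous (fun t : ℝ => ((1 - t) * x, (1 - t) * y + t)) := by fun_prop
      have := (this.tendsto 0).mono_left (nhdsWithin_le_nhds (s := Ioi 0))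
      simpa using this
    refine mem_closure_of_tendsto ht ?_
    filter_upwards [Ioo_mem_nhdsGT (zero_lt_one (α := ℝ))] with t ht
    obtain ⟨t0, t1⟩ := ht
    have k2 : (1 - t) * y + t < a := by nlinarith
    have k3 : (1 - t) * x ≤ (1 - t) * y + t := by nlinarith
    exact ⟨⟨by simp only; nlinarith, k3.trans k2.le, by simp only; nlinarith, k2.le, k3⟩, k2⟩
  refine Set.EqOn.of_subset_closure hgen ?_ continuousOn_const inter_subset_left hcl hp
  exact (continuousOn_integral_dens_oblate ha 0 a).2.add
    (Continuous.continuousOn (by fun_prop))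

theorem eta_oblate {h : ℝ} {L : AngMom} (hL : L ∈ reducedPhaseSpace h) (a : ℝ) :
    2 * a * h + gObl a L - (a - 1) * ell34 L ^ 2 = eta₁ 0 1 a a L ∧
      a * gObl a L = eta₂ 0 1 a a L := by
  rw [show 2 * a * h = a * (2 * h) by ring, ← hL.1]
  unfold gObl eta₁ eta₂ casimir₁
  constructor <;> ring

theorem oblate_actionImageIsTriangle {h a : ℝ} (hh : 0 < h) (ha : 1 < a) :
    ActionImageIsTriangle h (oblate h a) := by
  have ha0 : 0 < a := by linarith
  have ha1 : 0 < a - 1 := by linarith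
  have hint : ∀ p ∈ rootRegion 0 1 a a, ∀ x y,
      IntervalIntegrable (dens p.1 p.2 0 1 a a) volume x y :=
    fun p hp x y => (continuousOn_integral_dens_oblate ha x y).1 p hp
  have hcont : ∀ x y, ContinuousOn (partialAction h 0 1 a a x y) (rootRegion 0 1 a a) :=
    fun x y => (continuousOn_integral_dens_oblate ha x y).2.const_mul _
  let G : ℝ × ℝ → ℝ := fun p => √(2 * h) * √((a - p.1) * (a - p.2) / (a * (a - 1)))
  have hA : ∀ L ∈ reducedPhaseSpace h,
      (oblate h a L).HasAction 0 (partialAction h 0 1 a a 0 1 (sepRoots h 0 1 a a L)) ∧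
      (oblate h a L).HasAction 1 (partialAction h 0 1 a a 1 a (sepRoots h 0 1 a a L)) ∧
      (oblate h a L).HasAction 2 (G (sepRoots h 0 1 a a L)) := by
    intro L hL
    obtain ⟨hη₁, hη₂⟩ := eta_oblate hL a
    obtain ⟨hf, hp⟩ := sepRoots_spec hh zero_le_one ha.le le_rfl hL
    have hpsq : ∀ s, (-(2 * h) * s ^ 2 + (2 * a * h + gObl a L - (a - 1) * ell34 L ^ 2) * s
        - a * gObl a L) / (4 * s * (s - 1) * (s - a) ^ 2) = 2 * h / 4 *
        (-((s - (sepRoots h 0 1 a a L).1) * (s - (sepRoots h 0 1 a a L).2)) /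
          ((s - 0) * (s - 1) * (s - a) * (s - a))) := fun s => by
      rw [hη₁, hη₂, show -(2 * h) * s ^ 2 + eta₁ 0 1 a a L * s - eta₂ 0 1 a a L
        = -(2 * h * s ^ 2 - eta₁ 0 1 a a L * s + eta₂ 0 1 a a L) by ring, hf, div_mul_div_comm]
      congr 1 <;> ring
    have hhi0 : (oblate h a L).hi 0 = min (sepRoots h 0 1 a a L).1 1 := by
      unfold sepRoots
      rw [← hη₁, ← hη₂]
      rfl
    have hlo1 : (oblate h a L).lo 1 = max (sepRoots h 0 1 a a L).1 1 := by
      unfold sepRoots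
      rw [← hη₁, ← hη₂]
      rfl
    have hhi1 : (oblate h a L).hi 1 = min (sepRoots h 0 1 a a L).2 a := by
      unfold sepRoots
      rw [← hη₁, ← hη₂]
      rfl
    refine ⟨hasAction_left hh.le zero_le_one ha.le le_rfl hp rfl hhi0 (fun s _ => hpsq s) (hint _ hp),
      hasAction_mid hh.le zero_le_one ha.le le_rfl hp hlo1 hhi1 (fun s _ => hpsq s) (hint _ hp), ?_⟩
    convert hasAction_angular (D := oblate h a L) (i := 2) (l := ell34 L) rfl rfl fun s => rfl
      using 1
    -- At s = a only the term of ℓ₃₄ survives: 2h(a - r₁)(a - r₂) = a(a - 1) ℓ₃₄².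
    have h1 := hf a
    rw [← hη₁, ← hη₂] at h1
    simp only [G]
    rw [← Real.sqrt_sq_eq_abs, ← Real.sqrt_mul (by linarith)]
    congr 1
    field_simp
    linear_combination -h1
  refine actionImageIsTriangle_of_sepRoots hh zero_le_one ha.le le_rfl (zero_lt_one.trans ha) ha
    (F := partialAction h 0 1 a a 0 1) (H := partialAction h 0 1 a a 1 a) (G := G)
    ?_ ?_ (hcont _ _) (hcont _ _) (Continuous.continuousOn (by fun_prop)) ?_ ?_ ?_ ?_ ?_ ?_ ?_
  · intro L hL i
    obtain ⟨a0, a1, a2⟩ := hA L hL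
    fin_cases i
    exacts [a0.1, a1.1, a2.1]
  · intro L hL
    obtain ⟨a0, a1, a2⟩ := hA L hL
    exact actions_eq a0 a1 a2
  · exact fun p _ => ⟨partialAction_nonneg zero_le_one p, partialAction_nonneg ha.le p,
      by positivity⟩
  · intro p hp
    have h1 := integral_dens_oblate ha hp
    rw [← intervalIntegral.integral_add_adjacent_intervals (hint p hp 0 1) (hint p hp 1 a)] at h1
    simp only [partialAction, G]
    generalize √((a - p.1) * (a - p.2) / (a * (a - 1))) = q at *
    have := Real.pi_pos
    field_simp
    linear_combination h1
  · exact partialAction_left_mono zero_le_one ha.le le_rfl hint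
  · intro x x' y hp hq hx
    have h1 : y ≤ a := hp.2.2.2.1
    refine mul_le_mul_of_nonneg_left (Real.sqrt_le_sqrt ?_) (Real.sqrt_nonneg _)
    refine div_le_div_of_nonneg_right ?_ (by positivity)
    simp only
    nlinarith
  · exact partialAction_eq_zero zero_le_one fun s hs =>
      (dens_left ha.le le_rfl ha.le hs).2 hs.1.le
  · simp [G]
  · exact fun p hp hb => partialAction_mid_eq_zero zero_le_one ha.le le_rfl hp hb

/-! ### Systems with explicit actions -/

theorem actionImageIsTriangle_of_hasAction {h : ℝ} {S : AngMom → SeparatedData}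
    {A : Fin 3 → AngMom → ℝ} (hact : ∀ L ∈ reducedPhaseSpace h, ∀ i, (S L).HasAction i (A i L))
    (hcont : ∀ i, ContinuousOn (A i) (reducedPhaseSpace h))
    (hnonneg : ∀ L ∈ reducedPhaseSpace h, ∀ i, 0 ≤ A i L)
    (hsum : ∀ L ∈ reducedPhaseSpace h, A 0 L + A 1 L + A 2 L = √(2 * h))
    (hsurj : ∀ x y z : ℝ, 0 ≤ x → 0 ≤ y → 0 ≤ z → x + y + z = √(2 * h) →
      ∃ L ∈ reducedPhaseSpace h, A 0 L = x ∧ A 1 L = y ∧ A 2 L = z) :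
    ActionImageIsTriangle h S := by
  have hA : ∀ L ∈ reducedPhaseSpace h, (S L).actions = WithLp.toLp 2 fun i => A i L := by
    intro L hL
    unfold SeparatedData.actions
    congr 1
    funext i
    exact (hact L hL i).2
  refine ⟨fun L hL i => (hact L hL i).1, ?_, ?_⟩
  · exact ((PiLp.continuous_toLp 2 _).comp_continuousOn (continuousOn_pi.mpr hcont)).congr hA
  · ext J
    constructor
    · rintro ⟨L, hL, rfl⟩
      simp only
      rw [hA L hL]
      exact ⟨hsum L hL, hnonneg L hL⟩
    · rintro ⟨hJ, hJ0⟩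
      obtain ⟨L, hL, h0, h1, h2⟩ := hsurj _ _ _ (hJ0 0) (hJ0 1) (hJ0 2) hJ
      refine ⟨L, hL, ?_⟩
      simp only
      rw [hA L hL]
      ext i
      fin_cases i
      exacts [h0, h1, h2]

theorem hasAction_semicircle {D : SeparatedData} {i : Fin 3} {c r₁ r₂ : ℝ} (hc : 0 ≤ c)
    (h0 : 0 ≤ r₁) (hr : r₁ ≤ r₂) (h1 : r₂ ≤ 1) (hlo : D.lo i = r₁) (hhi : D.hi i = r₂)
    (hpsq : ∀ s ∈ Ioo r₁ r₂,
      D.sqMomentum i s = c * ((s - r₁) * (r₂ - s)) / (2 * (s * (1 - s))) ^ 2) :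
    D.HasAction i (√c * (1 - √(r₁ * r₂) - √((1 - r₁) * (1 - r₂)))) := by
  obtain ⟨hi, hv⟩ := integral_sqrt_div_mul h0 hr h1
  have hs : ∀ s ∈ Ioo r₁ r₂,
      √c / 2 * (√((s - r₁) * (r₂ - s)) / (s * (1 - s))) = √(D.sqMomentum i s) := by
    intro s hs
    have a1 : 0 < s := h0.trans_lt hs.1
    have a2 : 0 < 1 - s := by linarith [hs.2]
    rw [hpsq s hs, Real.sqrt_div (mul_nonneg hc (mul_nonneg (by linarith [hs.1])
      (by linarith [hs.2]))), Real.sqrt_mul hc, Real.sqrt_sq (by positivity)]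
    field_simp
  have hae : ∀ᵐ s, s ∈ uIoc r₁ r₂ →
      √c / 2 * (√((s - r₁) * (r₂ - s)) / (s * (1 - s))) = √(D.sqMomentum i s) := by
    filter_upwards [Measure.ae_ne volume r₂] with s hne hs'
    rw [uIoc_of_le hr] at hs'
    exact hs s ⟨hs'.1, lt_of_le_of_ne hs'.2 hne⟩
  unfold SeparatedData.HasAction SeparatedData.Admissible
  rw [hlo, hhi]
  refine ⟨⟨hr, fun s hs => ?_, ?_⟩, ?_⟩
  · rw [hpsq s hs]
    exact div_nonneg (mul_nonneg hc (mul_nonneg (by linarith [hs.1]) (by linarith [hs.2])))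
      (sq_nonneg _)
  · exact (hi.const_mul _).congr_ae ((ae_restrict_iff' measurableSet_uIoc).mpr hae)
  · rw [← intervalIntegral.integral_congr_ae hae, intervalIntegral.integral_const_mul, hv]
    have := Real.pi_pos
    field_simp

/-- The semicircle case with lower root 0, after expanding the fraction by s. -/
theorem hasAction_radial {D : SeparatedData} {i : Fin 3} {c w : ℝ} (hc : 0 ≤ c)
    (h0 : 0 ≤ w) (h1 : w ≤ 1) (hlo : D.lo i = 0) (hhi : D.hi i = w)
    (hpsq : ∀ s, D.sqMomentum i s = c * (w - s) / (4 * s * (s - 1) ^ 2)) :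
    D.HasAction i (√c - √(c * (1 - w))) := by
  convert hasAction_semicircle hc le_rfl h0 h1 hlo hhi ?_ using 1
  · rw [Real.sqrt_mul hc, zero_mul, Real.sqrt_zero]
    simp only [sub_zero, one_mul]
    ring
  · intro s hs
    rw [hpsq s]
    have a1 : s ≠ 0 := hs.1.ne'
    have a2 : 1 - s ≠ 0 := by linarith [hs.2]
    have a3 : s - 1 ≠ 0 := by linarith [hs.2]
    rw [div_eq_div_iff (by positivity) (by positivity)]
    ring

theorem fLame_nonneg (L : AngMom) : 0 ≤ fLame L := by
  unfold fLame; positivity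

theorem two_mul_sub_fLame {h : ℝ} {L : AngMom} (hL : L ∈ reducedPhaseSpace h) :
    2 * h - fLame L = ell23 L ^ 2 + ell24 L ^ 2 + ell34 L ^ 2 := by
  rw [← hL.1]
  unfold fLame casimir₁
  ring

theorem continuous_fLame : Continuous fLame := by
  obtain ⟨c1, c2, c3, -, -, -⟩ := continuous_ell
  unfold fLame
  fun_prop

theorem hasAction_fLame {D : SeparatedData} {i : Fin 3} {h : ℝ} (hh : 0 < h) {L : AngMom}
    (hL : L ∈ reducedPhaseSpace h) (hlo : D.lo i = 0) (hhi : D.hi i = fLame L / (2 * h))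
    (hpsq : ∀ s, D.sqMomentum i s = (fLame L - 2 * h * s) / (4 * s * (s - 1) ^ 2)) :
    D.HasAction i (√(2 * h) - √(2 * h - fLame L)) := by
  have hf := two_mul_sub_fLame hL
  have hle : fLame L ≤ 2 * h := by
    have : 0 ≤ ell23 L ^ 2 + ell24 L ^ 2 + ell34 L ^ 2 := by positivity
    linarith
  have hh' : 2 * h ≠ 0 := by linarith
  convert hasAction_radial (c := 2 * h) (w := fLame L / (2 * h)) (by linarith)
    (div_nonneg (fLame_nonneg L) (by linarith)) (div_le_one_of_le₀ hle (by linarith)) hlo hhi ?_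
    using 3
  · field_simp
  · intro s
    rw [hpsq, mul_sub, mul_div_cancel₀ _ hh']

/-! ### The spherical system -/

theorem spherical_actionImageIsTriangle {h : ℝ} (hh : 0 < h) :
    ActionImageIsTriangle h (spherical h) := by
  have hl : ∀ L ∈ reducedPhaseSpace h, |ell34 L| ≤ √(2 * h - fLame L) := by
    intro L hL
    refine Real.abs_le_sqrt ?_
    rw [two_mul_sub_fLame hL]
    nlinarith [sq_nonneg (ell23 L), sq_nonneg (ell24 L)]
  obtain ⟨-, -, -, -, -, c6⟩ := continuous_ell
  have cf := continuous_fLame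
  refine actionImageIsTriangle_of_hasAction (A := ![fun L => √(2 * h) - √(2 * h - fLame L),
    fun L => √(2 * h - fLame L) - |ell34 L|, fun L => |ell34 L|]) ?_ ?_ ?_ ?_ ?_
  · intro L hL i
    have hf := two_mul_sub_fLame hL
    fin_cases i
    · exact hasAction_fLame hh hL rfl rfl fun s => rfl
    · have hle : ell34 L ^ 2 ≤ 2 * h - fLame L := by
        rw [hf]
        nlinarith [sq_nonneg (ell23 L), sq_nonneg (ell24 L)]
      have hc : 0 ≤ 2 * h - fLame L := (sq_nonneg _).trans hle
      -- This survives the division by zero at f = 2h, because ℓ₃₄ = 0 there.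
      have hcw : (2 * h - fLame L) * (ell34 L ^ 2 / (2 * h - fLame L)) = ell34 L ^ 2 := by
        rcases hc.eq_or_lt with h0 | h0
        · rw [← h0, zero_mul]
          exact le_antisymm (sq_nonneg _) (by rwa [← h0] at hle)
        · rw [mul_div_cancel₀ _ h0.ne']
      have h1 : ell34 L ^ 2 / (2 * h - fLame L) ≤ 1 := div_le_one_of_le₀ hle hc
      have h2 : 0 ≤ ell34 L ^ 2 / (2 * h - fLame L) := div_nonneg (sq_nonneg _) hc
      change (spherical h L).HasAction 1 (√(2 * h - fLame L) - |ell34 L|)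
      convert hasAction_radial (D := spherical h L) (i := 1) (c := 2 * h - fLame L)
        (w := 1 - ell34 L ^ 2 / (2 * h - fLame L)) hc (by linarith) (by linarith) rfl rfl ?_ using 2
      · rw [sub_sub_cancel, hcw, Real.sqrt_sq_eq_abs]
      · intro s
        change ((fLame L - 2 * h) * (s - 1) - ell34 L ^ 2) / (4 * s * (s - 1) ^ 2) = _
        congr 1
        linear_combination hcw
    · exact hasAction_angular rfl rfl fun s => rfl
  · intro i
    fin_cases i
    · exact Continuous.continuousOn (by fun_prop : Continuous fun L => √(2 * h) - √(2 * h - fLame L))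
    · exact Continuous.continuousOn
        (by fun_prop : Continuous fun L => √(2 * h - fLame L) - |ell34 L|)
    · exact Continuous.continuousOn (by fun_prop : Continuous fun L => |ell34 L|)
  · intro L hL i
    fin_cases i
    · exact sub_nonneg.mpr (Real.sqrt_le_sqrt (by linarith [fLame_nonneg L]))
    · exact sub_nonneg.mpr (hl L hL)
    · exact abs_nonneg (ell34 L)
  · intro L _
    change √(2 * h) - √(2 * h - fLame L) + (√(2 * h - fLame L) - |ell34 L|) + |ell34 L| = _
    ring
  · intro x y z hx hy hz hsum
    have hE := Real.sq_sqrt (by linarith : 0 ≤ 2 * h)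
    have q1 : √(2 * h - (y + z) ^ 2) ^ 2 = 2 * h - (y + z) ^ 2 :=
      Real.sq_sqrt (by rw [← hE, ← hsum]; nlinarith)
    have q2 : √((y + z) ^ 2 - z ^ 2) ^ 2 = (y + z) ^ 2 - z ^ 2 := Real.sq_sqrt (by nlinarith)
    -- Chosen so that 2h - f = (y + z)² and ℓ₃₄ = z, with a zero factor in every Plücker product.
    let L : AngMom := ![0, √(2 * h - (y + z) ^ 2), 0, √((y + z) ^ 2 - z ^ 2), 0, z]
    have l1 : ell12 L = 0 := rfl
    have l2 : ell13 L = √(2 * h - (y + z) ^ 2) := rfl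
    have l3 : ell14 L = 0 := rfl
    have l4 : ell23 L = √((y + z) ^ 2 - z ^ 2) := rfl
    have l5 : ell24 L = 0 := rfl
    have l6 : ell34 L = z := rfl
    have hfL : √(2 * h - fLame L) = y + z := by
      rw [← Real.sqrt_sq (by linarith : 0 ≤ y + z)]
      congr 1
      unfold fLame
      rw [l1, l2, l3, q1]
      ring
    refine ⟨L, ⟨?_, ?_⟩, ?_, ?_, ?_⟩
    · unfold casimir₁
      rw [l1, l2, l3, l4, l5, l6, q1, q2]
      ring
    · unfold casimir₂
      rw [l1, l3, l5]
      ring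
    · change √(2 * h) - √(2 * h - fLame L) = x
      rw [hfL]; linarith
    · change √(2 * h - fLame L) - |ell34 L| = y
      rw [hfL, l6, abs_of_nonneg hz]; ring
    · change |ell34 L| = z
      rw [l6, abs_of_nonneg hz]

/-! ### The cylindrical system -/

/-- In the square of the left side, the Plücker relation turns the mixed term into 2|ℓ₁₃ ℓ₂₄ - ℓ₁₄
ℓ₂₃|, at most the sum of the four other squares. -/
theorem abs_ell12_add_abs_ell34_le {h : ℝ} {L : AngMom} (hL : L ∈ reducedPhaseSpace h) :
    |ell12 L| + |ell34 L| ≤ √(2 * h) := by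
  refine Real.le_sqrt_of_sq_le ?_
  rw [add_sq, sq_abs, sq_abs, mul_assoc, ← abs_mul,
    show ell12 L * ell34 L = ell13 L * ell24 L - ell14 L * ell23 L by
      have := hL.2
      unfold casimir₂ at this
      linarith, ← hL.1]
  unfold casimir₁
  have : |ell13 L * ell24 L - ell14 L * ell23 L|
      ≤ (ell13 L ^ 2 + ell24 L ^ 2 + ell14 L ^ 2 + ell23 L ^ 2) / 2 := by
    refine abs_le.mpr ⟨?_, ?_⟩
    · nlinarith [sq_nonneg (ell13 L + ell24 L), sq_nonneg (ell14 L - ell23 L)]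
    · nlinarith [sq_nonneg (ell13 L - ell24 L), sq_nonneg (ell14 L + ell23 L)]
  linarith

theorem hasAction_cylindrical {h : ℝ} (hh : 0 < h) {L : AngMom} (hL : L ∈ reducedPhaseSpace h) :
    (cylindrical h L).HasAction 1 (√(2 * h) - |ell12 L| - |ell34 L|) := by
  have habs := abs_ell12_add_abs_ell34_le hL
  obtain ⟨e, he⟩ : ∃ e, e = √(2 * h) := ⟨_, rfl⟩
  have he0 : 0 < e := by rw [he]; exact Real.sqrt_pos.mpr (by linarith)
  have hE : 2 * h = e ^ 2 := by rw [he, Real.sq_sqrt (by linarith)]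
  obtain ⟨k, hk⟩ : ∃ k, k = |ell12 L| := ⟨_, rfl⟩
  obtain ⟨l, hl⟩ : ∃ l, l = |ell34 L| := ⟨_, rfl⟩
  have hk0 : 0 ≤ k := hk ▸ abs_nonneg _
  have hl0 : 0 ≤ l := hl ▸ abs_nonneg _
  have hk2 : ell12 L ^ 2 = k ^ 2 := by rw [hk, sq_abs]
  have hl2 : ell34 L ^ 2 = l ^ 2 := by rw [hl, sq_abs]
  rw [← hk, ← hl, ← he] at habs ⊢
  -- The test point k/e is the geometric mean of the expected roots, whose product is k²/e². The
  -- value there is (k/e)(l² - (e - k)²), nonpositive because k + l ≤ e.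
  obtain ⟨hf, h1, h2⟩ := quadratic_roots (E := 2 * h) (b := -(2 * h + ell12 L ^ 2 - ell34 L ^ 2))
    (c := ell12 L ^ 2) (s₀ := k / e) (by linarith) (by
      rw [hk2, hl2, hE, show e ^ 2 * (k / e) ^ 2 + -(e ^ 2 + k ^ 2 - l ^ 2) * (k / e) + k ^ 2
        = k / e * (l ^ 2 - (e - k) ^ 2) by field_simp; ring]
      exact mul_nonpos_of_nonneg_of_nonpos (by positivity) (by nlinarith))
  have hr1 : (cylindrical h L).lo 1 = smallRoot (2 * h) (-(2 * h + ell12 L ^ 2 - ell34 L ^ 2))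
    (ell12 L ^ 2) := rfl
  have hr2 : (cylindrical h L).hi 1 = largeRoot (2 * h) (-(2 * h + ell12 L ^ 2 - ell34 L ^ 2))
    (ell12 L ^ 2) := rfl
  have hp : ∀ s, (cylindrical h L).sqMomentum 1 s = (ell12 L ^ 2 * (s - 1)
    - s * (2 * h * (s - 1) + ell34 L ^ 2)) / (4 * (s - 1) ^ 2 * s ^ 2) := fun s => rfl
  generalize smallRoot (2 * h) (-(2 * h + ell12 L ^ 2 - ell34 L ^ 2)) (ell12 L ^ 2) = r₁ at *
  generalize largeRoot (2 * h) (-(2 * h + ell12 L ^ 2 - ell34 L ^ 2)) (ell12 L ^ 2) = r₂ at *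
  rw [hk2, hl2, hE] at hf
  have hke : k / e ≤ 1 := div_le_one_of_le₀ (by linarith) he0.le
  have hr0 : 0 ≤ r₁ := by
    by_contra hneg
    have h3 := hf r₁
    have h4 : 0 < -r₁ := by linarith
    have h6 : 0 ≤ e ^ 2 + k ^ 2 - l ^ 2 := by nlinarith
    have h7 : 0 < e ^ 2 * (-r₁) ^ 2 := by positivity
    have h8 := mul_nonneg h6 h4.le
    rw [sub_self, zero_mul, mul_zero] at h3
    nlinarith
  have hr3 : r₂ ≤ 1 := by
    by_contra hgt
    have h3 := hf r₂
    have h4 : 0 < r₂ - 1 := by linarith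
    have h5 : e ^ 2 * r₂ ^ 2 + -(e ^ 2 + k ^ 2 - l ^ 2) * r₂ + k ^ 2
      = e ^ 2 * (r₂ - 1) ^ 2 + (e ^ 2 - k ^ 2 + l ^ 2) * (r₂ - 1) + l ^ 2 := by ring
    have h6 : 0 ≤ e ^ 2 - k ^ 2 + l ^ 2 := by nlinarith
    have h7 : 0 < e ^ 2 * (r₂ - 1) ^ 2 := by positivity
    have h8 := mul_nonneg h6 h4.le
    rw [sub_self, mul_zero, mul_zero, h5] at h3
    nlinarith
  convert hasAction_semicircle (D := cylindrical h L) (i := 1) (c := e ^ 2) (sq_nonneg _) hr0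
    (h1.trans h2) hr3 hr1 hr2 ?_ using 1
  · have v0 := hf 0
    have v1 := hf 1
    have s1 : √(r₁ * r₂) = k / e := by
      rw [← Real.sqrt_sq (div_nonneg hk0 he0.le)]
      congr 1
      field_simp
      linear_combination -v0
    have s2 : √((1 - r₁) * (1 - r₂)) = l / e := by
      rw [← Real.sqrt_sq (div_nonneg hl0 he0.le)]
      congr 1
      field_simp
      linear_combination -v1
    rw [s1, s2, Real.sqrt_sq he0.le]
    field_simp
  · intro s _
    rw [hp, hk2, hl2, hE, show k ^ 2 * (s - 1) - s * (e ^ 2 * (s - 1) + l ^ 2)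
      = -(e ^ 2 * s ^ 2 + -(e ^ 2 + k ^ 2 - l ^ 2) * s + k ^ 2) by ring, hf]
    congr 1 <;> ring

theorem cylindrical_actionImageIsTriangle {h : ℝ} (hh : 0 < h) :
    ActionImageIsTriangle h (cylindrical h) := by
  obtain ⟨c1, -, -, -, -, c6⟩ := continuous_ell
  refine actionImageIsTriangle_of_hasAction (A := ![fun L => |ell12 L|,
    fun L => √(2 * h) - |ell12 L| - |ell34 L|, fun L => |ell34 L|]) ?_ ?_ ?_ ?_ ?_
  · intro L hL i
    fin_cases i
    · exact hasAction_angular rfl rfl fun s => rfl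
    · exact hasAction_cylindrical hh hL
    · exact hasAction_angular rfl rfl fun s => rfl
  · intro i
    fin_cases i
    · exact Continuous.continuousOn (by fun_prop : Continuous fun L => |ell12 L|)
    · exact Continuous.continuousOn
        (by fun_prop : Continuous fun L => √(2 * h) - |ell12 L| - |ell34 L|)
    · exact Continuous.continuousOn (by fun_prop : Continuous fun L => |ell34 L|)
  · intro L hL i
    fin_cases i
    · exact abs_nonneg (ell12 L)
    · change 0 ≤ √(2 * h) - |ell12 L| - |ell34 L|
      linarith [abs_ell12_add_abs_ell34_le hL]
    · exact abs_nonneg (ell34 L)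
  · intro L _
    change |ell12 L| + (√(2 * h) - |ell12 L| - |ell34 L|) + |ell34 L| = _
    ring
  · intro x y z hx hy hz hsum
    have hE := Real.sq_sqrt (by linarith : 0 ≤ 2 * h)
    have q1 : √(2 * h - (x - z) ^ 2) ^ 2 = 2 * h - (x - z) ^ 2 :=
      Real.sq_sqrt (by rw [← hE, ← hsum]; nlinarith)
    have q2 : √(2 * h - (x + z) ^ 2) ^ 2 = 2 * h - (x + z) ^ 2 :=
      Real.sq_sqrt (by rw [← hE, ← hsum]; nlinarith)
    obtain ⟨u, hu⟩ : ∃ u, u = √(2 * h - (x - z) ^ 2) := ⟨_, rfl⟩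
    obtain ⟨v, hv⟩ : ∃ v, v = √(2 * h - (x + z) ^ 2) := ⟨_, rfl⟩
    rw [← hu] at q1
    rw [← hv] at q2
    -- With ℓ₁₂ = x, ℓ₃₄ = z and ℓ₁₄ = ℓ₂₃ = 0, the Casimirs prescribe ℓ₁₃ ± ℓ₂₄, whose squares are
    -- 2h - (x ∓ z)².
    refine ⟨![x, (u + v) / 2, 0, 0, (u - v) / 2, z], ⟨?_, ?_⟩, ?_, ?_, ?_⟩
    · change x ^ 2 + ((u + v) / 2) ^ 2 + 0 ^ 2 + 0 ^ 2 + ((u - v) / 2) ^ 2 + z ^ 2 = 2 * h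
      linear_combination (q1 + q2) / 2
    · change x * z - (u + v) / 2 * ((u - v) / 2) + 0 * 0 = 0
      linear_combination (q2 - q1) / 4
    · exact abs_of_nonneg hx
    · change √(2 * h) - |x| - |z| = y
      rw [abs_of_nonneg hx, abs_of_nonneg hz]; linarith
    · exact abs_of_nonneg hz

/-! ### The Lamé system -/

/-- The share of the first elliptic action as a function of the root `r`. -/
def lameShare (f₁ f₂ f₃ r : ℝ) : ℝ := partialAction (1 / 2) f₁ f₂ f₃ (f₃ + 1) f₁ f₂ (r, f₃ + 1)

/-- A fictitious root and a fictitious pole, both at f₃ + 1, cancel in the radicand and leave the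
three poles of the Lamé system. Any point beyond f₃ would serve. The results on four simple poles
then apply. -/
theorem mem_rootRegion_lame {f₁ f₂ f₃ r : ℝ} (h23 : f₂ < f₃)
    (hr : r ∈ Icc f₁ f₃) : (r, f₃ + 1) ∈ rootRegion f₁ f₂ f₃ (f₃ + 1) := by
  refine ⟨hr.1, hr.2, ?_, ?_, ?_⟩ <;> simp only <;> linarith [hr.2]

theorem partialAction_scale {c e₁ e₂ e₃ e₄ x y : ℝ} (p : ℝ × ℝ) :
    partialAction (c / 2) e₁ e₂ e₃ e₄ x y p = √c * partialAction (1 / 2) e₁ e₂ e₃ e₄ x y p := by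
  unfold partialAction
  rw [show 2 * (c / 2) = c by ring, show (2 : ℝ) * (1 / 2) = 1 by norm_num, Real.sqrt_one]
  ring

/-- On [f₃, f₃ + 1], below the fictitious root, the density vanishes, so the first two intervals
carry the whole integral π. -/
theorem lameShare_add {f₁ f₂ f₃ r : ℝ} (h12 : f₁ < f₂) (h23 : f₂ < f₃) (hr : r ∈ Icc f₁ f₃) :
    lameShare f₁ f₂ f₃ r + partialAction (1 / 2) f₁ f₂ f₃ (f₃ + 1) f₂ f₃ (r, f₃ + 1) = 1 := by
  have h34 : f₃ < f₃ + 1 := by linarith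
  have hi := intervalIntegrable_dens h12 h23 h34 r (f₃ + 1)
  obtain ⟨p1, p2, p3, p4, p5⟩ := mem_rootRegion_lame h23 hr
  have h := integral_dens h12 h23 h34 p1 p2 p3 p4 p5
  rw [← intervalIntegral.integral_add_adjacent_intervals (hi f₁ f₂) (hi f₂ _),
    ← intervalIntegral.integral_add_adjacent_intervals (hi f₂ f₃) (hi f₃ _),
    integral_eq_zero_of_forall_Ioo h34.le fun s hs =>
      (dens_right h12.le h23.le p2 hs).2 hs.2.le, add_zero] at h
  unfold lameShare partialAction
  rw [← mul_add, h]
  simp [Real.pi_ne_zero]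

theorem continuousOn_lameShare {f₁ f₂ f₃ : ℝ} (h12 : f₁ < f₂) (h23 : f₂ < f₃) :
    ContinuousOn (lameShare f₁ f₂ f₃) (Icc f₁ f₃) := by
  have h34 : f₃ < f₃ + 1 := by linarith
  have hc := (continuousOn_integral_dens (f₁ := f₁) (f₂ := f₂) (f₃ := f₃) (f₄ := f₃ + 1)
    (intervalIntegrable_invSqrtDist_four h12.ne (h12.trans h23).ne
    (h12.trans (h23.trans h34)).ne h23.ne (h23.trans h34).ne h34.ne f₁ f₂)
    (fun s => by unfold invSqrtDist; positivity)
    fun p _ s => dens_le_of_simple _ _ _ _ _ _ s).2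
  exact (hc.comp (f := fun r : ℝ => (r, f₃ + 1)) (Continuous.continuousOn (by fun_prop))
    fun r hr => mem_rootRegion_lame h23 hr).const_mul _

theorem lameShare_mem {f₁ f₂ f₃ r : ℝ} (h12 : f₁ < f₂) (h23 : f₂ < f₃) (hr : r ∈ Icc f₁ f₃) :
    lameShare f₁ f₂ f₃ r ∈ Icc 0 1 := by
  refine ⟨partialAction_nonneg h12.le _, ?_⟩
  have := lameShare_add h12 h23 hr
  have := partialAction_nonneg (h := 1 / 2) (e₁ := f₁) (e₂ := f₂) (e₃ := f₃) (e₄ := f₃ + 1) h23.le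
    (r, f₃ + 1)
  linarith

theorem exists_lameShare_eq {f₁ f₂ f₃ t : ℝ} (h12 : f₁ < f₂) (h23 : f₂ < f₃) (ht : t ∈ Icc 0 1) :
    ∃ r ∈ Icc f₁ f₃, lameShare f₁ f₂ f₃ r = t := by
  have h13 := (h12.trans h23).le
  have e0 : lameShare f₁ f₂ f₃ f₁ = 0 := partialAction_eq_zero h12.le fun s hs =>
    (dens_left h23.le (by linarith) (by simp only; linarith) hs).2 hs.1.le
  have e1 : lameShare f₁ f₂ f₃ f₃ = 1 := by
    have h := lameShare_add h12 h23 (right_mem_Icc.mpr h13)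
    rwa [partialAction_mid_eq_zero h12.le h23.le (by linarith)
      (mem_rootRegion_lame h23 (right_mem_Icc.mpr h13)) (Or.inl rfl), add_zero] at h
  exact intermediate_value_Icc h13 (continuousOn_lameShare h12 h23) (by rwa [e0, e1])

theorem lameRoot_spec {h f₁ f₂ f₃ : ℝ} (h12 : f₁ < f₂) (h23 : f₂ < f₃) {L : AngMom}
    (hL : L ∈ reducedPhaseSpace h) :
    lameRoot h f₁ f₂ f₃ L ∈ Icc f₁ f₃ ∧
      (2 * h - fLame L) * lameRoot h f₁ f₂ f₃ L = gLame f₁ f₂ f₃ L := by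
  have hf := two_mul_sub_fLame hL
  have s1 := sq_nonneg (ell23 L)
  have s2 := sq_nonneg (ell24 L)
  have s3 := sq_nonneg (ell34 L)
  unfold lameRoot
  split_ifs with h0
  · refine ⟨⟨h12.le, h23.le⟩, ?_⟩
    rw [h0, sub_self] at hf ⊢
    have z1 : ell23 L ^ 2 = 0 := by linarith
    have z2 : ell24 L ^ 2 = 0 := by linarith
    have z3 : ell34 L ^ 2 = 0 := by linarith
    unfold gLame
    rw [z1, z2, z3]
    ring
  · have hc : 0 < 2 * h - fLame L :=
      lt_of_le_of_ne (by rw [hf]; positivity) fun h => h0 (by linarith)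
    refine ⟨⟨?_, ?_⟩, by field_simp⟩
    · rw [le_div_iff₀ hc, hf]
      unfold gLame
      nlinarith
    · rw [div_le_iff₀ hc, hf]
      unfold gLame
      nlinarith

theorem lame_hasAction {h f₁ f₂ f₃ : ℝ} (hh : 0 < h) (h12 : f₁ < f₂) (h23 : f₂ < f₃) {L : AngMom}
    (hL : L ∈ reducedPhaseSpace h) :
    (lame h f₁ f₂ f₃ L).HasAction 0 (√(2 * h) - √(2 * h - fLame L)) ∧
    (lame h f₁ f₂ f₃ L).HasAction 1
      (√(2 * h - fLame L) * lameShare f₁ f₂ f₃ (lameRoot h f₁ f₂ f₃ L)) ∧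
    (lame h f₁ f₂ f₃ L).HasAction 2 (√(2 * h - fLame L) -
      √(2 * h - fLame L) * lameShare f₁ f₂ f₃ (lameRoot h f₁ f₂ f₃ L)) := by
  obtain ⟨hr, hg⟩ := lameRoot_spec h12 h23 hL
  have hp := mem_rootRegion_lame h23 hr
  have h34 : f₃ < f₃ + 1 := by linarith
  have hi := intervalIntegrable_dens h12 h23 h34 (lameRoot h f₁ f₂ f₃ L) (f₃ + 1)
  have hc : 0 ≤ (2 * h - fLame L) / 2 := by
    rw [two_mul_sub_fLame hL]
    positivity
  have hpsq : ∀ s, s < f₃ → -((fLame L - 2 * h) * s + gLame f₁ f₂ f₃ L) /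
      (4 * (f₃ - s) * (s - f₁) * (s - f₂)) = 2 * ((2 * h - fLame L) / 2) / 4 *
      (-((s - lameRoot h f₁ f₂ f₃ L) * (s - (f₃ + 1))) /
        ((s - f₁) * (s - f₂) * (s - f₃) * (s - (f₃ + 1)))) := by
    intro s hs
    have hne : s - (f₃ + 1) ≠ 0 := by linarith
    rw [← neg_mul, mul_div_mul_right _ _ hne, ← hg, div_mul_div_comm, ← neg_div_neg_eq]
    congr 1 <;> ring
  refine ⟨hasAction_fLame hh hL rfl rfl fun s => ?_, ?_, ?_⟩
  · change (fLame L - 2 * h * s) / (4 * (s - 1) ^ 2 * s) = _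
    congr 1
    ring
  · unfold lameShare
    rw [← partialAction_scale]
    exact hasAction_left hc h12.le h23.le h34.le hp rfl rfl
      (fun s hs => hpsq s (hs.2.trans h23)) hi
  · have hsum := lameShare_add h12 h23 hr
    rw [← mul_one_sub, ← hsum, add_sub_cancel_left, ← partialAction_scale]
    exact hasAction_mid hc h12.le h23.le h34.le hp (max_comm _ _)
      (min_eq_right h34.le).symm (fun s hs => hpsq s hs.2) hi

theorem continuousOn_lame_action {h f₁ f₂ f₃ : ℝ} (h12 : f₁ < f₂) (h23 : f₂ < f₃) :
    ContinuousOn (fun L => √(2 * h - fLame L) * lameShare f₁ f₂ f₃ (lameRoot h f₁ f₂ f₃ L))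
      (reducedPhaseSpace h) := by
  have cf := continuous_fLame
  have cs : Continuous fun L => √(2 * h - fLame L) := by fun_prop
  have cg : Continuous (gLame f₁ f₂ f₃) := by
    obtain ⟨-, -, -, c4, c5, c6⟩ := continuous_ell
    unfold gLame
    fun_prop
  intro L hL
  -- At f = 2h the root may jump, but the share stays in [0, 1] and its factor √(2h - f) tends to 0.
  by_cases h0 : fLame L = 2 * h
  · have hz : √(2 * h - fLame L) = 0 := by rw [h0, sub_self, Real.sqrt_zero]
    unfold ContinuousWithinAt
    beta_reduce
    rw [hz, zero_mul]
    have hlim : Tendsto (fun L => √(2 * h - fLame L)) (𝓝[reducedPhaseSpace h] L) (𝓝 0) := by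
      rw [← hz]
      exact cs.continuousWithinAt
    refine squeeze_zero' ?_ ?_ hlim
    · filter_upwards [self_mem_nhdsWithin] with L' hL'
      exact mul_nonneg (Real.sqrt_nonneg _) (lameShare_mem h12 h23 (lameRoot_spec h12 h23 hL').1).1
    · filter_upwards [self_mem_nhdsWithin] with L' hL'
      exact mul_le_of_le_one_right (Real.sqrt_nonneg _)
        (lameShare_mem h12 h23 (lameRoot_spec h12 h23 hL').1).2
  · have hroot : ContinuousWithinAt (lameRoot h f₁ f₂ f₃) (reducedPhaseSpace h) L := by
      have hq : ContinuousAt (fun L => gLame f₁ f₂ f₃ L / (2 * h - fLame L)) L :=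
        cg.continuousAt.div (by fun_prop) (sub_ne_zero.mpr (Ne.symm h0))
      refine (hq.congr ?_).continuousWithinAt
      filter_upwards [cf.continuousAt.eventually_ne h0] with L' hL'
      unfold lameRoot
      rw [if_neg hL']
    exact cs.continuousWithinAt.mul (((continuousOn_lameShare h12 h23) _
      (lameRoot_spec h12 h23 hL).1).comp hroot fun L' hL' => (lameRoot_spec h12 h23 hL').1)

theorem lame_actionImageIsTriangle {h f₁ f₂ f₃ : ℝ} (hh : 0 < h) (h12 : f₁ < f₂) (h23 : f₂ < f₃) :
    ActionImageIsTriangle h (lame h f₁ f₂ f₃) := by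
  have cf := continuous_fLame
  have cs : Continuous fun L => √(2 * h - fLame L) := by fun_prop
  have hmem := fun L (hL : L ∈ reducedPhaseSpace h) =>
    lameShare_mem h12 h23 (lameRoot_spec h12 h23 hL).1
  refine actionImageIsTriangle_of_hasAction (A := ![fun L => √(2 * h) - √(2 * h - fLame L),
    fun L => √(2 * h - fLame L) * lameShare f₁ f₂ f₃ (lameRoot h f₁ f₂ f₃ L),
    fun L => √(2 * h - fLame L) -
      √(2 * h - fLame L) * lameShare f₁ f₂ f₃ (lameRoot h f₁ f₂ f₃ L)]) ?_ ?_ ?_ ?_ ?_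
  · intro L hL i
    obtain ⟨a0, a1, a2⟩ := lame_hasAction hh h12 h23 hL
    fin_cases i
    exacts [a0, a1, a2]
  · intro i
    fin_cases i
    · exact (continuous_const.sub cs).continuousOn
    · exact continuousOn_lame_action h12 h23
    · exact cs.continuousOn.sub (continuousOn_lame_action h12 h23)
  · intro L hL i
    fin_cases i
    · exact sub_nonneg.mpr (Real.sqrt_le_sqrt (by linarith [fLame_nonneg L]))
    · exact mul_nonneg (Real.sqrt_nonneg _) (hmem L hL).1
    · exact sub_nonneg.mpr (mul_le_of_le_one_right (Real.sqrt_nonneg _) (hmem L hL).2)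
  · intro L _
    simp only [Matrix.cons_val]
    ring
  · intro x y z hx hy hz hsum
    have hyz : 0 ≤ y + z := by linarith
    -- If y + z = 0 the quotient is 0 by convention; the share is then irrelevant, being multiplied
    -- by 0.
    have ht : y / (y + z) ∈ Icc (0 : ℝ) 1 :=
      ⟨div_nonneg hy hyz, div_le_one_of_le₀ (by linarith) hyz⟩
    obtain ⟨r, hr, hrt⟩ := exists_lameShare_eq h12 h23 ht
    have d : 0 < f₃ - f₁ := by linarith
    have hE := Real.sq_sqrt (by linarith : 0 ≤ 2 * h)
    have q1 : √(2 * h - (y + z) ^ 2) ^ 2 = 2 * h - (y + z) ^ 2 :=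
      Real.sq_sqrt (by rw [← hE, ← hsum]; nlinarith)
    have q2 := Real.sq_sqrt (div_nonneg (sub_nonneg.mpr hr.1) d.le)
    have q3 := Real.sq_sqrt (div_nonneg (sub_nonneg.mpr hr.2) d.le)
    -- Here 2h - f = (y + z)², and ℓ₃₄², ℓ₂₃² divide it with the weights that express r as a convex
    -- combination of f₁ and f₃.
    let L : AngMom := ![0, √(2 * h - (y + z) ^ 2), 0, (y + z) * √((r - f₁) / (f₃ - f₁)), 0,
      (y + z) * √((f₃ - r) / (f₃ - f₁))]
    have hfL : fLame L = 2 * h - (y + z) ^ 2 := by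
      change 0 ^ 2 + √(2 * h - (y + z) ^ 2) ^ 2 + 0 ^ 2 = _
      rw [q1]
      ring
    have hs : √(2 * h - fLame L) = y + z := by
      rw [hfL, sub_sub_cancel, Real.sqrt_sq hyz]
    have hL : L ∈ reducedPhaseSpace h := by
      refine ⟨?_, ?_⟩
      · change 0 ^ 2 + √(2 * h - (y + z) ^ 2) ^ 2 + 0 ^ 2
          + ((y + z) * √((r - f₁) / (f₃ - f₁))) ^ 2 + 0 ^ 2
          + ((y + z) * √((f₃ - r) / (f₃ - f₁))) ^ 2 = _
        rw [q1, mul_pow, mul_pow, q2, q3]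
        field_simp
        ring
      · change 0 * _ - √(2 * h - (y + z) ^ 2) * 0 + 0 * _ = (0 : ℝ)
        ring
    have hg : gLame f₁ f₂ f₃ L = (y + z) ^ 2 * r := by
      change f₁ * ((y + z) * √((f₃ - r) / (f₃ - f₁))) ^ 2 + f₂ * 0 ^ 2
        + f₃ * ((y + z) * √((r - f₁) / (f₃ - f₁))) ^ 2 = _
      rw [mul_pow, mul_pow, q2, q3]
      field_simp
      ring
    have hy1 : √(2 * h - fLame L) * lameShare f₁ f₂ f₃ (lameRoot h f₁ f₂ f₃ L) = y := by
      rw [hs]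
      rcases hyz.eq_or_lt with h0 | h0
      · rw [← h0, zero_mul]
        linarith
      · have hroot : lameRoot h f₁ f₂ f₃ L = r := by
          have h1 := (lameRoot_spec h12 h23 hL).2
          rw [hg, hfL, sub_sub_cancel] at h1
          exact mul_left_cancel₀ (by positivity) h1
        rw [hroot, hrt, mul_div_cancel₀ _ h0.ne']
    refine ⟨L, hL, ?_, hy1, ?_⟩
    · change √(2 * h) - √(2 * h - fLame L) = x
      rw [hs]
      linarith
    · change √(2 * h - fLame L) -
        √(2 * h - fLame L) * lameShare f₁ f₂ f₃ (lameRoot h f₁ f₂ f₃ L) = z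
      rw [hy1, hs]
      ring

end SphereActions

end

theorem mainTheorem3 (h : ℝ) (hh : 0 < h) :
    (∃ T : Affine.Triangle ℝ (EuclideanSpace ℝ (Fin 3)),
      T.Equilateral ∧ T.closedInterior = SphereActions.actionTriangle h) ∧
    (∀ e₁ e₂ e₃ e₄ : ℝ, e₁ < e₂ → e₂ < e₃ → e₃ < e₄ →
      SphereActions.ActionImageIsTriangle h (SphereActions.ellipsoidal h e₁ e₂ e₃ e₄)) ∧
    (∀ b : ℝ, 1 < b →
      SphereActions.ActionImageIsTriangle h (SphereActions.prolate h b)) ∧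
    (∀ a : ℝ, 1 < a →
      SphereActions.ActionImageIsTriangle h (SphereActions.oblate h a)) ∧
    (∀ f₁ f₂ f₃ : ℝ, f₁ < f₂ → f₂ < f₃ →
      SphereActions.ActionImageIsTriangle h (SphereActions.lame h f₁ f₂ f₃)) ∧
    SphereActions.ActionImageIsTriangle h (SphereActions.spherical h) ∧
    SphereActions.ActionImageIsTriangle h (SphereActions.cylindrical h) := by
  exact ⟨SphereActions.exists_equilateral_triangle hh,
    fun _ _ _ _ h12 h23 h34 => SphereActions.ellipsoidal_actionImageIsTriangle hh h12 h23 h34,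
    fun _ hb => SphereActions.prolate_actionImageIsTriangle hh hb,
    fun _ ha => SphereActions.oblate_actionImageIsTriangle hh ha,
    fun _ _ _ h12 h23 => SphereActions.lame_actionImageIsTriangle hh h12 h23,
    SphereActions.spherical_actionImageIsTriangle hh,
    SphereActions.cylindrical_actionImageIsTriangle hh⟩
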